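/- **Setting.** Let $\mathcal U$ be a finite ground set with $n$ elements and let $f:2^{\mathcal U}\to\mathbb R_{\ge 0}$ be submodular, i.e. $f(T+x)-f(T)\le f(S+x)-f(S)$ for all $S\subseteq T\subseteq\mathcal U$ and $x\notin T$ ($f$ need not be monotone), accessible only through a value oracle. Let $0<\varepsilon<0.377$, $\varepsilon'=\varepsilon/2$, $\ell_1=\lceil 10/(3\varepsilon)\rceil$, $\ell_2=\lceil 5/\varepsilon\rceil$, $t=0.3$, and let $1\le k\le n$ be divisible by $\ell_1$ and by $\ell_2$. Add $3k$ dummy elements, which never change the value of a set, to $\mathcal U$ to obtain $\mathcal U'$, and fix an order of $\mathcal U'$ (any order of $\mathcal U$, followed by the dummy elements). Write $\Delta(x\mid A)=f(A\cup\{x\})-f(A)$. **ThreshGuidedIG$(Z,G,\ell)$.** Let $a_1,\dots,a_\ell$ be the $\ell$ elements of $\mathcal U'\setminus(G\cup Z)$ of largest gain $\Delta(\cdot\mid G)$, in decreasing order. For $u=0$ put $M=\Delta(a_\ell\mid G)$ and $A_{0,l}=G\cup\{a_l\}$ for $1\le l\le\ell$; for $1\le u\le \ell$ put $M=\Delta(a_u\mid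 G)$ and $A_{u,l}=G\cup\{a_u\}$ for $1\le l\le\ell$. For each $u$, give each $A_{u,l}$ a threshold $\tau_l=M$, and let the sets that are still running take turns $l=1,\dots,\ell$ cyclically. In its turn, $A_{u,l}$ looks, while $\tau_l\ge\varepsilon' M/k$, for an $x\in\mathcal U'\setminus(\bigcup_{l'}A_{u,l'}\cup Z)$ with $\Delta(x\mid A_{u,l})\ge\tau_l$; the first such $x$ is added to $A_{u,l}$ and the turn ends; if all elements are rejected, $\tau_l$ is multiplied by $1-\varepsilon'$ and the search is repeated. (An element already examined for $A_{u,l}$ at the current value of $\tau_l$ is not queried again.) After its turn $A_{u,l}$ stops running if $|A_{u,l}\setminus G|=k/\ell$ or $\tau_l<\varepsilon'M/k$. All $\ell(\ell+1)$ sets $A_{u,l}$ are returned. **Prune$(A)$.** Go once through the elements $x$ of $A$, replacing $A$ by $A\setminus\{x\}$ whenever $\Delta(x\mid A\setminus\{x\})<0$. **The algorithm.** Let $\mathcal Z_0=\{\emptyset\}$; for $i=1,\dots,\ell_1$ let $\mathcal Z_i$ consist of the pruned outputs of ThreshGuidedIG$(\emptyset,A,\ell_1)$ for all $A\in\mathcal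 Z_{i-1}$; let $\mathcal Z=\bigcup_{i=1}^{\ell_1}\mathcal Z_i$ (the guidance sets). For each $A\in\mathcal Z$ let $\mathcal G_0=\{\emptyset\}$ and, for $i=1,\dots,\ell_2$, let $\mathcal G_i$ consist of the outputs of ThreshGuidedIG$(A,B,\ell_2)$ if $i\le t\ell_2$, and of ThreshGuidedIG$(\emptyset,B,\ell_2)$ if $i>t\ell_2$, for all $B\in\mathcal G_{i-1}$. Return a set $C^*$ of maximum value among the members of $\mathcal Z$ and of the final families $\mathcal G_{\ell_2}$ of all $A\in\mathcal Z$, with dummy elements removed. (Families are kept as lists, with repetitions.) **Theorem.** There is an absolute constant $C>0$ such that for all such $\mathcal U,f,k,\varepsilon$ this deterministic algorithm returns a set $C^*\subseteq\mathcal U$ with $|C^*|\le k$ and $$f(C^*)\ \ge\ (0.377-\varepsilon)\,\max_{O\subseteq\mathcal U,\ |O|\le k} f(O),$$ using at most $$\frac{C}{\varepsilon^{2}}\; n\,\log (k)\;\ell_1^{2\ell_1}\,\ell_2^{2\ell_2-1}$$ oracle queries. (So for every fixed $\varepsilon$ the number of queries is $O\big(n\log(k)\,\ell_1^{2\ell_1}\ell_2^{2\ell_2-1}\big)$,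 with hidden constant $C/\varepsilon^2$.) -/

import Mathlib

namespace SubMax

universe u v w

/-- Submodularity of a set function in the form of diminishing returns. -/
def IsSubmodular {α : Type u} [DecidableEq α] (f : Finset α → ℝ) : Prop :=
  ∀ S T : Finset α, S ⊆ T → ∀ x, x ∉ T → f (insert x T) - f T ≤ f (insert x S) - f S

/-- A deterministic value-oracle algorithm over the ground set `α`, as a decision tree: it either
stops with an output, or asks the oracle for the value of a set `S` and continues depending on the
answer.  Such an algorithm has no access to the set function other than through its queries. -/
inductive OracleProg (α : Type u) (β : Type v) : Type (max u v)
  | ret (b : β) : OracleProg α β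
  | query (S : Finset α) (next : ℝ → OracleProg α β) : OracleProg α β

namespace OracleProg

variable {α : Type u} {β : Type v} {γ : Type w}

/-- Sequential composition. -/
def bind : OracleProg α β → (β → OracleProg α γ) → OracleProg α γ
  | ret b, g => g b
  | query S next, g => query S fun r => (next r).bind g

/-- The output when the oracle is the set function `f`. -/
def run (f : Finset α → ℝ) : OracleProg α β → β
  | ret b => b
  | query S next => (next (f S)).run f

/-- The number of oracle queries made when the oracle is the set function `f`. -/
def queries (f : Finset α → ℝ) : OracleProg α β → ℕ
  | ret _ => 0
  | query S next => (next (f S)).queries f + 1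

/-- Run `g` on the entries of a list, one after the other, and list the results. -/
def forEach (g : β → OracleProg α γ) : List β → OracleProg α (List γ)
  | [] => ret []
  | b :: bs => (g b).bind fun c => (forEach g bs).bind fun cs => ret (c :: cs)

/-- The loop `for b in list do s ← step s b`. -/
def loop (step : γ → β → OracleProg α γ) : List β → γ → OracleProg α γ
  | [], s => ret s
  | b :: bs, s => (step s b).bind (loop step bs)

end OracleProg

open OracleProg

section Algorithm

variable {α : Type u} [Fintype α] [LinearOrder α] {k : ℕ}

/-- The ground set together with `3 * k` dummy elements. -/
abbrev Ground (α : Type u) (k : ℕ) : Type u := α ⊕ Fin (3 * k)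

/-- The extended ground set in the fixed order in which the algorithm goes through it. -/
def elems : List (Ground α k) :=
  ((Finset.univ : Finset α).sort (· ≤ ·)).map Sum.inl ++ (List.finRange (3 * k)).map Sum.inr

/-- The value of a set; dummy elements do not contribute. One query. -/
def value (S : Finset (Ground α k)) : OracleProg α ℝ :=
  query S.toLeft ret

/-- The marginal gain `f (A ∪ {x}) - f A`. Two queries. -/
def gain (x : Ground α k) (A : Finset (Ground α k)) : OracleProg α ℝ :=
  (value (insert x A)).bind fun a => (value A).bind fun b => ret (a - b)

/-- The `ℓ` elements outside `G ∪ Z` with the largest marginal gains on `G`, in decreasing order,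
each paired with its gain. -/
noncomputable def topGains (ℓ : ℕ) (Z G : Finset (Ground α k)) :
    OracleProg α (List (Ground α k × ℝ)) :=
  (forEach (fun x => (gain x G).bind fun d => ret (x, d))
    (elems.filter fun x => x ∉ G ∪ Z)).bind fun L =>
      ret ((L.insertionSort fun p q => q.2 ≤ p.2).take ℓ)

/-- One of the `ℓ` interlaced greedy procedures: its current set, its current threshold, the
elements not yet examined at this threshold, and whether it is still running. -/
structure Thread (α : Type u) (k : ℕ) where
  set : Finset (Ground α k)
  threshold : ℝ
  todo : List (Ground α k)
  active : Bool

/-- Look through a list for the first element outside `blocked` whose gain on `A` is at least `τ`;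
return it together with the part of the list behind it. -/
noncomputable def scan (blocked A : Finset (Ground α k)) (τ : ℝ) :
    List (Ground α k) → OracleProg α (Option (Ground α k × List (Ground α k)))
  | [] => ret none
  | x :: xs =>
      if x ∈ blocked then scan blocked A τ xs
      else (gain x A).bind fun d =>
        if τ ≤ d then ret (some (x, xs)) else scan blocked A τ xs

/-- The loop `while τ ≥ τmin` of the procedure `ADD`: if some available element has gain at least
`τ`, add it and stop; otherwise multiply `τ` by `1 - ε` and look through all elements again.
An element that was already examined at the current value of `τ` in an earlier call is not
examined again: for a submodular function it would be rejected again.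
The first argument bounds the number of passes of the loop (see `levelBound`). -/
noncomputable def addLoop (ε τmin : ℝ) (blocked : Finset (Ground α k)) :
    ℕ → Thread α k → OracleProg α (Thread α k)
  | 0, t => ret t
  | n + 1, t =>
      if t.threshold < τmin then ret t
      else (scan blocked t.set t.threshold t.todo).bind fun r =>
        match r with
        | some (x, rest) => ret { t with set := insert x t.set, todo := rest }
        | none => addLoop ε τmin blocked n
            { t with threshold := (1 - ε) * t.threshold, todo := elems }

/-- A number of passes after which a threshold that starts at `M > 0` is below `ε * M / k`. -/
noncomputable def levelBound (ε : ℝ) (k : ℕ) : ℕ := ⌈Real.log (k / ε) / ε⌉₊ + 1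

/-- The bound on the number of passes in `addLoop` does not cut the loop short. (For `M = 0` the
first pass finds an element, since there are enough dummy elements.) -/
theorem levelBound_spec {ε M : ℝ} {k : ℕ} (hε : 0 < ε) (hε1 : ε < 1) (hk : 0 < k) (hM : 0 < M) :
    (1 - ε) ^ levelBound ε k * M < ε * M / k := by
  have hk' : (0 : ℝ) < k := by exact_mod_cast hk
  have h1 : Real.log (k / ε) / ε < (levelBound ε k : ℕ) := by
    have := Nat.le_ceil (Real.log (k / ε) / ε)
    unfold levelBound
    push_cast
    linarith
  have h2 : (1 - ε) ^ levelBound ε k ≤ Real.exp (-(ε * levelBound ε k)) := by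
    have h3 : 1 - ε ≤ Real.exp (-ε) := by linarith [Real.add_one_le_exp (-ε)]
    calc (1 - ε) ^ levelBound ε k ≤ Real.exp (-ε) ^ levelBound ε k :=
          pow_le_pow_left₀ (by linarith) h3 _
      _ = Real.exp (-(ε * levelBound ε k)) := by
          rw [← Real.exp_nat_mul]; congr 1; ring
  have h4 : Real.exp (-(ε * levelBound ε k)) < ε / k := by
    have h5 : Real.log (k / ε) < ε * levelBound ε k := by
      rw [div_lt_iff₀ hε] at h1; linarith
    have h6 : Real.exp (-(ε * levelBound ε k)) < Real.exp (-Real.log (k / ε)) :=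
      Real.exp_lt_exp.mpr (by linarith)
    rw [Real.exp_neg (Real.log _), Real.exp_log (by positivity), inv_div] at h6
    exact h6
  calc (1 - ε) ^ levelBound ε k * M < ε / k * M :=
        mul_lt_mul_of_pos_right (lt_of_le_of_lt h2 h4) hM
    _ = ε * M / k := by ring

/-- The turn of the `i`-th greedy procedure: if it is running, call `ADD` on the elements outside
all current sets and outside `Z`; it stops once it has added `k / ℓ` elements to `G` or its
threshold is below `τmin`. -/
noncomputable def turn (ε τmin : ℝ) (ℓ : ℕ) (Z G : Finset (Ground α k))
    (ts : List (Thread α k)) (i : ℕ) : OracleProg α (List (Thread α k)) :=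
  match ts[i]? with
  | none => ret ts
  | some t =>
      if t.active then
        (addLoop ε τmin ((ts.map Thread.set).foldr (· ∪ ·) ∅ ∪ Z) (levelBound ε k) t).bind
          fun t' => ret (ts.set i
            { t' with active := !decide ((t'.set \ G).card = k / ℓ ∨ t'.threshold < τmin) })
      else ret ts

/-- The loop `while some procedure is running: every procedure takes its turn`. The first argument
bounds the number of rounds; `k` rounds suffice, since in each round a running procedure adds an
element or stops. -/
noncomputable def rounds (ε τmin : ℝ) (ℓ : ℕ) (Z G : Finset (Ground α k)) :
    ℕ → List (Thread α k) → OracleProg α (List (Thread α k))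
  | 0, ts => ret ts
  | n + 1, ts =>
      if ts.any Thread.active then
        (loop (turn ε τmin ℓ Z G) (List.range ts.length) ts).bind (rounds ε τmin ℓ Z G n)
      else ret ts

/-- Interlaced descending-threshold greedy procedures, one for each of the sets in `start`, with
first threshold `M` and last threshold `ε * M / k`. -/
noncomputable def interlace (ε : ℝ) (ℓ : ℕ) (Z G : Finset (Ground α k)) (M : ℝ)
    (start : List (Finset (Ground α k))) : OracleProg α (List (Finset (Ground α k))) :=
  (rounds ε (ε * M / k) ℓ Z G k (start.map fun A => ⟨A, M, elems, true⟩)).bind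
    fun ts => ret (ts.map Thread.set)

/-- The guided threshold greedy subroutine `ThreshGuidedIG`. With `a 1, …, a ℓ` the top `ℓ`
elements, the case `u = 0` starts from the `ℓ` sets `G ∪ {a l}` with `M` the gain of `a ℓ`, and the
case `u ≥ 1` starts from `ℓ` copies of `G ∪ {a u}` with `M` the gain of `a u`.
All `ℓ * (ℓ + 1)` sets are returned. -/
noncomputable def threshGuidedIG (ε : ℝ) (ℓ : ℕ) (Z G : Finset (Ground α k)) :
    OracleProg α (List (Finset (Ground α k))) :=
  (topGains ℓ Z G).bind fun top =>
    (interlace ε ℓ Z G (top.getLast?.elim 0 Prod.snd) (top.map fun p => insert p.1 G)).bind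
      fun C₀ =>
        (forEach (fun p => interlace ε ℓ Z G p.2 (List.replicate ℓ (insert p.1 G))) top).bind
          fun C => ret (C₀ ++ C.flatten)

/-- Pruning: go once through the elements of `A` and delete those whose marginal gain is negative. -/
noncomputable def prune (A : Finset (Ground α k)) : OracleProg α (Finset (Ground α k)) :=
  loop (fun B x => (gain x (B.erase x)).bind fun d => ret (if d < 0 then B.erase x else B))
    (elems.filter fun x => x ∈ A) A

/-- The union of the next `n` families of pruned intermediate solutions after the family `F`. -/
noncomputable def guidanceSets (ε : ℝ) (ℓ : ℕ) :
    ℕ → List (Finset (Ground α k)) → OracleProg α (List (Finset (Ground α k)))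
  | 0, _ => ret []
  | n + 1, F =>
      (forEach (fun A => (threshGuidedIG ε ℓ ∅ A).bind (forEach prune)) F).bind fun F' =>
        (guidanceSets ε ℓ n F'.flatten).bind fun rest => ret (F'.flatten ++ rest)

/-- The guided part: `ℓ` iterations over all candidate solutions, starting from the empty set; the
iterations `i ≤ t * ℓ` are guided by `A`, the later ones are unguided. -/
noncomputable def guidedSets (ε t : ℝ) (ℓ : ℕ) (A : Finset (Ground α k)) :
    OracleProg α (List (Finset (Ground α k))) :=
  loop (fun F i =>
      (forEach (threshGuidedIG ε ℓ (if (i : ℝ) ≤ t * ℓ then A else ∅)) F).bind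
        fun F' => ret F'.flatten)
    (List.range' 1 ℓ) [∅]

/-- A set of largest value in a list. -/
noncomputable def best (L : List (Finset (Ground α k))) : OracleProg α (Finset (Ground α k)) :=
  (forEach (fun S => (value S).bind fun r => ret (S, r)) L).bind fun P =>
    ret ((P.argmax Prod.snd).elim ∅ Prod.fst)

/-- `ℓ₁ = 10 / (3 ε)`, rounded up to an integer. -/
noncomputable def ell₁ (ε : ℝ) : ℕ := ⌈10 / (3 * ε)⌉₊

/-- `ℓ₂ = 5 / ε`, rounded up to an integer. -/
noncomputable def ell₂ (ε : ℝ) : ℕ := ⌈5 / ε⌉₊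

/-- The nearly linear-time deterministic algorithm for the size constraint `k` with error rate `ε`.
Dummy elements are removed from the output. -/
noncomputable def nearlyLinearAlg (α : Type u) [Fintype α] [LinearOrder α] (k : ℕ) (ε : ℝ) :
    OracleProg α (Finset α) :=
  (guidanceSets (k := k) (ε / 2) (ell₁ ε) (ell₁ ε) [∅]).bind fun Zs =>
    (forEach (guidedSets (ε / 2) (3 / 10) (ell₂ ε)) Zs).bind fun Gs =>
      (best (Zs ++ Gs.flatten)).bind fun C => ret C.toLeft

end Algorithm

end SubMax

set_option linter.unusedSectionVars false

/-! The proof replaces the expectations of a randomized greedy argument by averages over a tree of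
candidate sets. Write ε' = ε/2, and let `F` be `f` extended to the dummies.

One call. Fix a comparison set W with |W| ≤ k that avoids the guide, and let A be an output grown
from G. Every element that A takes gains at least the current threshold τ. Since the ℓ procedures
take turns, that gain can pay for ℓ elements of W taken by the others, each of which had gain at
most τ/(1-ε') on A. What remains when the procedure stops pays for the elements of W that nobody
took, up to an error ε'M covered by the first element. This gives (1-ε')(F(W ∪ A) - F(A)) ≤
(ℓ+ε')(F(A) - F(G)) (`ThreadInv.union_sub_le`). For one of the ℓ+1 values of u, the ℓ outputs also
meet pairwise inside G ∪ W (`threshGuidedIG_good`). Then the average of F(S ∪ A) over them is at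
least (1-1/ℓ)F(S ∪ G) for every S ⊇ W (`IsSubmodular.le_sum_of_pairwise`).

Trees. Keeping only good children gives a tree with ℓ^i sets at depth i. Put q = 1-1/ℓ and κ =
(1-ε')/(ℓ+ε'). For the guidance sets, the averages z of F(A) and b of F(O ∪ A) satisfy (1+κ)z(i+1) ≥
z(i) + κq b(i) and b(i+1) ≥ q b(i). For a fixed guide Z the first ⌊0.3ℓ⌋ steps use W = O \ Z and the
later ones W = O. If F(Z) ≤ 0.377 F(O) and F(O ∪ Z) ≤ 0.92 F(O), solving the recursions gives a
final set of value at least (0.4762-ε)F(O) - 0.1288 F(Z) - 0.1085 F(O ∪ Z) (`guided_value_ge`).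
Pruning makes F(O ∩ Z) ≤ F(Z), so that F(Z) can stand in for F(O ∩ Z).

Contradiction. If the returned value is below (0.377-ε)F(O), then every guidance set satisfies
0.1288 F(Z) + 0.1085 F(O ∪ Z) ≥ 0.0992 F(O). This is linear, so it passes to the averages and bounds
b below in terms of z. Fed into the guidance recursion, it forces the last average z(ℓ) up to
(0.377-ε)F(O) (`exists_guidance_value_ge`). Some guidance set is then already that good, which is
absurd.

Queries. A potential, namely the unexamined elements plus full passes over the levels still below
the threshold, bounds each interlaced run. Geometric sums over the two trees give the total. -/

namespace SubMax

universe u v w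

open OracleProg

/-! ### Outputs and query counts of composed oracle programs. -/

namespace OracleProg

variable {α : Type u} {β : Type v} {γ : Type w}

@[simp] theorem run_ret (f : Finset α → ℝ) (b : β) : (ret b : OracleProg α β).run f = b := rfl

@[simp] theorem queries_ret (f : Finset α → ℝ) (b : β) :
    (ret b : OracleProg α β).queries f = 0 := rfl

@[simp] theorem run_bind (f : Finset α → ℝ) (p : OracleProg α β) (g : β → OracleProg α γ) :
    (p.bind g).run f = (g (p.run f)).run f := by
  induction p with
  | ret b => rfl
  | query S next ih => exact ih _

@[simp] theorem queries_bind (f : Finset α → ℝ) (p : OracleProg α β) (g : β → OracleProg α γ) :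
    (p.bind g).queries f = p.queries f + (g (p.run f)).queries f := by
  induction p with
  | ret b => simp [bind, queries, run]
  | query S next ih => simp only [bind, queries, run, ih]; omega

@[simp] theorem run_forEach (f : Finset α → ℝ) (g : β → OracleProg α γ) (L : List β) :
    (forEach g L).run f = L.map fun b => (g b).run f := by
  induction L with
  | nil => rfl
  | cons b bs ih => simp [forEach, ih]

theorem queries_forEach (f : Finset α → ℝ) (g : β → OracleProg α γ) (L : List β) :
    (forEach g L).queries f = (L.map fun b => (g b).queries f).sum := by
  induction L with
  | nil => rfl
  | cons b bs ih => simp [forEach, ih]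

theorem queries_forEach_le (f : Finset α → ℝ) (g : β → OracleProg α γ) (L : List β) (c : ℕ)
    (h : ∀ b ∈ L, (g b).queries f ≤ c) : (forEach g L).queries f ≤ L.length * c := by
  rw [queries_forEach]
  simpa using List.sum_le_card_nsmul (L.map fun b => (g b).queries f) c (by simpa using h)

end OracleProg

/-! ### Inequalities for submodular functions. -/

section Marginal

variable {β : Type u} [DecidableEq β]

/-- The marginal gain of adding `x` to `A`. -/
def marg (F : Finset β → ℝ) (x : β) (A : Finset β) : ℝ := F (insert x A) - F A

variable {F : Finset β → ℝ}

theorem IsSubmodular.marg_anti (hF : IsSubmodular F) {A B : Finset β} (h : A ⊆ B) {x : β}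
    (hx : x ∉ B) : marg F x B ≤ marg F x A := hF A B h x hx

theorem IsSubmodular.union_sub_le_sum (hF : IsSubmodular F) (A W : Finset β) :
    F (W ∪ A) - F A ≤ ∑ x ∈ W \ A, marg F x A := by
  induction W using Finset.induction_on with
  | empty => simp
  | insert x W hx ih =>
    by_cases hxA : x ∈ A
    · rw [Finset.insert_sdiff_of_mem _ hxA, Finset.insert_union,
        Finset.insert_eq_of_mem (Finset.mem_union_right _ hxA)]
      exact ih
    · rw [Finset.insert_sdiff_of_notMem _ hxA, Finset.sum_insert (by simp [hx]),
        Finset.insert_union]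
      have := hF.marg_anti (A := A) (B := W ∪ A) Finset.subset_union_right (x := x)
        (by simp [hx, hxA])
      have e : ∀ B, marg F x B = F (insert x B) - F B := fun _ => rfl
      rw [e (W ∪ A)] at this
      linarith

/-- The elements of B \ A, added one at a time, gain no more on A than on A ∩ B. -/
theorem IsSubmodular.union_add_inter_le (hF : IsSubmodular F) (A B : Finset β) :
    F (A ∪ B) + F (A ∩ B) ≤ F A + F B := by
  have key : ∀ C : Finset β, Disjoint C A → C ⊆ B →
      F (C ∪ A) - F A ≤ F (C ∪ (A ∩ B)) - F (A ∩ B) := by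
    intro C
    induction C using Finset.induction_on with
    | empty => simp
    | insert x C hx ih =>
      intro hd hs
      rw [Finset.disjoint_insert_left] at hd
      have h1 := ih hd.2 (fun y hy => hs (Finset.mem_insert_of_mem hy))
      have h2 := hF (C ∪ (A ∩ B)) (C ∪ A)
        (Finset.union_subset_union_right Finset.inter_subset_left) x (by simp [hx, hd.1])
      rw [Finset.insert_union, Finset.insert_union]
      linarith
  have h := key (B \ A) Finset.sdiff_disjoint Finset.sdiff_subset
  have e1 : B \ A ∪ A = A ∪ B := by ext; simp; tauto
  have e2 : B \ A ∪ (A ∩ B) = B := by ext; simp; tauto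
  rw [e1, e2] at h
  linarith

/-- Sets that pairwise intersect in the common subset `B` can not all have small value. -/
theorem IsSubmodular.le_sum_of_pairwise (hF : IsSubmodular F) (h0 : ∀ S, 0 ≤ F S) (B : Finset β)
    (L : List (Finset β)) (hB : ∀ A ∈ L, B ⊆ A) (hL : L.Pairwise fun A A' => A ∩ A' ⊆ B) :
    ((L.length : ℝ) - 1) * F B ≤ (L.map F).sum := by
  suffices h : ((L.length : ℝ) - 1) * F B + F (L.foldr (· ∪ ·) B) ≤ (L.map F).sum by
    linarith [h0 (L.foldr (· ∪ ·) B)]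
  induction L with
  | nil => simp
  | cons A L ih =>
    rw [List.pairwise_cons] at hL
    have h1 := ih (fun A' h => hB A' (List.mem_cons_of_mem _ h)) hL.2
    have h2 := hF.union_add_inter_le A (L.foldr (· ∪ ·) B)
    -- Each remaining set meets A inside B, so A meets their union exactly in B. Every merge
    -- therefore releases one copy of F B.
    have h3 : A ∩ L.foldr (· ∪ ·) B = B := by
      have hAB := hB A List.mem_cons_self
      have hL1 := hL.1
      clear ih h1 h2 hL hB
      induction L with
      | nil => simpa using hAB
      | cons A' L ih =>
        have := ih (fun A'' h => hL1 A'' (List.mem_cons_of_mem _ h))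
        simp only [List.foldr_cons, Finset.inter_union_distrib_left, this]
        exact Finset.union_eq_right.2 (hL1 A' List.mem_cons_self)
    rw [h3] at h2
    simp only [List.length_cons, List.map_cons, List.sum_cons, List.foldr_cons]
    push_cast
    linarith

end Marginal

/-! ### The extension by dummy elements, and a single scan. -/

section Primitives

variable {α : Type u} [LinearOrder α] {k : ℕ}

/-- The extension of a set function to the ground set with dummy elements. -/
def extendFn (k : ℕ) (f : Finset α → ℝ) (S : Finset (Ground α k)) : ℝ := f S.toLeft

theorem toLeft_insert_inl (x : α) (A : Finset (Ground α k)) :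
    (insert (Sum.inl x) A).toLeft = insert x A.toLeft := by ext; simp

theorem IsSubmodular.extendFn {f : Finset α → ℝ} (hf : IsSubmodular f) :
    IsSubmodular (extendFn k f) := by
  intro S T hST x hx
  have hs : S.toLeft ⊆ T.toLeft := Finset.toLeft_subset_toLeft hST
  rcases x with x | d
  · simp only [SubMax.extendFn, toLeft_insert_inl]
    exact hf _ _ hs x (by simpa using hx)
  · simp [SubMax.extendFn]

theorem marg_inr (f : Finset α → ℝ) (d : Fin (3 * k)) (A : Finset (Ground α k)) :
    marg (extendFn k f) (Sum.inr d) A = 0 := by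
  simp [marg, extendFn]

variable (f : Finset α → ℝ)

@[simp] theorem run_value (S : Finset (Ground α k)) : (value S).run f = extendFn k f S := rfl

@[simp] theorem queries_value (S : Finset (Ground α k)) : (value S).queries f = 1 := rfl

@[simp] theorem run_gain (x : Ground α k) (A : Finset (Ground α k)) :
    (gain x A).run f = marg (extendFn k f) x A := rfl

@[simp] theorem queries_gain (x : Ground α k) (A : Finset (Ground α k)) :
    (gain x A).queries f = 2 := rfl

/-- The term `2 * rest.length` keeps the unexamined tail prepaid: the next scan resumes there, so
all scans at one threshold together cost one pass. -/
theorem scan_spec (blocked A : Finset (Ground α k)) (τ : ℝ) (L : List (Ground α k)) :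
    (∃ pre x rest, (scan blocked A τ L).run f = some (x, rest) ∧ L = pre ++ x :: rest ∧
      x ∉ blocked ∧ τ ≤ marg (extendFn k f) x A ∧
      (∀ y ∈ pre, y ∉ blocked → marg (extendFn k f) y A < τ) ∧
      (scan blocked A τ L).queries f + 2 * rest.length ≤ 2 * L.length) ∨
    ((scan blocked A τ L).run f = none ∧
      (∀ y ∈ L, y ∉ blocked → marg (extendFn k f) y A < τ) ∧
      (scan blocked A τ L).queries f ≤ 2 * L.length) := by
  induction L with
  | nil => right; simp [scan]
  | cons z L ih =>
    by_cases hz : z ∈ blocked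
    · simp only [scan, if_pos hz]
      rcases ih with ⟨pre, x, rest, h1, h2, h3, h4, h5, h6⟩ | ⟨h1, h2, h3⟩
      · refine Or.inl ⟨z :: pre, x, rest, h1, by simp [h2], h3, h4, ?_, ?_⟩
        · intro y hy hyb
          rcases List.mem_cons.1 hy with rfl | hy
          · exact absurd hz hyb
          · exact h5 y hy hyb
        · simp only [List.length_cons]; omega
      · refine Or.inr ⟨h1, ?_, by simp only [List.length_cons]; omega⟩
        intro y hy hyb
        rcases List.mem_cons.1 hy with rfl | hy
        · exact absurd hz hyb
        · exact h2 y hy hyb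
    · by_cases hτ : τ ≤ marg (extendFn k f) z A
      · refine Or.inl ⟨[], z, L, by simp [scan, hz, hτ], rfl, hz, hτ, by simp, ?_⟩
        have e2 : (scan blocked A τ (z :: L)).queries f = 2 := by simp [scan, hz, hτ]
        simp only [e2, List.length_cons]
        omega
      · have e1 : (scan blocked A τ (z :: L)).run f = (scan blocked A τ L).run f := by
          simp [scan, hz, hτ]
        have e2 : (scan blocked A τ (z :: L)).queries f = 2 + (scan blocked A τ L).queries f := by
          simp [scan, hz, hτ]
        rw [e1, e2]
        rcases ih with ⟨pre, x, rest, h1, h2, h3, h4, h5, h6⟩ | ⟨h1, h2, h3⟩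
        · refine Or.inl ⟨z :: pre, x, rest, h1, by simp [h2], h3, h4, ?_, ?_⟩
          · intro y hy hyb
            rcases List.mem_cons.1 hy with rfl | hy
            · exact lt_of_not_ge hτ
            · exact h5 y hy hyb
          · simp only [List.length_cons]; omega
        · refine Or.inr ⟨h1, ?_, by simp only [List.length_cons]; omega⟩
          intro y hy hyb
          rcases List.mem_cons.1 hy with rfl | hy
          · exact lt_of_not_ge hτ
          · exact h2 y hy hyb

end Primitives

/-! ### Descending thresholds and their query budget. -/

section AddLoop

theorem one_sub_pow_levelBound_lt {ε M : ℝ} {k d : ℕ} (hε : 0 < ε) (hε1 : ε < 1) (hk : 0 < k)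
    (hM : 0 < M) (hd : levelBound ε k ≤ d) : (1 - ε) ^ d * M < ε * M / k :=
  lt_of_le_of_lt (mul_le_mul_of_nonneg_right
    (pow_le_pow_of_le_one (by linarith) (by linarith) hd) hM.le) (levelBound_spec hε hε1 hk hM)

/-- The number of levels of the threshold below `τ`. -/
noncomputable def levelsLeft (ε M : ℝ) (k : ℕ) (τ : ℝ) : ℕ :=
  ((Finset.range (levelBound ε k + 1)).filter fun e => (1 - ε) ^ e * M < τ).card

theorem levelsLeft_step {ε M : ℝ} {k d : ℕ} (hε : 0 < ε) (hε1 : ε < 1) (hM : 0 < M)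
    (hd : d < levelBound ε k) :
    levelsLeft ε M k ((1 - ε) * ((1 - ε) ^ d * M)) + 1 ≤ levelsLeft ε M k ((1 - ε) ^ d * M) := by
  have hpos : 0 < (1 - ε) ^ d * M := mul_pos (pow_pos (by linarith) _) hM
  have hlt : (1 - ε) * ((1 - ε) ^ d * M) < (1 - ε) ^ d * M := by nlinarith
  rw [Nat.add_one_le_iff]
  apply Finset.card_lt_card
  rw [Finset.ssubset_iff_of_subset]
  -- Level d + 1 is counted below the old threshold but not below the new one, which equals it.
  · refine ⟨d + 1, ?_, ?_⟩
    · rw [Finset.mem_filter, Finset.mem_range]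
      exact ⟨by omega, by rw [pow_succ']; linarith⟩
    · rw [Finset.mem_filter, pow_succ']
      intro h
      linarith [h.2]
  · intro e he
    rw [Finset.mem_filter] at he ⊢
    exact ⟨he.1, he.2.trans hlt⟩

theorem levelsLeft_self_le {ε M : ℝ} {k : ℕ} : levelsLeft ε M k M ≤ levelBound ε k := by
  unfold levelsLeft
  have h : ((Finset.range (levelBound ε k + 1)).filter fun e => (1 - ε) ^ e * M < M) ⊆
      Finset.Icc 1 (levelBound ε k) := by
    intro e he
    rw [Finset.mem_filter, Finset.mem_range] at he
    rw [Finset.mem_Icc]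
    refine ⟨Nat.one_le_iff_ne_zero.2 ?_, by omega⟩
    rintro rfl
    simp at he
  simpa using Finset.card_le_card h

variable {α : Type u} [Fintype α] [LinearOrder α] {k : ℕ}

@[simp] theorem mem_elems (x : Ground α k) : x ∈ (elems : List (Ground α k)) := by
  rcases x with x | d <;> simp [elems]

theorem nodup_elems : (elems : List (Ground α k)).Nodup := by
  unfold elems
  rw [List.nodup_append]
  refine ⟨(Finset.sort_nodup _ _).map Sum.inl_injective,
    (List.nodup_finRange _).map Sum.inr_injective, ?_⟩
  intro a ha b hb
  simp only [List.mem_map] at ha hb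
  obtain ⟨x, -, rfl⟩ := ha
  obtain ⟨y, -, rfl⟩ := hb
  simp

@[simp] theorem length_elems :
    (elems : List (Ground α k)).length = Fintype.card α + 3 * k := by
  simp [elems]

/-- A bound on the number of queries that a greedy procedure can still make. -/
noncomputable def Thread.budget (ε M : ℝ) (t : Thread α k) : ℕ :=
  2 * t.todo.length + 2 * (Fintype.card α + 3 * k) * levelsLeft ε M k t.threshold

/-- The bound `hav` carries the quality of the greedy choice: an available element of W was rejected
one level higher, so its gain is at most τ / (1 - ε). The bound `hrej` justifies skipping elements
that have left the list. A free dummy has gain 0, so a pass at threshold 0 always succeeds; this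
settles M = 0, where the threshold never drops below `ε * M / k`. -/
theorem addLoop_spec {f : Finset α → ℝ} {ε M : ℝ} (hε : 0 < ε)
    (hε1 : ε < 1) (hk : 0 < k) (hM : 0 ≤ M) (W blocked : Finset (Ground α k))
    (hdummy : ∃ d : Fin (3 * k), (Sum.inr d : Ground α k) ∉ blocked) (n : ℕ) (t : Thread α k) (d : ℕ)
    (hd : t.threshold = (1 - ε) ^ d * M)
    (hn : levelBound ε k ≤ n + d) (hn0 : M = 0 → 0 < n)
    (hrej : ∀ x, x ∉ blocked → x ∉ t.todo → marg (extendFn k f) x t.set < t.threshold)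
    (hav : ∀ x ∈ W, x ∉ blocked → (1 - ε) * marg (extendFn k f) x t.set ≤ t.threshold) :
    ((addLoop ε (ε * M / k) blocked n t).run f).active = t.active ∧
    (∃ d', ((addLoop ε (ε * M / k) blocked n t).run f).threshold = (1 - ε) ^ d' * M) ∧
    ((addLoop ε (ε * M / k) blocked n t).run f).threshold ≤ t.threshold ∧
    (addLoop ε (ε * M / k) blocked n t).queries f +
      ((addLoop ε (ε * M / k) blocked n t).run f).budget ε M ≤ t.budget ε M ∧
    (∀ x ∈ W, x ∉ blocked → (1 - ε) * marg (extendFn k f) x t.set ≤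
      ((addLoop ε (ε * M / k) blocked n t).run f).threshold) ∧
    ((((addLoop ε (ε * M / k) blocked n t).run f).set = t.set ∧
      ((addLoop ε (ε * M / k) blocked n t).run f).threshold < ε * M / k ∧
      ∀ x, x ∉ blocked → x ∉ ((addLoop ε (ε * M / k) blocked n t).run f).todo →
        marg (extendFn k f) x t.set < ((addLoop ε (ε * M / k) blocked n t).run f).threshold) ∨
    ∃ x, x ∉ blocked ∧ ((addLoop ε (ε * M / k) blocked n t).run f).set = insert x t.set ∧
      ((addLoop ε (ε * M / k) blocked n t).run f).threshold ≤ marg (extendFn k f) x t.set ∧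
      ∀ y, y ∉ blocked → y ≠ x → y ∉ ((addLoop ε (ε * M / k) blocked n t).run f).todo →
        marg (extendFn k f) y t.set <
          ((addLoop ε (ε * M / k) blocked n t).run f).threshold) := by
  induction n generalizing t d with
  | zero =>
    have hM' : 0 < M := lt_of_le_of_ne hM fun h => absurd (hn0 h.symm) (lt_irrefl 0)
    have hlt : t.threshold < ε * M / k := by
      rw [hd]; exact one_sub_pow_levelBound_lt hε hε1 hk hM' (by omega)
    simp only [addLoop, run_ret, queries_ret, zero_add]
    exact ⟨trivial, ⟨d, hd⟩, le_rfl, le_rfl, hav, Or.inl ⟨trivial, hlt, hrej⟩⟩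
  | succ n ih =>
    by_cases hlt : t.threshold < ε * M / k
    · simp only [addLoop, if_pos hlt, run_ret, queries_ret, zero_add]
      exact ⟨trivial, ⟨d, hd⟩, le_rfl, le_rfl, hav, Or.inl ⟨trivial, hlt, hrej⟩⟩
    · rcases scan_spec f blocked t.set t.threshold t.todo with
        ⟨pre, x, rest, h1, h2, h3, h4, h5, h6⟩ | ⟨h1, h2, h3⟩
      · have er : (addLoop ε (ε * M / k) blocked (n + 1) t).run f =
            { t with set := insert x t.set, todo := rest } := by
          simp [addLoop, if_neg hlt, h1]
        have eq : (addLoop ε (ε * M / k) blocked (n + 1) t).queries f =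
            (scan blocked t.set t.threshold t.todo).queries f := by
          simp [addLoop, if_neg hlt, h1]
        rw [er, eq]
        refine ⟨rfl, ⟨d, hd⟩, le_rfl, ?_, hav, Or.inr ⟨x, h3, rfl, h4, ?_⟩⟩
        · simp only [Thread.budget]
          omega
        · intro y hy hyx hyr
          by_cases hyt : y ∈ t.todo
          · rw [h2] at hyt
            rcases List.mem_append.1 hyt with h | h
            · exact h5 y h hy
            · rcases List.mem_cons.1 h with h | h
              · exact absurd h hyx
              · exact absurd h hyr
          · exact hrej y hy hyt
      · have hall : ∀ y, y ∉ blocked → marg (extendFn k f) y t.set < t.threshold := by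
          intro y hy
          by_cases hyt : y ∈ t.todo
          · exact h2 y hyt hy
          · exact hrej y hy hyt
        obtain ⟨δ, hδ⟩ := hdummy
        -- If M = 0 the threshold would be 0, and the free dummy could not have been rejected.
        have hM' : 0 < M := by
          rcases hM.lt_or_eq with h | h
          · exact h
          · have := hall _ hδ
            rw [marg_inr, hd, ← h] at this
            simp at this
        have hdlt : d < levelBound ε k := by
          by_contra hcon
          exact hlt (by rw [hd]; exact one_sub_pow_levelBound_lt hε hε1 hk hM' (by omega))
        set t₁ : Thread α k := { t with threshold := (1 - ε) * t.threshold, todo := elems }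
          with ht₁
        have er : (addLoop ε (ε * M / k) blocked (n + 1) t).run f =
            (addLoop ε (ε * M / k) blocked n t₁).run f := by
          simp [addLoop, if_neg hlt, h1, ht₁]
        have eq : (addLoop ε (ε * M / k) blocked (n + 1) t).queries f =
            (scan blocked t.set t.threshold t.todo).queries f +
              (addLoop ε (ε * M / k) blocked n t₁).queries f := by
          simp [addLoop, if_neg hlt, h1, ht₁]
        rw [er, eq]
        have hb : (scan blocked t.set t.threshold t.todo).queries f + t₁.budget ε M ≤
            t.budget ε M := by
          have := levelsLeft_step (k := k) hε hε1 hM' hdlt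
          have h4 := Nat.mul_le_mul_left (2 * (Fintype.card α + 3 * k)) this
          rw [hd] at h3
          simp only [Thread.budget, ht₁, length_elems, hd]
          linarith
        have hpos : 0 ≤ t.threshold := by
          rw [hd]; exact mul_nonneg (pow_nonneg (by linarith) _) hM
        -- The list restarts in full, so `hrej` is vacuous, and rejection of everything at the old
        -- threshold is precisely `hav` at the new one.
        obtain ⟨i1, i2, i3, i4, i5, i6⟩ := ih t₁ (d + 1)
          (by simp only [ht₁, hd, pow_succ']; ring) (by omega) (fun h => absurd h hM'.ne')
          (fun x _ hx => absurd (mem_elems x) hx)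
          (fun x _ hx => mul_le_mul_of_nonneg_left (hall x hx).le (by linarith))
        refine ⟨i1, i2, i3.trans ?_, by omega, i5, i6⟩
        simp only [ht₁]
        nlinarith

end AddLoop

/-! ### The charging argument for one greedy procedure. -/

section Interlace

variable {α : Type u} [Fintype α] [LinearOrder α] {k : ℕ}

/-- The invariant of one greedy procedure. `U` is the union of the sets of all procedures, `W` a
set that is compared with the solution, and `c` bounds the number of turns made so far. -/
structure ThreadInv (F : Finset (Ground α k) → ℝ) (ε M : ℝ) (ℓ : ℕ)
    (Z G W U : Finset (Ground α k)) (c : ℕ) (t : Thread α k) : Prop where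
  base_sub : G ⊆ t.set
  sub_union : t.set ⊆ U
  avoid : ∀ x ∈ t.set, x ∉ G → x ∉ Z
  level : ∃ d, t.threshold = (1 - ε) ^ d * M
  rejected : ∀ x, x ∉ U ∪ Z → x ∉ t.todo → marg F x t.set < t.threshold
  avail : ∀ x ∈ W, x ∉ U ∪ Z → (1 - ε) * marg F x t.set ≤ t.threshold
  -- With A the set of the procedure and X = (W ∩ U) \ A, the part of W lost to other procedures:
  -- each element of A \ G buys ℓ units of the current threshold, and each element of X uses up one.
  -- The last term absorbs elements lost after the threshold has fallen below `ε * M / k`.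
  charge : ∑ o ∈ (W ∩ U) \ t.set, (1 - ε) * marg F o t.set +
      ((ℓ * (t.set \ G).card - ((W ∩ U) \ t.set).card : ℕ) : ℝ) * t.threshold ≤
    ℓ * (F t.set - F G) + ((W ∩ U) \ t.set).card * (ε * M / k)
  card_le : ((W ∩ U) \ t.set).card ≤ c
  first : M ≤ F t.set - F G
  size_le : (t.set \ G).card ≤ k / ℓ
  size_lt : t.active = true → (t.set \ G).card < k / ℓ
  stopped : t.active = false → (t.set \ G).card = k / ℓ ∨ t.threshold < ε * M / k

variable {F : Finset (Ground α k) → ℝ} {ε M : ℝ} {ℓ : ℕ} {Z G W U : Finset (Ground α k)} {c : ℕ}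
  {t : Thread α k}

theorem ThreadInv.mono_turns (h : ThreadInv F ε M ℓ Z G W U c t) :
    ThreadInv F ε M ℓ Z G W U (c + 1) t :=
  { h with card_le := h.card_le.trans (Nat.le_succ _) }

theorem ThreadInv.threshold_nonneg (h : ThreadInv F ε M ℓ Z G W U c t) (hε1 : ε < 1)
    (hM : 0 ≤ M) : 0 ≤ t.threshold := by
  obtain ⟨d, hd⟩ := h.level
  rw [hd]
  exact mul_nonneg (pow_nonneg (by linarith) _) hM

/-- The invariant is kept when another procedure adds an element. -/
theorem ThreadInv.insert_other (h : ThreadInv F ε M ℓ Z G W U c t) (hε : 0 < ε) (hε1 : ε < 1)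
    (hM : 0 ≤ M) {x : Ground α k} (hx : x ∉ U ∪ Z)
    (hc : t.threshold < ε * M / k ∨ c < ℓ * (t.set \ G).card) :
    ThreadInv F ε M ℓ Z G W (insert x U) (c + 1) t := by
  have hxU : x ∉ U := fun h' => hx (Finset.mem_union_left _ h')
  have hxt : x ∉ t.set := fun h' => hxU (h.sub_union h')
  have hτ := h.threshold_nonneg hε1 hM
  have hmin : 0 ≤ ε * M / k := by positivity
  have hsub : ∀ y, y ∉ insert x U ∪ Z → y ∉ U ∪ Z := by
    intro y hy hy'
    apply hy
    rw [Finset.insert_union]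
    exact Finset.mem_insert_of_mem hy'
  have key : ∑ o ∈ (W ∩ insert x U) \ t.set, (1 - ε) * marg F o t.set +
      ((ℓ * (t.set \ G).card - ((W ∩ insert x U) \ t.set).card : ℕ) : ℝ) * t.threshold ≤
    ℓ * (F t.set - F G) + ((W ∩ insert x U) \ t.set).card * (ε * M / k) ∧
    ((W ∩ insert x U) \ t.set).card ≤ c + 1 := by
    by_cases hxW : x ∈ W
    · have e : (W ∩ insert x U) \ t.set = insert x ((W ∩ U) \ t.set) := by
        rw [Finset.inter_insert_of_mem hxW, Finset.insert_sdiff_of_notMem _ hxt]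
      have hn : x ∉ (W ∩ U) \ t.set := by simp [hxU]
      rw [e, Finset.sum_insert hn, Finset.card_insert_of_notMem hn]
      refine ⟨?_, Nat.succ_le_succ h.card_le⟩
      have h1 := h.avail x hxW hx
      have h2 := h.charge
      have h3 := h.card_le
      push_cast
      -- A procedure with exhausted threshold pays for x by the additive term, as (1 - ε) times the
      -- gain is at most τ < ε * M / k. Otherwise it pays one unit of credit; |X| ≤ c < ℓ * |A \ G|
      -- guarantees that the truncated difference really drops by one.
      rcases hc with hc | hc
      · have h4 : ((ℓ * (t.set \ G).card - (((W ∩ U) \ t.set).card + 1) : ℕ) : ℝ) * t.threshold ≤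
            ((ℓ * (t.set \ G).card - ((W ∩ U) \ t.set).card : ℕ) : ℝ) * t.threshold := by
          apply mul_le_mul_of_nonneg_right _ hτ
          exact_mod_cast Nat.sub_le_sub_left (Nat.le_succ _) _
        linarith
      · have h4 : ((ℓ * (t.set \ G).card - (((W ∩ U) \ t.set).card + 1) : ℕ) : ℝ) + 1 =
            ((ℓ * (t.set \ G).card - ((W ∩ U) \ t.set).card : ℕ) : ℝ) := by
          exact_mod_cast (by omega)
        rw [← h4] at h2
        linarith
    · rw [Finset.inter_insert_of_notMem hxW]
      exact ⟨h.charge, h.card_le.trans (Nat.le_succ _)⟩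
  exact
    { h with
      sub_union := h.sub_union.trans (Finset.subset_insert _ _)
      rejected := fun y hy => h.rejected y (hsub y hy)
      avail := fun y hyW hy => h.avail y hyW (hsub y hy)
      charge := key.1
      card_le := key.2 }

/-- The invariant is kept when the procedure itself adds an element. -/
theorem ThreadInv.insert_self (h : ThreadInv F ε M ℓ Z G W U c t) (hF : IsSubmodular F)
    (hε1 : ε < 1) (hM : 0 ≤ M) (hact : t.active = true)
    {x : Ground α k} (hx : x ∉ U ∪ Z) {t' : Thread α k}
    (hset : t'.set = insert x t.set) (hlev : ∃ d, t'.threshold = (1 - ε) ^ d * M)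
    (hle : t'.threshold ≤ t.threshold) (hmarg : t'.threshold ≤ marg F x t.set)
    (hrej : ∀ y, y ∉ U ∪ Z → y ≠ x → y ∉ t'.todo → marg F y t.set < t'.threshold)
    (hav : ∀ y ∈ W, y ∉ U ∪ Z → (1 - ε) * marg F y t.set ≤ t'.threshold)
    (ha : t'.active = !decide ((t'.set \ G).card = k / ℓ ∨ t'.threshold < ε * M / k)) :
    ThreadInv F ε M ℓ Z G W (insert x U) (c + 1) t' := by
  have hxU : x ∉ U := fun h' => hx (Finset.mem_union_left _ h')
  have hxt : x ∉ t.set := fun h' => hxU (h.sub_union h')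
  have hxG : x ∉ G := fun h' => hxt (h.base_sub h')
  have hτ' : 0 ≤ t'.threshold := by
    obtain ⟨d, hd⟩ := hlev
    rw [hd]
    exact mul_nonneg (pow_nonneg (by linarith) _) hM
  have hFx : marg F x t.set = F t'.set - F t.set := by rw [hset]; rfl
  have hsub : ∀ y, y ∉ insert x U ∪ Z → y ∉ U ∪ Z ∧ y ≠ x ∧ y ∉ insert x t.set := by
    intro y hy
    rw [Finset.insert_union, Finset.mem_insert, not_or] at hy
    refine ⟨hy.2, hy.1, ?_⟩
    rw [Finset.mem_insert, not_or]
    exact ⟨hy.1, fun h' => hy.2 (Finset.mem_union_left _ (h.sub_union h'))⟩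
  have hcard : (t'.set \ G).card = (t.set \ G).card + 1 := by
    rw [hset, Finset.insert_sdiff_of_notMem _ hxG, Finset.card_insert_of_notMem (by simp [hxt])]
  have eX : (W ∩ insert x U) \ t'.set = (W ∩ U) \ t.set := by
    rw [hset]
    ext y
    simp only [Finset.mem_sdiff, Finset.mem_inter, Finset.mem_insert, not_or]
    constructor
    · rintro ⟨⟨h1, h2⟩, h3, h4⟩
      exact ⟨⟨h1, h2.resolve_left h3⟩, h4⟩
    · rintro ⟨⟨h1, h2⟩, h3⟩
      exact ⟨⟨h1, Or.inr h2⟩, fun e => hxU (e ▸ h2), h3⟩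
  have hlt := h.size_lt hact
  refine ⟨?_, ?_, ?_, hlev, ?_, ?_, ?_, ?_, ?_, ?_, ?_, ?_⟩
  · rw [hset]
    exact h.base_sub.trans (Finset.subset_insert _ _)
  · rw [hset]
    exact Finset.insert_subset_insert _ h.sub_union
  · intro y hy hyG
    rw [hset] at hy
    rcases Finset.mem_insert.1 hy with rfl | hy
    · exact fun h' => hx (Finset.mem_union_right _ h')
    · exact h.avoid y hy hyG
  · intro y hy hyt
    obtain ⟨h1, h2, h3⟩ := hsub y hy
    rw [hset]
    exact (hF.marg_anti (Finset.subset_insert _ _) h3).trans_lt (hrej y h1 h2 hyt)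
  · intro y hyW hy
    obtain ⟨h1, h2, h3⟩ := hsub y hy
    rw [hset]
    exact (mul_le_mul_of_nonneg_left (hF.marg_anti (Finset.subset_insert _ _) h3)
      (by linarith)).trans (hav y hyW h1)
  · rw [eX, hcard]
    have h1 : ∑ o ∈ (W ∩ U) \ t.set, (1 - ε) * marg F o t'.set ≤
        ∑ o ∈ (W ∩ U) \ t.set, (1 - ε) * marg F o t.set := by
      apply Finset.sum_le_sum
      intro o ho
      rw [← eX] at ho
      rw [hset] at ho ⊢
      exact mul_le_mul_of_nonneg_left (hF.marg_anti (Finset.subset_insert _ _)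
        (Finset.mem_sdiff.1 ho).2) (by linarith)
    -- The new element creates ℓ further units of credit at the new threshold, and ℓ times its gain
    -- covers them. The old units only become cheaper.
    have h2 : ((ℓ * ((t.set \ G).card + 1) - ((W ∩ U) \ t.set).card : ℕ) : ℝ) ≤
        ((ℓ * (t.set \ G).card - ((W ∩ U) \ t.set).card : ℕ) : ℝ) + ℓ := by
      have : ℓ * ((t.set \ G).card + 1) - ((W ∩ U) \ t.set).card ≤
          ℓ * (t.set \ G).card - ((W ∩ U) \ t.set).card + ℓ := by
        rw [mul_add, mul_one]; omega
      exact_mod_cast this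
    have h3 := mul_le_mul_of_nonneg_right h2 hτ'
    have h4 := mul_le_mul_of_nonneg_left hle
      (Nat.cast_nonneg (α := ℝ) (ℓ * (t.set \ G).card - ((W ∩ U) \ t.set).card))
    have h5 := mul_le_mul_of_nonneg_left hmarg (Nat.cast_nonneg (α := ℝ) ℓ)
    have h6 := h.charge
    rw [hFx] at h5
    linarith
  · rw [eX]
    exact h.card_le.trans (Nat.le_succ _)
  · have := h.first
    linarith
  · rw [hcard]
    omega
  · intro h'
    rw [ha] at h'
    have h2 : ¬((t'.set \ G).card = k / ℓ ∨ t'.threshold < ε * M / k) := by simpa using h'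
    rw [not_or] at h2
    rw [hcard] at h2 ⊢
    omega
  · intro h'
    rw [ha] at h'
    simpa [or_iff_not_imp_left] using h'

/-- The invariant is kept when the procedure stops because its threshold is small. -/
theorem ThreadInv.lower_self (h : ThreadInv F ε M ℓ Z G W U c t)
    {t' : Thread α k}
    (hset : t'.set = t.set) (hlev : ∃ d, t'.threshold = (1 - ε) ^ d * M)
    (hle : t'.threshold ≤ t.threshold) (hmin : t'.threshold < ε * M / k)
    (hrej : ∀ y, y ∉ U ∪ Z → y ∉ t'.todo → marg F y t.set < t'.threshold)
    (hav : ∀ y ∈ W, y ∉ U ∪ Z → (1 - ε) * marg F y t.set ≤ t'.threshold)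
    (ha : t'.active = !decide ((t'.set \ G).card = k / ℓ ∨ t'.threshold < ε * M / k)) :
    ThreadInv F ε M ℓ Z G W U (c + 1) t' := by
  have hact : t'.active = false := by rw [ha]; simp [hmin]
  refine ⟨?_, ?_, ?_, hlev, ?_, ?_, ?_, ?_, ?_, ?_, ?_, fun _ => Or.inr hmin⟩
  · rw [hset]; exact h.base_sub
  · rw [hset]; exact h.sub_union
  · rw [hset]; exact h.avoid
  · rw [hset]; exact hrej
  · rw [hset]; exact hav
  · rw [hset]
    have h4 := mul_le_mul_of_nonneg_left hle
      (Nat.cast_nonneg (α := ℝ) (ℓ * (t.set \ G).card - ((W ∩ U) \ t.set).card))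
    linarith [h.charge]
  · rw [hset]; exact h.card_le.trans (Nat.le_succ _)
  · rw [hset]; exact h.first
  · rw [hset]; exact h.size_le
  · rw [hact]; simp

/-- What a stopped greedy procedure guarantees. -/
theorem ThreadInv.union_sub_le (h : ThreadInv F ε M ℓ Z G W U c t) (hF : IsSubmodular F)
    (hε : 0 < ε) (hε1 : ε < 1) (hM : 0 ≤ M) (hk : 0 < k) (hℓ : ℓ ∣ k) (hW : W.card ≤ k)
    (hWZ : Disjoint W Z) (hact : t.active = false) :
    (1 - ε) * (F (W ∪ t.set) - F t.set) ≤ (ℓ + ε) * (F t.set - F G) := by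
  have hτ := h.threshold_nonneg hε1 hM
  have hk' : (0 : ℝ) < k := by exact_mod_cast hk
  have hmin : 0 ≤ ε * M / k := by positivity
  have e1 : W \ t.set = (W ∩ U) \ t.set ∪ W \ U := by
    ext y
    have := @h.sub_union y
    simp only [Finset.mem_sdiff, Finset.mem_inter, Finset.mem_union]
    tauto
  have e2 : Disjoint ((W ∩ U) \ t.set) (W \ U) := by
    rw [Finset.disjoint_left]
    simp only [Finset.mem_sdiff, Finset.mem_inter]
    tauto
  have h1 := hF.union_sub_le_sum t.set W
  rw [e1, Finset.sum_union e2] at h1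
  have h2 : ∑ o ∈ W \ U, (1 - ε) * marg F o t.set ≤ (W \ U).card * t.threshold := by
    rw [← nsmul_eq_mul]
    apply Finset.sum_le_card_nsmul
    intro o ho
    rw [Finset.mem_sdiff] at ho
    refine h.avail o ho.1 ?_
    rw [Finset.mem_union, not_or]
    exact ⟨ho.2, fun h' => (Finset.disjoint_left.1 hWZ) ho.1 h'⟩
  have h3 := h.charge
  rw [← Finset.mul_sum] at h2 h3
  have hcard : ((W ∩ U) \ t.set).card + (W \ U).card ≤ k := by
    rw [← Finset.card_union_of_disjoint e2, ← e1]
    exact (Finset.card_le_card Finset.sdiff_subset).trans hW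
  have hcR : (((W ∩ U) \ t.set).card : ℝ) + (W \ U).card ≤ k := by exact_mod_cast hcard
  -- If the procedure stopped full, ℓ * |A \ G| = k, and the k - |X| units left cover W \ U. If its
  -- threshold ran out, all of W costs at most k * (ε * M / k). In both cases the excess is at most
  -- ε * M, which `first` bounds by ε times the total gain.
  have h4 : ((W \ U).card : ℝ) * t.threshold + ((W ∩ U) \ t.set).card * (ε * M / k) ≤
      ((ℓ * (t.set \ G).card - ((W ∩ U) \ t.set).card : ℕ) : ℝ) * t.threshold + ε * M := by
    have e3 : ε * M = k * (ε * M / k) := by field_simp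
    rcases h.stopped hact with hs | hs
    · have h5 : ((W \ U).card : ℝ) ≤
          ((ℓ * (t.set \ G).card - ((W ∩ U) \ t.set).card : ℕ) : ℝ) := by
        rw [hs, Nat.mul_div_cancel' hℓ]
        exact_mod_cast (by omega)
      have h6 := mul_le_mul_of_nonneg_right h5 hτ
      have h7 : (((W ∩ U) \ t.set).card : ℝ) * (ε * M / k) ≤ k * (ε * M / k) := by
        apply mul_le_mul_of_nonneg_right _ hmin
        have : (0 : ℝ) ≤ (W \ U).card := Nat.cast_nonneg _
        linarith
      linarith
    · have h5 := mul_le_mul_of_nonneg_left hs.le (Nat.cast_nonneg (α := ℝ) (W \ U).card)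
      have h6 := mul_le_mul_of_nonneg_right hcR hmin
      have h7 : 0 ≤ ((ℓ * (t.set \ G).card - ((W ∩ U) \ t.set).card : ℕ) : ℝ) * t.threshold :=
        mul_nonneg (Nat.cast_nonneg _) hτ
      linarith
  have h5 := mul_le_mul_of_nonneg_left h1 (show 0 ≤ 1 - ε by linarith)
  have h6 := mul_le_mul_of_nonneg_left h.first hε.le
  linarith

/-- The union of the current sets. -/
def unionSets (ts : List (Thread α k)) : Finset (Ground α k) :=
  (ts.map Thread.set).foldr (· ∪ ·) ∅

theorem mem_unionSets {ts : List (Thread α k)} {x : Ground α k} :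
    x ∈ unionSets ts ↔ ∃ t ∈ ts, x ∈ t.set := by
  unfold unionSets
  induction ts with
  | nil => simp
  | cons t ts ih => simp [ih]

theorem card_unionSets_le {ts : List (Thread α k)} {m : ℕ}
    (h : ∀ t ∈ ts, (t.set \ G).card ≤ m) :
    (unionSets ts \ G).card ≤ ts.length * m := by
  unfold unionSets
  induction ts with
  | nil => simp
  | cons t ts ih =>
    rw [List.map_cons, List.foldr_cons, Finset.union_sdiff_distrib, List.length_cons]
    have h1 := ih fun t h' => h t (List.mem_cons_of_mem _ h')
    have h2 := h t List.mem_cons_self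
    refine (Finset.card_union_le _ _).trans ?_
    rw [add_mul, one_mul]
    omega

/-- A bound on the number of queries that all procedures together can still make. -/
noncomputable def totalBudget (ε M : ℝ) (ts : List (Thread α k)) : ℕ :=
  (ts.map (Thread.budget ε M)).sum

theorem totalBudget_set {ts : List (Thread α k)} {i q : ℕ} {t' : Thread α k}
    (hi : ts[i]? = some t) (h : q + t'.budget ε M ≤ t.budget ε M) :
    q + totalBudget ε M (ts.set i t') ≤ totalBudget ε M ts := by
  unfold totalBudget
  induction ts generalizing i with
  | nil => simp at hi
  | cons a ts ih =>
    cases i with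
    | zero =>
      simp only [List.getElem?_cons_zero, Option.some.injEq] at hi
      subst hi
      simp only [List.set_cons_zero, List.map_cons, List.sum_cons]
      omega
    | succ i =>
      simp only [List.getElem?_cons_succ] at hi
      have := ih hi
      simp only [List.set_cons_succ, List.map_cons, List.sum_cons]
      omega

/-- The joint invariant of the greedy procedures after `r` rounds and `i` more turns. -/
structure StateInv (F : Finset (Ground α k) → ℝ) (ε M : ℝ) (ℓ : ℕ)
    (Z G W : Finset (Ground α k)) (r i : ℕ) (ts : List (Thread α k)) : Prop where
  len : ts.length = ℓ
  inv : ∀ (l : ℕ) (t : Thread α k), ts[l]? = some t → ThreadInv F ε M ℓ Z G W (unionSets ts) (ℓ * r + i) t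
  -- The starting element counts as one, hence r + 1 after r rounds. This makes ℓ * |A \ G| exceed
  -- the number ℓ * r + i of turns made so far, the credit condition for losing another element.
  sync : ∀ (l : ℕ) (t : Thread α k), ts[l]? = some t → t.active = true →
    r + 1 ≤ (t.set \ G).card ∧ (l < i → r + 2 ≤ (t.set \ G).card)
  inter : ∀ (l l' : ℕ) (t t' : Thread α k), l ≠ l' → ts[l]? = some t → ts[l']? = some t' → t.set ∩ t'.set ⊆ G ∪ W

/-- The procedures hold at most ℓ * (k / ℓ) ≤ k elements outside G, and G and Z fewer than 2k in
all, so not all 3k dummies are blocked. -/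
theorem StateInv.exists_dummy {r i : ℕ} {ts : List (Thread α k)}
    (h : StateInv F ε M ℓ Z G W r i ts) (hGZ : G.card + Z.card < 2 * k) :
    ∃ d : Fin (3 * k), (Sum.inr d : Ground α k) ∉ unionSets ts ∪ Z := by
  by_contra hcon
  push Not at hcon
  have h1 : (unionSets ts \ G).card ≤ ts.length * (k / ℓ) := by
    apply card_unionSets_le
    intro t ht
    obtain ⟨l, hl⟩ := List.mem_iff_getElem?.1 ht
    exact (h.inv l t hl).size_le
  rw [h.len] at h1
  have h2 : ℓ * (k / ℓ) ≤ k := Nat.mul_div_le k ℓ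
  have h3 : (Finset.univ.map ⟨(Sum.inr : Fin (3 * k) → Ground α k), Sum.inr_injective⟩) ⊆
      (unionSets ts \ G) ∪ (G ∪ Z) := by
    intro x hx
    obtain ⟨d, -, rfl⟩ := Finset.mem_map.1 hx
    have := hcon d
    simp only [Finset.mem_union, Finset.mem_sdiff, Function.Embedding.coeFn_mk] at this ⊢
    tauto
  have h4 := Finset.card_le_card h3
  rw [Finset.card_map, Finset.card_univ, Fintype.card_fin] at h4
  have h5 := Finset.card_union_le (unionSets ts \ G) (G ∪ Z)
  have h6 := Finset.card_union_le G Z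
  omega

end Interlace

/-! ### Turns, rounds, and the guarantees of an interlaced run. -/

section Rounds

variable {α : Type u} [Fintype α] [LinearOrder α] {k : ℕ} {f : Finset α → ℝ}
  {ε M : ℝ} {ℓ : ℕ} {Z G W : Finset (Ground α k)}

theorem unionSets_set_subset {ts : List (Thread α k)} {i : ℕ} {t t' : Thread α k}
    (hi : ts[i]? = some t) (h : t'.set = t.set) : unionSets (ts.set i t') = unionSets ts := by
  unfold unionSets
  congr 1
  rw [List.map_set, h]
  apply List.ext_getElem?
  intro j
  rw [List.getElem?_set]
  split_ifs with h1 h2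
  · subst h1; simp [hi]
  · subst h1
    rw [List.length_map] at h2
    rw [List.getElem?_map, List.getElem?_eq_none (by omega)]; rfl
  · rfl

theorem unionSets_set_insert {ts : List (Thread α k)} {i : ℕ} {t t' : Thread α k} {x : Ground α k}
    (hi : ts[i]? = some t) (h : t'.set = insert x t.set) :
    unionSets (ts.set i t') = insert x (unionSets ts) := by
  unfold unionSets
  induction ts generalizing i with
  | nil => simp at hi
  | cons a ts ih =>
    cases i with
    | zero =>
      simp only [List.getElem?_cons_zero, Option.some.injEq] at hi
      subst hi
      simp [h]
    | succ i =>
      simp only [List.getElem?_cons_succ] at hi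
      have := ih hi
      simp only [List.set_cons_succ, List.map_cons, List.foldr_cons, this, Finset.union_insert]

theorem getElem?_set_cases {ts : List (Thread α k)} {i l : ℕ} {t' s : Thread α k}
    (h : (ts.set i t')[l]? = some s) : (l = i ∧ s = t') ∨ (l ≠ i ∧ ts[l]? = some s) := by
  rw [List.getElem?_set] at h
  split_ifs at h with h1 h2
  · exact Or.inl ⟨h1.symm, by simpa using h.symm⟩
  · exact Or.inr ⟨Ne.symm h1, h⟩

theorem StateInv.turn {r i : ℕ} {ts : List (Thread α k)} (hf : IsSubmodular f)
    (hε : 0 < ε) (hε1 : ε < 1) (hM : 0 ≤ M) (hk : 0 < k)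
    (hGZ : G.card + Z.card < 2 * k)
    (h : StateInv (extendFn k f) ε M ℓ Z G W r i ts) (hi : i < ℓ) :
    StateInv (extendFn k f) ε M ℓ Z G W r (i + 1)
      ((turn ε (ε * M / k) ℓ Z G ts i).run f) ∧
    (turn ε (ε * M / k) ℓ Z G ts i).queries f +
      totalBudget ε M ((turn ε (ε * M / k) ℓ Z G ts i).run f) ≤ totalBudget ε M ts := by
  have hF : IsSubmodular (extendFn k f) := hf.extendFn
  obtain ⟨t, ht⟩ : ∃ t, ts[i]? = some t :=
    ⟨ts[i]'(by rw [h.len]; exact hi), List.getElem?_eq_getElem (by rw [h.len]; exact hi)⟩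
  have hinv := h.inv i t ht
  by_cases hact : t.active = true
  swap
  · have e1 : (SubMax.turn ε (ε * M / k) ℓ Z G ts i).run f = ts := by
      simp [SubMax.turn, ht, hact]
    have e2 : (SubMax.turn ε (ε * M / k) ℓ Z G ts i).queries f = 0 := by
      simp [SubMax.turn, ht, hact]
    rw [e1, e2, zero_add]
    refine ⟨⟨h.len, fun l t hl => (h.inv l t hl).mono_turns, ?_, h.inter⟩, le_rfl⟩
    intro l s hl ha
    refine ⟨(h.sync l s hl ha).1, fun hli => ?_⟩
    rcases Nat.lt_succ_iff_lt_or_eq.1 hli with h1 | rfl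
    · exact (h.sync l s hl ha).2 h1
    · rw [ht, Option.some.injEq] at hl
      subst hl
      exact absurd ha hact
  · obtain ⟨d, hd⟩ := hinv.level
    obtain ⟨i1, i2, i3, i4, i5, i6⟩ := addLoop_spec (f := f) hε hε1 hk hM W (unionSets ts ∪ Z)
      (h.exists_dummy hGZ) (levelBound ε k) t d hd (by omega)
      (fun _ => Nat.succ_pos _) hinv.rejected hinv.avail
    set t₀ := (addLoop ε (ε * M / k) (unionSets ts ∪ Z) (levelBound ε k) t).run f with ht₀
    set t' : Thread α k := { t₀ with
      active := !decide ((t₀.set \ G).card = k / ℓ ∨ t₀.threshold < ε * M / k) } with ht'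
    have e1 : (SubMax.turn ε (ε * M / k) ℓ Z G ts i).run f = ts.set i t' := by
      have : unionSets ts = (ts.map Thread.set).foldr (· ∪ ·) ∅ := rfl
      simp [SubMax.turn, ht, hact, ← this, ht', ht₀]
    have e2 : (SubMax.turn ε (ε * M / k) ℓ Z G ts i).queries f =
        (addLoop ε (ε * M / k) (unionSets ts ∪ Z) (levelBound ε k) t).queries f := by
      have : unionSets ts = (ts.map Thread.set).foldr (· ∪ ·) ∅ := rfl
      simp [SubMax.turn, ht, hact, ← this]
    rw [e1, e2]
    refine ⟨?_, totalBudget_set ht i4⟩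
    have hsync := h.sync i t ht hact
    have hlt := hinv.size_lt hact
    rcases i6 with ⟨j1, j2, j3⟩ | ⟨x, j1, j2, j3, j4⟩
    · have hact' : t'.active = false := by simp [ht', j2]
      have eU : unionSets (ts.set i t') = unionSets ts := unionSets_set_subset ht j1
      refine ⟨by rw [List.length_set, h.len], ?_, ?_, ?_⟩
      · intro l s hl
        rw [eU]
        rcases getElem?_set_cases hl with ⟨rfl, rfl⟩ | ⟨hl1, hl2⟩
        · exact hinv.lower_self j1 i2 i3 j2 j3 i5 rfl
        · exact (h.inv l s hl2).mono_turns
      · intro l s hl ha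
        rcases getElem?_set_cases hl with ⟨rfl, rfl⟩ | ⟨hl1, hl2⟩
        · rw [hact'] at ha; simp at ha
        · exact ⟨(h.sync l s hl2 ha).1, fun hli => (h.sync l s hl2 ha).2 (by omega)⟩
      · intro l l' s s' hne hl hl'
        rcases getElem?_set_cases hl with ⟨rfl, rfl⟩ | ⟨hl1, hl2⟩ <;>
          rcases getElem?_set_cases hl' with ⟨rfl, rfl⟩ | ⟨hl1', hl2'⟩
        · exact absurd rfl hne
        · have := h.inter _ _ _ _ hne ht hl2'
          rwa [← j1] at this
        · have := h.inter _ _ _ _ hne hl2 ht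
          rwa [← j1] at this
        · exact h.inter _ _ _ _ hne hl2 hl2'
    · have eU : unionSets (ts.set i t') = insert x (unionSets ts) := unionSets_set_insert ht j2
      have hxU : x ∉ unionSets ts := fun h' => j1 (Finset.mem_union_left _ h')
      have hxs : ∀ (l : ℕ) (s : Thread α k), ts[l]? = some s → x ∉ s.set := fun l s hl hx =>
        hxU ((h.inv l s hl).sub_union hx)
      have hxG : x ∉ G := fun h' => hxs i t ht (hinv.base_sub h')
      have hc : ∀ m, r + 1 ≤ m → ℓ * r + i < ℓ * m := by
        intro m hm
        have := Nat.mul_le_mul_left ℓ hm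
        rw [mul_add] at this
        omega
      refine ⟨by rw [List.length_set, h.len], ?_, ?_, ?_⟩
      · intro l s hl
        rw [eU]
        rcases getElem?_set_cases hl with ⟨rfl, rfl⟩ | ⟨hl1, hl2⟩
        · exact hinv.insert_self hF hε1 hM hact j1 j2 i2 i3 j3 j4 i5 rfl
        · refine (h.inv l s hl2).insert_other hε hε1 hM j1 ?_
          -- Procedure s may lose x: if it runs, or has stopped full and so is larger than the
          -- running procedure i, its size is at least r + 1 and there is credit; otherwise its
          -- threshold has run out.
          by_cases ha : s.active = true
          · exact Or.inr (hc _ (h.sync l s hl2 ha).1)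
          · rcases (h.inv l s hl2).stopped (by simpa using ha) with hs | hs
            · exact Or.inr (hc _ (by omega))
            · exact Or.inl hs
      · intro l s hl ha
        rcases getElem?_set_cases hl with ⟨rfl, rfl⟩ | ⟨hl1, hl2⟩
        · have hcard : (t'.set \ G).card = (t.set \ G).card + 1 := by
            have : t'.set = insert x t.set := j2
            rw [this, Finset.insert_sdiff_of_notMem _ hxG,
              Finset.card_insert_of_notMem (by simp [hxs l t ht])]
          omega
        · exact ⟨(h.sync l s hl2 ha).1, fun hli => (h.sync l s hl2 ha).2 (by omega)⟩
      · intro l l' s s' hne hl hl'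
        have e : t'.set = insert x t.set := j2
        rcases getElem?_set_cases hl with ⟨rfl, rfl⟩ | ⟨hl1, hl2⟩ <;>
          rcases getElem?_set_cases hl' with ⟨rfl, rfl⟩ | ⟨hl1', hl2'⟩
        · exact absurd rfl hne
        · rw [e, Finset.insert_inter_of_notMem (hxs _ _ hl2')]
          exact h.inter _ _ _ _ hne ht hl2'
        · rw [e, Finset.inter_insert_of_notMem (hxs _ _ hl2)]
          exact h.inter _ _ _ _ hne hl2 ht
        · exact h.inter _ _ _ _ hne hl2 hl2'

theorem StateInv.loop {r : ℕ} (hf : IsSubmodular f)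
    (hε : 0 < ε) (hε1 : ε < 1) (hM : 0 ≤ M) (hk : 0 < k)
    (hGZ : G.card + Z.card < 2 * k) (n i : ℕ) (ts : List (Thread α k))
    (h : StateInv (extendFn k f) ε M ℓ Z G W r i ts) (hi : i + n = ℓ) :
    StateInv (extendFn k f) ε M ℓ Z G W (r + 1) 0
      ((loop (SubMax.turn ε (ε * M / k) ℓ Z G) (List.range' i n) ts).run f) ∧
    (loop (SubMax.turn ε (ε * M / k) ℓ Z G) (List.range' i n) ts).queries f +
      totalBudget ε M ((loop (SubMax.turn ε (ε * M / k) ℓ Z G) (List.range' i n) ts).run f) ≤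
        totalBudget ε M ts := by
  induction n generalizing i ts with
  | zero =>
    simp only [List.range'_zero, OracleProg.loop, run_ret, queries_ret, zero_add]
    refine ⟨⟨h.len, ?_, ?_, h.inter⟩, le_rfl⟩
    · intro l t hl
      have := h.inv l t hl
      have e : ℓ * (r + 1) + 0 = ℓ * r + i := by rw [mul_add]; omega
      rwa [e]
    · intro l t hl ha
      have hlt : l < ts.length := (List.getElem?_eq_some_iff.1 hl).1
      rw [h.len] at hlt
      exact ⟨(h.sync l t hl ha).2 (by omega), fun h' => absurd h' (by omega)⟩
  | succ n ih =>
    obtain ⟨h1, h2⟩ := h.turn hf hε hε1 hM hk hGZ (by omega)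
    obtain ⟨h3, h4⟩ := ih (i + 1) _ h1 (by omega)
    simp only [List.range'_succ, OracleProg.loop, run_bind, queries_bind]
    exact ⟨h3, by omega⟩

theorem StateInv.rounds (hf : IsSubmodular f)
    (hε : 0 < ε) (hε1 : ε < 1) (hM : 0 ≤ M) (hk : 0 < k)
    (hGZ : G.card + Z.card < 2 * k) (n r : ℕ) (ts : List (Thread α k))
    (h : StateInv (extendFn k f) ε M ℓ Z G W r 0 ts) (hn : k ≤ r + n) :
    (∃ r', StateInv (extendFn k f) ε M ℓ Z G W r' 0
      ((rounds ε (ε * M / k) ℓ Z G n ts).run f)) ∧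
    (∀ t ∈ (rounds ε (ε * M / k) ℓ Z G n ts).run f, t.active = false) ∧
    (rounds ε (ε * M / k) ℓ Z G n ts).queries f +
      totalBudget ε M ((rounds ε (ε * M / k) ℓ Z G n ts).run f) ≤ totalBudget ε M ts := by
  induction n generalizing r ts with
  | zero =>
    simp only [SubMax.rounds, run_ret, queries_ret, zero_add]
    refine ⟨⟨r, h⟩, ?_, le_rfl⟩
    intro t ht
    -- A procedure running after r ≥ k rounds would have taken at least k + 1 elements, although its
    -- size is below k / ℓ.
    by_contra hcon
    obtain ⟨l, hl⟩ := List.mem_iff_getElem?.1 ht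
    have ha : t.active = true := by simpa using hcon
    have h1 := (h.sync l t hl ha).1
    have h2 := (h.inv l t hl).size_lt ha
    have h3 := Nat.div_le_self k ℓ
    omega
  | succ n ih =>
    by_cases ha : ts.any Thread.active = true
    · obtain ⟨h1, h2⟩ := h.loop hf hε hε1 hM hk hGZ ℓ 0 ts (by omega)
      obtain ⟨h3, h4, h5⟩ := ih (r + 1) _ h1 (by omega)
      simp only [SubMax.rounds, if_pos ha, run_bind, queries_bind, h.len, List.range_eq_range']
      exact ⟨h3, h4, by omega⟩
    · simp only [SubMax.rounds, if_neg ha, run_ret, queries_ret, zero_add]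
      refine ⟨⟨r, h⟩, ?_, le_rfl⟩
      intro t ht
      simp only [List.any_eq_true, not_exists, not_and] at ha
      simpa using ha t ht

/-- The guarantees of the interlaced greedy procedures. -/
theorem interlace_spec (hf : IsSubmodular f)
    (hε : 0 < ε) (hε1 : ε < 1) (hM : 0 ≤ M) (hk : 0 < k) (hℓ : ℓ ∣ k) (hkℓ : 2 ≤ k / ℓ)
    (hGZ : G.card + Z.card < 2 * k) (hW : W.card ≤ k) (hWZ : Disjoint W Z)
    (start : List (Finset (Ground α k))) (hlen : start.length = ℓ)
    (hstart : ∀ B ∈ start, ∃ x, x ∉ G ∪ Z ∧ B = insert x G ∧ M ≤ marg (extendFn k f) x G)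
    (hWB : ∀ B ∈ start, ∀ B' ∈ start, W ∩ B ⊆ B')
    (hWM : ∀ x ∈ W, x ∉ Z → (∀ B ∈ start, x ∉ B) → marg (extendFn k f) x G ≤ M)
    (hinter : start.Pairwise fun B B' => B ∩ B' ⊆ G ∪ W) :
    ((interlace ε ℓ Z G M start).run f).length = ℓ ∧
    (∀ A ∈ (interlace ε ℓ Z G M start).run f, G ⊆ A ∧ (A \ G).card ≤ k / ℓ ∧
      (∀ x ∈ A, x ∉ G → x ∉ Z) ∧
      (1 - ε) * (extendFn k f (W ∪ A) - extendFn k f A) ≤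
        (ℓ + ε) * (extendFn k f A - extendFn k f G)) ∧
    ((interlace ε ℓ Z G M start).run f).Pairwise (fun A A' => A ∩ A' ⊆ G ∪ W) ∧
    (interlace ε ℓ Z G M start).queries f ≤
      ℓ * (2 * (Fintype.card α + 3 * k) * (levelBound ε k + 1)) := by
  have hF : IsSubmodular (extendFn k f) := hf.extendFn
  set ts₀ : List (Thread α k) := start.map fun A => ⟨A, M, elems, true⟩ with hts₀
  have hU : ∀ x, x ∈ unionSets ts₀ ↔ ∃ B ∈ start, x ∈ B := by
    intro x
    rw [mem_unionSets]
    simp [hts₀]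
  have hmem : ∀ (l : ℕ) (t : Thread α k), ts₀[l]? = some t → ∃ B ∈ start, t = ⟨B, M, elems, true⟩ := by
    intro l t hl
    have := List.mem_of_getElem? hl
    rw [hts₀, List.mem_map] at this
    obtain ⟨B, h1, h2⟩ := this
    exact ⟨B, h1, h2.symm⟩
  have hinit : StateInv (extendFn k f) ε M ℓ Z G W 0 0 ts₀ := by
    refine ⟨by simp [hts₀, hlen], ?_, ?_, ?_⟩
    · intro l t hl
      obtain ⟨B, hB, rfl⟩ := hmem l t hl
      obtain ⟨x, hx, rfl, hxM⟩ := hstart B hB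
      have hxG : x ∉ G := fun h => hx (Finset.mem_union_left _ h)
      have hcard : (insert x G \ G).card = 1 := by
        rw [Finset.insert_sdiff_of_notMem _ hxG]; simp
      -- By `hWB` the starting sets contain the same elements of W, so nothing has been lost yet,
      -- and the charge starts from the credit ℓ * M alone.
      have hX : (W ∩ unionSets ts₀) \ insert x G = ∅ := by
        rw [Finset.sdiff_eq_empty_iff_subset]
        intro y hy
        rw [Finset.mem_inter, hU] at hy
        obtain ⟨hyW, B', hB', hyB'⟩ := hy
        exact hWB B' hB' _ hB (Finset.mem_inter.2 ⟨hyW, hyB'⟩)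
      refine ⟨Finset.subset_insert _ _, ?_, ?_, ⟨0, by simp⟩, ?_, ?_, ?_, ?_, hxM, ?_, ?_, ?_⟩
      · intro y hy
        rw [hU]
        exact ⟨_, hB, hy⟩
      · intro y hy hyG
        rcases Finset.mem_insert.1 hy with rfl | hy
        · exact fun h => hx (Finset.mem_union_right _ h)
        · exact absurd hy hyG
      · intro y _ hy
        exact absurd (mem_elems y) hy
      · intro y hyW hy
        rw [Finset.mem_union, not_or, hU] at hy
        push Not at hy
        have h1 := hWM y hyW hy.2 hy.1
        have h2 := hF.marg_anti (Finset.subset_insert x G) (hy.1 _ hB)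
        have h3 : (1 - ε) * marg (extendFn k f) y (insert x G) ≤ (1 - ε) * M :=
          mul_le_mul_of_nonneg_left (h2.trans h1) (by linarith)
        dsimp only
        nlinarith
      · dsimp only
        rw [hX, hcard]
        simp only [Finset.sum_empty, Finset.card_empty, Nat.cast_zero, zero_mul, add_zero,
          mul_one, Nat.sub_zero, zero_add]
        exact mul_le_mul_of_nonneg_left hxM (Nat.cast_nonneg _)
      · dsimp only; rw [hX]; simp
      · dsimp only; rw [hcard]; omega
      · intro _; dsimp only; rw [hcard]; omega
      · intro h; simp at h
    · intro l t hl _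
      obtain ⟨B, hB, rfl⟩ := hmem l t hl
      obtain ⟨x, hx, rfl, hxM⟩ := hstart B hB
      have hxG : x ∉ G := fun h => hx (Finset.mem_union_left _ h)
      refine ⟨?_, fun h => absurd h (by omega)⟩
      dsimp only
      rw [Finset.insert_sdiff_of_notMem _ hxG]; simp
    · intro l l' t t' hne hl hl'
      rw [hts₀, List.getElem?_map, Option.map_eq_some_iff] at hl hl'
      obtain ⟨B, hB, rfl⟩ := hl
      obtain ⟨B', hB', rfl⟩ := hl'
      obtain ⟨h1, rfl⟩ := List.getElem?_eq_some_iff.1 hB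
      obtain ⟨h1', rfl⟩ := List.getElem?_eq_some_iff.1 hB'
      rw [List.pairwise_iff_getElem] at hinter
      rcases lt_or_gt_of_ne hne with h | h
      · exact hinter _ _ h1 h1' h
      · dsimp only
        rw [Finset.inter_comm]
        exact hinter _ _ h1' h1 h
  obtain ⟨⟨r', h1⟩, h2, h3⟩ := hinit.rounds hf hε hε1 hM hk hGZ k 0 ts₀ (by omega)
  have er : (interlace ε ℓ Z G M start).run f =
      ((SubMax.rounds ε (ε * M / k) ℓ Z G k ts₀).run f).map Thread.set := by
    simp [interlace, hts₀]
  have eq : (interlace ε ℓ Z G M start).queries f =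
      (SubMax.rounds ε (ε * M / k) ℓ Z G k ts₀).queries f := by
    simp [interlace, hts₀]
  rw [er, eq]
  refine ⟨by rw [List.length_map, h1.len], ?_, ?_, ?_⟩
  · intro A hA
    obtain ⟨t, ht, rfl⟩ := List.mem_map.1 hA
    obtain ⟨l, hl⟩ := List.mem_iff_getElem?.1 ht
    have hi := h1.inv l t hl
    exact ⟨hi.base_sub, hi.size_le, hi.avoid,
      hi.union_sub_le hF hε hε1 hM hk hℓ hW hWZ (h2 t ht)⟩
  · rw [List.pairwise_map, List.pairwise_iff_getElem]
    intro a b ha hb hab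
    exact h1.inter a b _ _ hab.ne (List.getElem?_eq_getElem ha) (List.getElem?_eq_getElem hb)
  · have hb : totalBudget ε M ts₀ ≤ ℓ * (2 * (Fintype.card α + 3 * k) * (levelBound ε k + 1)) := by
      unfold totalBudget
      refine (List.sum_le_card_nsmul _ (2 * (Fintype.card α + 3 * k) * (levelBound ε k + 1))
        ?_).trans (by simp [hts₀, hlen])
      intro b hb
      simp only [hts₀, List.map_map, List.mem_map, Function.comp_apply] at hb
      obtain ⟨B, _, rfl⟩ := hb
      simp only [Thread.budget, length_elems]
      have := Nat.mul_le_mul_left (2 * (Fintype.card α + 3 * k))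
        (levelsLeft_self_le (ε := ε) (M := M) (k := k))
      linarith
    omega

end Rounds

/-! ### The top elements, and the choice of the case u. -/

section ThreshGuided

variable {α : Type u} [Fintype α] [LinearOrder α] {k : ℕ} {f : Finset α → ℝ}
  {ε : ℝ} {ℓ : ℕ} {Z G W : Finset (Ground α k)}

theorem queries_topGains_le (f : Finset α → ℝ) (ℓ : ℕ) (Z G : Finset (Ground α k)) :
    (topGains ℓ Z G).queries f ≤ 2 * (Fintype.card α + 3 * k) := by
  unfold topGains
  rw [queries_bind, queries_ret, add_zero]
  refine (queries_forEach_le f _ _ 2 (by intro b _; simp)).trans ?_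
  have := List.length_filter_le (fun x : Ground α k => decide (x ∉ G ∪ Z)) elems
  rw [length_elems] at this
  omega

/-- The selected gains are nonnegative because of the dummies: at least ℓ of them are available with
gain 0. Hence M ≥ 0 in every run. -/
theorem topGains_spec (f : Finset α → ℝ) (hcard : G.card + Z.card + ℓ ≤ 3 * k) :
    ((topGains ℓ Z G).run f).length = ℓ ∧
    (∀ p ∈ (topGains ℓ Z G).run f, p.1 ∉ G ∪ Z ∧ p.2 = marg (extendFn k f) p.1 G ∧ 0 ≤ p.2) ∧
    (((topGains ℓ Z G).run f).map Prod.fst).Nodup ∧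
    ((topGains ℓ Z G).run f).Pairwise (fun p q => q.2 ≤ p.2) ∧
    (∀ x, x ∉ G ∪ Z → (∀ p ∈ (topGains ℓ Z G).run f, p.1 ≠ x) →
      ∀ p ∈ (topGains ℓ Z G).run f, marg (extendFn k f) x G ≤ p.2) := by
  classical
  set F := extendFn k f with hF
  set r : Ground α k × ℝ → Ground α k × ℝ → Prop := fun p q => q.2 ≤ p.2 with hr
  have : Std.Total r := ⟨fun p q => le_total q.2 p.2⟩
  have : IsTrans (Ground α k × ℝ) r := ⟨fun p q s h1 h2 => le_trans h2 h1⟩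
  set L : List (Ground α k × ℝ) :=
    (elems.filter fun x : Ground α k => x ∉ G ∪ Z).map fun x => (x, marg F x G) with hL
  set S : List (Ground α k × ℝ) := L.insertionSort fun p q => q.2 ≤ p.2 with hS
  have hrun : (topGains ℓ Z G).run f = S.take ℓ := by
    simp [topGains, hS, hL, hF]
  have hperm : S.Perm L := List.perm_insertionSort _ _
  have hsort : S.Pairwise r := List.pairwise_insertionSort r L
  have hmemS : ∀ p, p ∈ S ↔ p.1 ∉ G ∪ Z ∧ p.2 = marg F p.1 G := by
    intro p
    rw [hperm.mem_iff, hL, List.mem_map]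
    constructor
    · rintro ⟨x, hx, rfl⟩
      rw [List.mem_filter] at hx
      exact ⟨by simpa using hx.2, rfl⟩
    · rintro ⟨h1, h2⟩
      refine ⟨p.1, ?_, by rw [← h2]⟩
      rw [List.mem_filter]
      exact ⟨mem_elems _, by simpa using h1⟩
  have hnodup : (S.map Prod.fst).Nodup := by
    rw [(hperm.map Prod.fst).nodup_iff, hL, List.map_map]
    have e : (Prod.fst ∘ fun x : Ground α k => (x, marg F x G)) = id := rfl
    rw [e, List.map_id]
    exact nodup_elems.filter _
  have hsplit : S.take ℓ ++ S.drop ℓ = S := List.take_append_drop _ _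
  have hcross : ∀ p ∈ S.take ℓ, ∀ q ∈ S.drop ℓ, q.2 ≤ p.2 := by
    rw [← hsplit, List.pairwise_append] at hsort
    exact hsort.2.2
  set D : Finset (Ground α k × ℝ) :=
    ((Finset.univ : Finset (Fin (3 * k))).filter fun d => (Sum.inr d : Ground α k) ∉ G ∪ Z).map
      ⟨fun d => ((Sum.inr d : Ground α k), (0 : ℝ)), fun a b h => by simpa using h⟩ with hD
  have hDS : ∀ p ∈ D, p ∈ S ∧ p.2 = 0 := by
    intro p hp
    obtain ⟨d, hd, rfl⟩ := Finset.mem_map.1 hp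
    rw [Finset.mem_filter] at hd
    rw [hmemS]
    exact ⟨⟨hd.2, (marg_inr f d G).symm⟩, rfl⟩
  have hDcard : ℓ ≤ D.card := by
    rw [hD, Finset.card_map]
    have h1 := Finset.card_filter_add_card_filter_not (s := (Finset.univ : Finset (Fin (3 * k))))
      (fun d => (Sum.inr d : Ground α k) ∉ G ∪ Z)
    have h2 : ((Finset.univ : Finset (Fin (3 * k))).filter
        fun d => ¬ (Sum.inr d : Ground α k) ∉ G ∪ Z).card ≤ (G ∪ Z).card := by
      apply Finset.card_le_card_of_injOn (fun d => (Sum.inr d : Ground α k))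
      · intro d hd
        simpa [or_iff_not_imp_left] using hd
      · exact Sum.inr_injective.injOn
    have h3 := Finset.card_union_le G Z
    rw [Finset.card_univ, Fintype.card_fin] at h1
    omega
  have hlen : ℓ ≤ S.length := by
    refine hDcard.trans ((Finset.card_le_card ?_).trans S.toFinset_card_le)
    intro p hp
    exact List.mem_toFinset.2 (hDS p hp).1
  have hlen' : (S.take ℓ).length = ℓ := by rw [List.length_take]; omega
  rw [hrun]
  refine ⟨hlen', ?_, ?_, hsort.sublist (List.take_sublist _ _), ?_⟩
  · intro p hp
    have hpS := (hmemS p).1 (List.mem_of_mem_take hp)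
    refine ⟨hpS.1, hpS.2, ?_⟩
    by_contra hneg
    push Not at hneg
    -- If a selected gain were negative, all available dummies would rank ahead of it, leaving at
    -- least ℓ of them in the other ℓ - 1 selected places.
    have hsub : D ⊆ (S.take ℓ).toFinset.erase p := by
      intro q hq
      have hq' := hDS q hq
      rw [Finset.mem_erase, List.mem_toFinset]
      refine ⟨fun h => by rw [h] at hq'; linarith [hq'.2], ?_⟩
      have := hq'.1
      rw [← hsplit, List.mem_append] at this
      rcases this with h | h
      · exact h
      · have := hcross p hp q h
        linarith [hq'.2]
    have h1 := Finset.card_le_card hsub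
    rw [Finset.card_erase_of_mem (List.mem_toFinset.2 hp)] at h1
    have h2 := (S.take ℓ).toFinset_card_le
    have h3 : 0 < (S.take ℓ).toFinset.card := Finset.card_pos.2 ⟨p, List.mem_toFinset.2 hp⟩
    omega
  · exact hnodup.sublist ((List.take_sublist _ _).map _)
  · intro x hx hne p hp
    have hxS : (x, marg F x G) ∈ S := (hmemS _).2 ⟨hx, rfl⟩
    rw [← hsplit, List.mem_append] at hxS
    rcases hxS with h | h
    · exact absurd rfl (hne _ h)
    · exact hcross p hp _ h

/-- The conclusion of `interlace_spec`. -/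
structure GoodOutputs (f : Finset α → ℝ) (ε : ℝ) (ℓ : ℕ) (Z G W : Finset (Ground α k))
    (L : List (Finset (Ground α k))) : Prop where
  len : L.length = ℓ
  base_sub : ∀ A ∈ L, G ⊆ A
  size_le : ∀ A ∈ L, (A \ G).card ≤ k / ℓ
  avoid : ∀ A ∈ L, ∀ x ∈ A, x ∉ G → x ∉ Z
  gain : ∀ A ∈ L, (1 - ε) * (extendFn k f (W ∪ A) - extendFn k f A) ≤
    (ℓ + ε) * (extendFn k f A - extendFn k f G)
  inter : L.Pairwise fun A A' => A ∩ A' ⊆ G ∪ W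

/-- The sets S ∪ A meet pairwise inside S ∪ G, as W ⊆ S. This is the deterministic counterpart of a
random choice among ℓ disjoint increments: on average only the factor 1 - 1/ℓ is lost. -/
theorem GoodOutputs.sum_union_ge {L : List (Finset (Ground α k))} (h : GoodOutputs f ε ℓ Z G W L)
    (hf : IsSubmodular f) (h0 : ∀ S, 0 ≤ f S) {S : Finset (Ground α k)} (hS : W ⊆ S) :
    ((ℓ : ℝ) - 1) * extendFn k f (S ∪ G) ≤ (L.map fun A => extendFn k f (S ∪ A)).sum := by
  have := hf.extendFn.le_sum_of_pairwise (F := extendFn k f) (fun S => h0 _) (S ∪ G)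
    (L.map fun A => S ∪ A) ?_ ?_
  · rw [List.length_map, h.len, List.map_map] at this
    exact this
  · intro A hA
    obtain ⟨B, hB, rfl⟩ := List.mem_map.1 hA
    exact Finset.union_subset_union_right (h.base_sub B hB)
  · rw [List.pairwise_map]
    refine h.inter.imp ?_
    intro A A' hAA
    rw [← Finset.union_inter_distrib_left]
    refine Finset.union_subset Finset.subset_union_left (hAA.trans ?_)
    exact Finset.union_subset Finset.subset_union_right (hS.trans Finset.subset_union_left)

theorem interlace_good (hf : IsSubmodular f) {M : ℝ}
    (hε : 0 < ε) (hε1 : ε < 1) (hM : 0 ≤ M) (hk : 0 < k) (hℓ : ℓ ∣ k) (hkℓ : 2 ≤ k / ℓ)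
    (hGZ : G.card + Z.card < 2 * k) (hW : W.card ≤ k) (hWZ : Disjoint W Z)
    (start : List (Finset (Ground α k))) (hlen : start.length = ℓ)
    (hstart : ∀ B ∈ start, ∃ x, x ∉ G ∪ Z ∧ B = insert x G ∧ M ≤ marg (extendFn k f) x G)
    (hWB : ∀ B ∈ start, ∀ B' ∈ start, W ∩ B ⊆ B')
    (hWM : ∀ x ∈ W, x ∉ Z → (∀ B ∈ start, x ∉ B) → marg (extendFn k f) x G ≤ M)
    (hinter : start.Pairwise fun B B' => B ∩ B' ⊆ G ∪ W) :
    GoodOutputs f ε ℓ Z G W ((interlace ε ℓ Z G M start).run f) ∧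
    (interlace ε ℓ Z G M start).queries f ≤
      ℓ * (2 * (Fintype.card α + 3 * k) * (levelBound ε k + 1)) := by
  obtain ⟨h1, h2, h3, h4⟩ := interlace_spec hf hε hε1 hM hk hℓ hkℓ hGZ hW hWZ start hlen hstart hWB
    hWM hinter
  exact ⟨⟨h1, fun A hA => (h2 A hA).1, fun A hA => (h2 A hA).2.1, fun A hA => (h2 A hA).2.2.1,
    fun A hA => (h2 A hA).2.2.2, h3⟩, h4⟩

/-- The size conditions under which the subroutine is called. -/
structure Admissible (ℓ : ℕ) (Z G : Finset (Ground α k)) : Prop where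
  k_pos : 0 < k
  dvd : ℓ ∣ k
  two_le : 2 ≤ k / ℓ
  base : G.card < k
  guide : Z.card ≤ k

theorem Admissible.pos (h : Admissible ℓ Z G) : 0 < ℓ := by
  rcases Nat.eq_zero_or_pos ℓ with h0 | h0
  · have := h.two_le
    rw [h0, Nat.div_zero] at this
    omega
  · exact h0

theorem Admissible.card_add_le (h : Admissible ℓ Z G) : G.card + Z.card + ℓ ≤ 3 * k := by
  have := Nat.le_of_dvd h.k_pos h.dvd
  have := h.base
  have := h.guide
  omega

/-- The run with `ℓ` copies of `G ∪ {a}`, where `a` has the largest gain in `W`. -/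
theorem interlace_replicate (hf : IsSubmodular f) (hε : 0 < ε) (hε1 : ε < 1)
    (h : Admissible ℓ Z G) (hW : W.card ≤ k) (hWZ : Disjoint W Z)
    {p : Ground α k × ℝ} (hp : p ∈ (topGains ℓ Z G).run f) (hpW : p.1 ∈ W)
    (hmax : ∀ x ∈ W, x ∉ G → marg (extendFn k f) x G ≤ p.2) :
    GoodOutputs f ε ℓ Z G W
      ((interlace ε ℓ Z G p.2 (List.replicate ℓ (insert p.1 G))).run f) ∧
    (interlace ε ℓ Z G p.2 (List.replicate ℓ (insert p.1 G))).queries f ≤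
      ℓ * (2 * (Fintype.card α + 3 * k) * (levelBound ε k + 1)) := by
  obtain ⟨-, h2, -, -, -⟩ := topGains_spec f h.card_add_le
  obtain ⟨h3, h4, h5⟩ := h2 p hp
  apply interlace_good hf hε hε1 h5 h.k_pos h.dvd h.two_le
    (by have := h.base; have := h.guide; omega) hW hWZ _ (List.length_replicate ..)
  · intro B hB
    exact ⟨p.1, h3, List.eq_of_mem_replicate hB, h4.le⟩
  · intro B hB B' hB'
    rw [List.eq_of_mem_replicate hB, List.eq_of_mem_replicate hB']
    exact Finset.inter_subset_right
  · intro x hxW _ hx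
    have := hx _ (List.mem_replicate.2 ⟨h.pos.ne', rfl⟩)
    rw [Finset.mem_insert, not_or] at this
    exact hmax x hxW this.2
  · rw [List.pairwise_replicate]
    right
    rw [Finset.inter_self]
    exact Finset.insert_subset (Finset.mem_union_right _ hpW) Finset.subset_union_left

/-- The run with the sets `G ∪ {a}` for all `ℓ` top elements `a`, none of them in `W`. -/
theorem interlace_distinct (hf : IsSubmodular f) (hε : 0 < ε) (hε1 : ε < 1)
    (h : Admissible ℓ Z G) (hW : W.card ≤ k) (hWZ : Disjoint W Z)
    (hnot : ∀ p ∈ (topGains ℓ Z G).run f, p.1 ∉ W) :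
    GoodOutputs f ε ℓ Z G W
      ((interlace ε ℓ Z G (((topGains ℓ Z G).run f).getLast?.elim 0 Prod.snd)
        (((topGains ℓ Z G).run f).map fun p => insert p.1 G)).run f) ∧
    (interlace ε ℓ Z G (((topGains ℓ Z G).run f).getLast?.elim 0 Prod.snd)
        (((topGains ℓ Z G).run f).map fun p => insert p.1 G)).queries f ≤
      ℓ * (2 * (Fintype.card α + 3 * k) * (levelBound ε k + 1)) := by
  obtain ⟨h1, h2, h3, h4, h5⟩ := topGains_spec f h.card_add_le
  set top := (topGains ℓ Z G).run f with htop
  have hne : top ≠ [] := by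
    intro h'
    rw [h'] at h1
    exact h.pos.ne' h1.symm
  have hlast : top.getLast?.elim 0 Prod.snd = (top.getLast hne).2 := by
    rw [List.getLast?_eq_getLast_of_ne_nil hne]; rfl
  have hmin : ∀ p ∈ top, (top.getLast hne).2 ≤ p.2 := by
    intro p hp
    rw [← List.dropLast_append_getLast hne] at hp
    rcases List.mem_append.1 hp with hp | hp
    · have h4' := h4
      rw [← List.dropLast_append_getLast hne, List.pairwise_append] at h4'
      exact h4'.2.2 p hp _ (by simp)
    · rw [List.mem_singleton] at hp
      rw [hp]
  have hmem := List.getLast_mem hne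
  rw [hlast]
  have hWB : ∀ p ∈ top, W ∩ insert p.1 G ⊆ G := by
    intro p hp x hx
    rw [Finset.mem_inter, Finset.mem_insert] at hx
    rcases hx.2 with h' | h'
    · exact absurd (h' ▸ hx.1) (hnot p hp)
    · exact h'
  apply interlace_good hf hε hε1 (h2 _ hmem).2.2 h.k_pos h.dvd h.two_le
    (by have := h.base; have := h.guide; omega) hW hWZ _ (by rw [List.length_map, h1])
  · intro B hB
    obtain ⟨p, hp, rfl⟩ := List.mem_map.1 hB
    exact ⟨p.1, (h2 p hp).1, rfl, (h2 p hp).2.1 ▸ hmin p hp⟩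
  · intro B hB B' hB'
    obtain ⟨p, hp, rfl⟩ := List.mem_map.1 hB
    obtain ⟨p', hp', rfl⟩ := List.mem_map.1 hB'
    exact (hWB p hp).trans (Finset.subset_insert _ _)
  · intro x hxW hxZ hx
    have hx' : ∀ p ∈ top, x ∉ insert p.1 G := fun p hp => hx _ (List.mem_map.2 ⟨p, hp, rfl⟩)
    refine h5 x ?_ ?_ _ hmem
    · rw [Finset.mem_union, not_or]
      exact ⟨fun h' => hx' _ hmem (Finset.mem_insert_of_mem h'), hxZ⟩
    · intro p hp h'
      exact hx' p hp (h' ▸ Finset.mem_insert_self _ _)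
  · rw [List.pairwise_map]
    rw [List.nodup_iff_pairwise_ne, List.pairwise_map] at h3
    refine h3.imp ?_
    intro p q hpq x hx
    rw [Finset.mem_inter, Finset.mem_insert, Finset.mem_insert] at hx
    refine Finset.mem_union_left _ ?_
    rcases hx with ⟨h1 | h1, h2 | h2⟩
    · exact absurd (h1.symm.trans h2) hpq
    all_goals assumption

theorem run_threshGuidedIG (f : Finset α → ℝ) : (threshGuidedIG ε ℓ Z G).run f =
    (interlace ε ℓ Z G (((topGains ℓ Z G).run f).getLast?.elim 0 Prod.snd)
        (((topGains ℓ Z G).run f).map fun p => insert p.1 G)).run f ++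
      (((topGains ℓ Z G).run f).map fun p =>
        (interlace ε ℓ Z G p.2 (List.replicate ℓ (insert p.1 G))).run f).flatten := by
  simp [threshGuidedIG]

/-- What holds for all outputs of the subroutine. -/
theorem threshGuidedIG_all (hf : IsSubmodular f) (hε : 0 < ε) (hε1 : ε < 1)
    (h : Admissible ℓ Z G) :
    ((threshGuidedIG ε ℓ Z G).run f).length = ℓ * (ℓ + 1) ∧
    (∀ A ∈ (threshGuidedIG ε ℓ Z G).run f, G ⊆ A ∧ (A \ G).card ≤ k / ℓ ∧
      ∀ x ∈ A, x ∉ G → x ∉ Z) ∧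
    (threshGuidedIG ε ℓ Z G).queries f ≤ 2 * (Fintype.card α + 3 * k) +
      (ℓ + 1) * (ℓ * (2 * (Fintype.card α + 3 * k) * (levelBound ε k + 1))) := by
  obtain ⟨t1, t2, -, -, -⟩ := topGains_spec f h.card_add_le
  -- Length, sizes and cost do not depend on the comparison set, so the simplest admissible ones
  -- serve: ∅ for u = 0, and the singleton of the starting element for u ≥ 1.
  have h0 := interlace_distinct hf hε hε1 h (W := ∅) (by simp) (by simp) (by simp)
  have h1 : ∀ p ∈ (topGains ℓ Z G).run f, _ := fun p hp =>
    interlace_replicate hf hε hε1 h (W := {p.1}) (by rw [Finset.card_singleton]; exact h.k_pos)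
      (by
        rw [Finset.disjoint_singleton_left]
        exact fun h' => (t2 p hp).1 (Finset.mem_union_right _ h'))
      hp (by simp) (by
        intro x hx _
        rw [Finset.mem_singleton] at hx
        rw [hx]
        exact (t2 p hp).2.1.ge)
  refine ⟨?_, ?_, ?_⟩
  · rw [run_threshGuidedIG, List.length_append, h0.1.len, List.length_flatten, List.map_map]
    have e : ((topGains ℓ Z G).run f).map (List.length ∘ fun p : Ground α k × ℝ =>
        (interlace ε ℓ Z G p.2 (List.replicate ℓ (insert p.1 G))).run f) =
        ((topGains ℓ Z G).run f).map fun _ => ℓ :=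
      List.map_congr_left fun p hp => (h1 p hp).1.len
    rw [e, List.map_const', List.sum_replicate, t1, smul_eq_mul]
    ring
  · intro A hA
    rw [run_threshGuidedIG, List.mem_append, List.mem_flatten] at hA
    rcases hA with hA | ⟨L, hL, hA⟩
    · exact ⟨h0.1.base_sub A hA, h0.1.size_le A hA, h0.1.avoid A hA⟩
    · obtain ⟨p, hp, rfl⟩ := List.mem_map.1 hL
      have := (h1 p hp).1
      exact ⟨this.base_sub A hA, this.size_le A hA, this.avoid A hA⟩
  · have h2 := queries_forEach_le f
      (fun p : Ground α k × ℝ => interlace ε ℓ Z G p.2 (List.replicate ℓ (insert p.1 G)))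
      ((topGains ℓ Z G).run f) _ fun p hp => (h1 p hp).2
    rw [t1] at h2
    have h3 := queries_topGains_le f ℓ Z G
    have h4 := h0.2
    simp only [threshGuidedIG, queries_bind, queries_ret, add_zero]
    linarith

/-- Among the outputs of the subroutine are `ℓ` sets that are good with respect to `W`. -/
theorem threshGuidedIG_good (hf : IsSubmodular f) (hε : 0 < ε) (hε1 : ε < 1)
    (h : Admissible ℓ Z G) (hW : W.card ≤ k) (hWZ : Disjoint W Z) :
    ∃ L : List (Finset (Ground α k)), GoodOutputs f ε ℓ Z G W L ∧
      ∀ A ∈ L, A ∈ (threshGuidedIG ε ℓ Z G).run f := by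
  obtain ⟨t1, t2, t3, t4, t5⟩ := topGains_spec f h.card_add_le
  by_cases hnot : ∀ p ∈ (topGains ℓ Z G).run f, p.1 ∉ W
  · refine ⟨_, (interlace_distinct hf hε hε1 h hW hWZ hnot).1, fun A hA => ?_⟩
    rw [run_threshGuidedIG]
    exact List.mem_append_left _ hA
  · push Not at hnot
    obtain ⟨p₀, hp₀, hp₀W⟩ := hnot
    -- The first top element in W has the largest gain among the elements of W outside G, since the
    -- list is sorted and no earlier entry lies in W.
    obtain ⟨p, hp⟩ : ∃ p, ((topGains ℓ Z G).run f).find? (fun p => decide (p.1 ∈ W)) = some p := by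
      rw [← Option.isSome_iff_exists, List.find?_isSome]
      exact ⟨p₀, hp₀, by simpa using hp₀W⟩
    rw [List.find?_eq_some_iff_append] at hp
    obtain ⟨hpW, pre, post, hsplit, hpre⟩ := hp
    have hpW' : p.1 ∈ W := by simpa using hpW
    have hpm : p ∈ (topGains ℓ Z G).run f := by rw [hsplit]; simp
    refine ⟨_, (interlace_replicate hf hε hε1 h hW hWZ hpm hpW' ?_).1, fun A hA => ?_⟩
    · intro x hxW hxG
      have hxGZ : x ∉ G ∪ Z := by
        rw [Finset.mem_union, not_or]
        exact ⟨hxG, Finset.disjoint_left.1 hWZ hxW⟩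
      by_cases hx : ∀ q ∈ (topGains ℓ Z G).run f, q.1 ≠ x
      · exact t5 x hxGZ hx p hpm
      · push Not at hx
        obtain ⟨q, hq, rfl⟩ := hx
        rw [← (t2 q hq).2.1]
        rw [hsplit, List.pairwise_append] at t4
        rw [hsplit, List.mem_append, List.mem_cons] at hq
        rcases hq with hq | rfl | hq
        · have := hpre q hq
          simp [hxW] at this
        · exact le_rfl
        · exact (List.pairwise_cons.1 t4.2.1).1 q hq
    · rw [run_threshGuidedIG]
      refine List.mem_append_right _ ?_
      rw [List.mem_flatten]
      exact ⟨_, List.mem_map.2 ⟨p, hpm, rfl⟩, hA⟩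

end ThreshGuided

namespace OracleProg

variable {α : Type u} {β : Type v} {γ : Type w}

theorem run_loop_concat (f : Finset α → ℝ) (step : γ → β → OracleProg α γ) (L : List β) (b : β)
    (s : γ) : (loop step (L ++ [b]) s).run f = (step ((loop step L s).run f) b).run f := by
  induction L generalizing s with
  | nil => simp [loop]
  | cons a L ih => simp [loop, ih]

theorem queries_loop_concat (f : Finset α → ℝ) (step : γ → β → OracleProg α γ) (L : List β) (b : β)
    (s : γ) : (loop step (L ++ [b]) s).queries f =
      (loop step L s).queries f + (step ((loop step L s).run f) b).queries f := by
  induction L generalizing s with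
  | nil => simp [loop]
  | cons a L ih => simp [loop, ih, add_assoc]

end OracleProg

theorem sum_le_sum_flatMap {β : Type u} (L : List β) (c : β → List β) (φ χ : β → ℝ)
    (h : ∀ A ∈ L, φ A ≤ ((c A).map χ).sum) : (L.map φ).sum ≤ ((L.flatMap c).map χ).sum := by
  induction L with
  | nil => simp
  | cons a L ih =>
    have h1 := h a List.mem_cons_self
    have h2 := ih fun A hA => h A (List.mem_cons_of_mem _ hA)
    simp only [List.map_cons, List.sum_cons, List.flatMap_cons, List.map_append, List.sum_append]
    linarith

/-! ### Pruning, and the tree of guidance sets. -/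

section Trees

variable {α : Type u} [Fintype α] [LinearOrder α] {k : ℕ} {f : Finset α → ℝ}
  {ε : ℝ} {ℓ : ℕ}

/-- Deleting x with negative gain on B \ {x} is harmless for every union S ∪ B, because the gain on
a larger set is no greater. An element once kept stays justified: later deletions only raise its
gain. -/
theorem prune_loop_spec (hf : IsSubmodular f) (L : List (Ground α k)) (B : Finset (Ground α k)) :
    let P := loop (fun B x => (gain x (B.erase x)).bind fun d =>
      ret (if d < 0 then B.erase x else B)) L B
    P.run f ⊆ B ∧ (∀ S, extendFn k f (S ∪ B) ≤ extendFn k f (S ∪ P.run f)) ∧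
    (∀ x ∈ L, x ∈ P.run f → 0 ≤ marg (extendFn k f) x ((P.run f).erase x)) ∧
    P.queries f = 2 * L.length := by
  have hF : IsSubmodular (extendFn k f) := hf.extendFn
  induction L generalizing B with
  | nil => simp [loop]
  | cons x L ih =>
    simp only [loop, run_bind, run_ret, queries_bind, queries_gain, queries_ret, add_zero]
    by_cases hneg : (gain x (B.erase x)).run f < 0
    · rw [if_pos hneg]
      rw [run_gain] at hneg
      obtain ⟨h1, h2, h3, h4⟩ := ih (B.erase x)
      refine ⟨h1.trans (Finset.erase_subset _ _), ?_, ?_, ?_⟩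
      · intro S
        refine le_trans ?_ (h2 S)
        by_cases hxB : x ∈ B
        swap
        · rw [Finset.erase_eq_of_notMem hxB]
        by_cases hxS : x ∈ S
        · have e : S ∪ B.erase x = S ∪ B := by
            ext y
            simp only [Finset.mem_union, Finset.mem_erase]
            by_cases hy : y = x
            · subst hy; simp [hxS]
            · simp [hy]
          rw [e]
        · have e : S ∪ B = insert x (S ∪ B.erase x) := by
            rw [← Finset.union_insert, Finset.insert_erase hxB]
          have := hF.marg_anti (Finset.subset_union_right (s₁ := S) (s₂ := B.erase x)) (x := x)
            (by simp [hxS])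
          rw [e]
          have e2 : marg (extendFn k f) x (S ∪ B.erase x) =
            extendFn k f (insert x (S ∪ B.erase x)) - extendFn k f (S ∪ B.erase x) := rfl
          linarith
      · intro y hy hyP
        rcases List.mem_cons.1 hy with rfl | hy
        · exact absurd (h1 hyP) (Finset.notMem_erase _ _)
        · exact h3 y hy hyP
      · rw [h4, List.length_cons]; ring
    · rw [if_neg hneg]
      rw [run_gain] at hneg
      obtain ⟨h1, h2, h3, h4⟩ := ih B
      refine ⟨h1, h2, ?_, ?_⟩
      · intro y hy hyP
        rcases List.mem_cons.1 hy with rfl | hy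
        · exact (not_lt.1 hneg).trans (hF.marg_anti (Finset.erase_subset_erase _ h1)
            (Finset.notMem_erase _ _))
        · exact h3 y hy hyP
      · rw [h4, List.length_cons]; ring

/-- An element of B added on the way from S to B gains at least as much as it does on top of all the
others. For pruned guides this yields F(O ∩ Z) ≤ F(Z). -/
theorem IsSubmodular.le_of_marg_nonneg {β : Type u} [DecidableEq β] {F : Finset β → ℝ}
    (hF : IsSubmodular F) {S B : Finset β} (hS : S ⊆ B)
    (h : ∀ x ∈ B, 0 ≤ marg F x (B.erase x)) : F S ≤ F B := by
  have key : ∀ C : Finset β, C ⊆ B → F S ≤ F (S ∪ C) := by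
    intro C
    induction C using Finset.induction_on with
    | empty => simp
    | insert x C hx ih =>
      intro hC
      have h1 := ih ((Finset.subset_insert _ _).trans hC)
      have hxB := hC (Finset.mem_insert_self _ _)
      rw [Finset.union_insert]
      by_cases hxS : x ∈ S ∪ C
      · rwa [Finset.insert_eq_of_mem hxS]
      · have h2 := hF.marg_anti (A := S ∪ C) (B := B.erase x) (x := x) ?_
          (Finset.notMem_erase _ _)
        · have h3 := h x hxB
          have e : marg F x (S ∪ C) = F (insert x (S ∪ C)) - F (S ∪ C) := rfl
          linarith
        · intro y hy
          rw [Finset.mem_erase]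
          refine ⟨fun e => hxS (e ▸ hy), ?_⟩
          rcases Finset.mem_union.1 hy with hy | hy
          · exact hS hy
          · exact hC (Finset.mem_insert_of_mem hy)
  have := key B le_rfl
  rwa [Finset.union_eq_right.2 hS] at this

theorem prune_spec (hf : IsSubmodular f) (A : Finset (Ground α k)) :
    (prune A).run f ⊆ A ∧
    (∀ S, extendFn k f (S ∪ A) ≤ extendFn k f (S ∪ (prune A).run f)) ∧
    (∀ S, S ⊆ (prune A).run f → extendFn k f S ≤ extendFn k f ((prune A).run f)) ∧
    (prune A).queries f ≤ 2 * (Fintype.card α + 3 * k) := by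
  obtain ⟨h1, h2, h3, h4⟩ := prune_loop_spec hf (elems.filter fun x => x ∈ A) A
  refine ⟨h1, h2, ?_, ?_⟩
  · intro S hS
    apply hf.extendFn.le_of_marg_nonneg hS
    intro x hx
    refine h3 x ?_ hx
    rw [List.mem_filter]
    exact ⟨mem_elems x, by simpa using h1 hx⟩
  · have := List.length_filter_le (fun x : Ground α k => decide (x ∈ A)) elems
    rw [length_elems] at this
    have h5 : (prune A).queries f = _ := h4
    omega

/-- The bound on the number of queries of one call of the subroutine. -/
noncomputable def callCost (α : Type u) [Fintype α] (k : ℕ) (ε : ℝ) (ℓ : ℕ) : ℕ :=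
  2 * (Fintype.card α + 3 * k) +
    (ℓ + 1) * (ℓ * (2 * (Fintype.card α + 3 * k) * (levelBound ε k + 1)))

theorem admissible_of_card {Z G : Finset (Ground α k)} (hk : 0 < k) (hℓ : ℓ ∣ k)
    (h2 : 2 ≤ k / ℓ) {i : ℕ} (hi : i < ℓ) (hG : G.card ≤ i * (k / ℓ)) (hZ : Z.card ≤ k) :
    Admissible ℓ Z G := by
  refine ⟨hk, hℓ, h2, ?_, hZ⟩
  have h3 : ℓ * (k / ℓ) = k := Nat.mul_div_cancel' hℓ
  have h4 : i * (k / ℓ) < ℓ * (k / ℓ) := Nat.mul_lt_mul_of_pos_right hi (by omega)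
  omega

theorem card_le_of_sdiff {G A : Finset (Ground α k)} {i m : ℕ} (hG : G.card ≤ i * m)
    (hA : (A \ G).card ≤ m) : A.card ≤ (i + 1) * m := by
  have h1 := Finset.card_le_card_sdiff_add_card (s := A) (t := G)
  rw [add_mul, one_mul]
  omega

/-- The pruned outputs of an unguided call. -/
noncomputable def prunedOutputs (f : Finset α → ℝ) (ε : ℝ) (ℓ : ℕ) (A : Finset (Ground α k)) :
    List (Finset (Ground α k)) :=
  ((threshGuidedIG ε ℓ ∅ A).run f).map fun B => (prune B).run f

theorem run_guidanceSets_succ (f : Finset α → ℝ) (n : ℕ) (F : List (Finset (Ground α k))) :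
    (guidanceSets ε ℓ (n + 1) F).run f = F.flatMap (prunedOutputs f ε ℓ) ++
      (guidanceSets ε ℓ n (F.flatMap (prunedOutputs f ε ℓ))).run f := by
  simp only [guidanceSets, List.flatMap_def, run_bind, run_forEach, run_ret]
  rfl

theorem queries_guidanceSets_succ (f : Finset α → ℝ) (n : ℕ) (F : List (Finset (Ground α k))) :
    (guidanceSets ε ℓ (n + 1) F).queries f =
      (forEach (fun A => (threshGuidedIG ε ℓ ∅ A).bind (forEach prune)) F).queries f +
      (guidanceSets ε ℓ n (F.flatMap (prunedOutputs f ε ℓ))).queries f := by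
  simp only [guidanceSets, List.flatMap_def, run_bind, queries_bind, run_forEach,
    queries_ret, add_zero]
  rfl

theorem length_flatMap_eq {β : Type u} {γ : Type v} (L : List β) (c : β → List γ) (m : ℕ)
    (h : ∀ A ∈ L, (c A).length = m) : (L.flatMap c).length = L.length * m := by
  induction L with
  | nil => simp
  | cons a L ih =>
    rw [List.flatMap_cons, List.length_append, h a List.mem_cons_self,
      ih fun A hA => h A (List.mem_cons_of_mem _ hA), List.length_cons]
    ring

theorem prunedOutputs_spec (hf : IsSubmodular f) (hε : 0 < ε) (hε1 : ε < 1) (hk : 0 < k)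
    (hℓ : ℓ ∣ k) (h2 : 2 ≤ k / ℓ) {m : ℕ} (hm : m < ℓ) {A : Finset (Ground α k)}
    (hA : A.card ≤ m * (k / ℓ)) :
    (prunedOutputs f ε ℓ A).length = ℓ * (ℓ + 1) ∧
    (∀ B ∈ prunedOutputs f ε ℓ A, B.card ≤ (m + 1) * (k / ℓ) ∧
      ∀ S, S ⊆ B → extendFn k f S ≤ extendFn k f B) ∧
    ((threshGuidedIG ε ℓ ∅ A).bind (forEach prune)).queries f ≤
      callCost α k ε ℓ + ℓ * (ℓ + 1) * (2 * (Fintype.card α + 3 * k)) := by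
  obtain ⟨h3, h4, h5⟩ := threshGuidedIG_all hf hε hε1
    (admissible_of_card hk hℓ h2 hm hA (Z := ∅) (by simp))
  refine ⟨by rw [prunedOutputs, List.length_map, h3], ?_, ?_⟩
  · intro B hB
    obtain ⟨C, hC, rfl⟩ := List.mem_map.1 hB
    obtain ⟨p1, p2, p3, p4⟩ := prune_spec hf C
    exact ⟨(Finset.card_le_card p1).trans (card_le_of_sdiff hA (h4 C hC).2.1), p3⟩
  · rw [queries_bind]
    have h6 := queries_forEach_le f (prune (α := α) (k := k))
      ((threshGuidedIG ε ℓ ∅ A).run f) _ fun B _ => (prune_spec hf B).2.2.2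
    rw [h3] at h6
    unfold callCost
    omega

/-- The counts are geometric sums with ratio s = ℓ * (ℓ + 1) ≥ 2, bounded by twice their last term.
Multiplying by s avoids a division, and the extra summands on the left make the induction close. -/
theorem guidanceSets_all (hf : IsSubmodular f) (hε : 0 < ε) (hε1 : ε < 1) (hk : 0 < k)
    (hℓ : ℓ ∣ k) (h2 : 2 ≤ k / ℓ) (n m : ℕ) (hnm : m + n ≤ ℓ) (F : List (Finset (Ground α k)))
    (hF : ∀ A ∈ F, A.card ≤ m * (k / ℓ)) :
    (∀ B ∈ (guidanceSets ε ℓ n F).run f, B.card ≤ k ∧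
      ∀ S, S ⊆ B → extendFn k f S ≤ extendFn k f B) ∧
    ((guidanceSets ε ℓ n F).run f).length + 2 * F.length ≤
      2 * F.length * (ℓ * (ℓ + 1)) ^ n ∧
    ℓ * (ℓ + 1) * (guidanceSets ε ℓ n F).queries f + 2 * F.length *
        (callCost α k ε ℓ + ℓ * (ℓ + 1) * (2 * (Fintype.card α + 3 * k))) ≤
      2 * F.length * (callCost α k ε ℓ + ℓ * (ℓ + 1) * (2 * (Fintype.card α + 3 * k))) *
        (ℓ * (ℓ + 1)) ^ n := by
  induction n generalizing m F with
  | zero => simp [guidanceSets]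
  | succ n ih =>
    have hm : m < ℓ := by omega
    have hs : 2 ≤ ℓ * (ℓ + 1) := by nlinarith
    have hp := fun A hA => prunedOutputs_spec hf hε hε1 hk hℓ h2 hm (hF A hA)
    have hlen := length_flatMap_eq F (prunedOutputs f ε ℓ) _ fun A hA => (hp A hA).1
    have hmem : ∀ B ∈ F.flatMap (prunedOutputs f ε ℓ), B.card ≤ (m + 1) * (k / ℓ) ∧
        ∀ S, S ⊆ B → extendFn k f S ≤ extendFn k f B := by
      intro B hB
      obtain ⟨A, hA, hB⟩ := List.mem_flatMap.1 hB
      exact (hp A hA).2.1 B hB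
    obtain ⟨i1, i2, i3⟩ := ih (m + 1) (by omega) _ fun B hB => (hmem B hB).1
    have hq := queries_forEach_le f _ F _ fun A hA => (hp A hA).2.2
    rw [run_guidanceSets_succ, queries_guidanceSets_succ]
    rw [hlen] at i2 i3
    set s := ℓ * (ℓ + 1)
    set c := callCost α k ε ℓ + s * (2 * (Fintype.card α + 3 * k))
    refine ⟨?_, ?_, ?_⟩
    · intro B hB
      rcases List.mem_append.1 hB with hB | hB
      · refine ⟨(hmem B hB).1.trans ?_, (hmem B hB).2⟩
        calc (m + 1) * (k / ℓ) ≤ ℓ * (k / ℓ) := Nat.mul_le_mul_right _ (by omega)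
          _ = k := Nat.mul_div_cancel' hℓ
      · exact i1 B hB
    · rw [List.length_append, hlen, pow_succ]
      have : 2 * F.length ≤ F.length * s := by
        rw [mul_comm]; exact Nat.mul_le_mul_left _ hs
      linarith
    · have h3 : 2 * (F.length * c) ≤ s * (F.length * c) := Nat.mul_le_mul_right _ hs
      have h4 := Nat.mul_le_mul_left s hq
      rw [pow_succ]
      linarith

theorem mem_guidanceSets {n i : ℕ} (hi : i < n) (F : List (Finset (Ground α k)))
    {B : Finset (Ground α k)}
    (hB : B ∈ (fun F => F.flatMap (prunedOutputs f ε ℓ))^[i + 1] F) :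
    B ∈ (guidanceSets ε ℓ n F).run f := by
  induction n generalizing i F with
  | zero => omega
  | succ n ih =>
    rw [run_guidanceSets_succ]
    cases i with
    | zero => exact List.mem_append_left _ hB
    | succ i =>
      rw [Function.iterate_succ_apply] at hB
      exact List.mem_append_right _ (ih (by omega) _ hB)

/-- The factor `κ` in the recursion `(1 + κ) * f A ≥ f G + κ * f (O ∪ A)` for one call. -/
noncomputable def rate (ε : ℝ) (ℓ : ℕ) : ℝ := (1 - ε) / (ℓ + ε)

theorem rate_step {a b g : ℝ} (hε : 0 < ε) (h : (1 - ε) * (b - a) ≤ (ℓ + ε) * (a - g)) :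
    g + rate ε ℓ * b ≤ (1 + rate ε ℓ) * a := by
  have hpos : (0 : ℝ) < ℓ + ε := by positivity
  have e : rate ε ℓ * (b - a) ≤ a - g := by
    unfold rate
    rw [div_mul_eq_mul_div, div_le_iff₀ hpos]
    linarith
  linarith

/-- A tree of guidance sets along which the average values can be controlled. -/
theorem exists_guidance_tree (hf : IsSubmodular f) (h0 : ∀ S, 0 ≤ f S) (hε : 0 < ε) (hε1 : ε < 1)
    (hk : 0 < k) (hℓ : ℓ ∣ k) (h2 : 2 ≤ k / ℓ) (O : Finset (Ground α k)) (hO : O.card ≤ k) :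
    ∃ L : ℕ → List (Finset (Ground α k)), L 0 = [∅] ∧
      (∀ i, i ≤ ℓ → (L i).length = ℓ ^ i) ∧
      (∀ i, i < ℓ → ∀ A ∈ L (i + 1), A ∈ (guidanceSets ε ℓ ℓ [∅]).run f) ∧
      (∀ i, i < ℓ → ℓ * ((L i).map (extendFn k f)).sum +
          rate ε ℓ * ((ℓ - 1) * ((L i).map fun A => extendFn k f (O ∪ A)).sum) ≤
        (1 + rate ε ℓ) * ((L (i + 1)).map (extendFn k f)).sum) ∧
      (∀ i, i < ℓ → ((ℓ : ℝ) - 1) * ((L i).map fun A => extendFn k f (O ∪ A)).sum ≤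
        ((L (i + 1)).map fun A => extendFn k f (O ∪ A)).sum) := by
  have hκ : 0 ≤ rate ε ℓ := div_nonneg (by linarith) (by positivity)
  have hc : ∀ A : Finset (Ground α k), ∃ c : List (Finset (Ground α k)), Admissible ℓ ∅ A →
      c.length = ℓ ∧ (∀ B ∈ c, B ∈ prunedOutputs f ε ℓ A) ∧
      (∀ B ∈ c, B.card ≤ A.card + k / ℓ) ∧
      ℓ * extendFn k f A + rate ε ℓ * ((ℓ - 1) * extendFn k f (O ∪ A)) ≤
        (c.map fun B => (1 + rate ε ℓ) * extendFn k f B).sum ∧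
      (ℓ - 1) * extendFn k f (O ∪ A) ≤ (c.map fun B => extendFn k f (O ∪ B)).sum := by
    intro A
    by_cases hA : Admissible ℓ ∅ A
    swap
    -- An arbitrary value: the tree only contains admissible sets.
    · exact ⟨[], fun h => absurd h hA⟩
    obtain ⟨c, hc1, hc2⟩ := threshGuidedIG_good hf hε hε1 hA hO (W := O) (by simp)
    have hsum := hc1.sum_union_ge hf h0 (S := O) le_rfl
    have hpr : ∀ B, extendFn k f B ≤ extendFn k f ((prune B).run f) := by
      intro B
      have := (prune_spec hf B).2.1 ∅
      rwa [Finset.empty_union, Finset.empty_union] at this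
    have hlist : ∀ (L : List (Finset (Ground α k))) (φ ψ : Finset (Ground α k) → ℝ),
        (∀ B ∈ L, φ B ≤ ψ B) → (L.map φ).sum ≤ (L.map ψ).sum :=
      fun L φ ψ h => List.sum_le_sum h
    refine ⟨c.map fun B => (prune B).run f, fun _ => ⟨by rw [List.length_map, hc1.len], ?_, ?_, ?_,
      ?_⟩⟩
    · intro B hB
      obtain ⟨C, hC, rfl⟩ := List.mem_map.1 hB
      exact List.mem_map.2 ⟨C, hc2 C hC, rfl⟩
    · intro B hB
      obtain ⟨C, hC, rfl⟩ := List.mem_map.1 hB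
      refine (Finset.card_le_card (prune_spec hf C).1).trans ?_
      have h3 := hc1.size_le C hC
      have h4 := Finset.card_le_card_sdiff_add_card (s := C) (t := A)
      omega
    · rw [List.map_map]
      -- Pruning decreases neither F(B) nor F(O ∪ B), so the estimates for the unpruned outputs
      -- survive.
      refine le_trans ?_ (hlist c (fun B => extendFn k f A + rate ε ℓ * extendFn k f (O ∪ B)) _ ?_)
      · rw [List.sum_map_add, List.map_const', List.sum_replicate, List.sum_map_mul_left, hc1.len,
          nsmul_eq_mul]
        have := mul_le_mul_of_nonneg_left hsum hκ
        linarith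
      · intro B hB
        refine (rate_step hε (hc1.gain B hB)).trans ?_
        exact mul_le_mul_of_nonneg_left (hpr B) (by linarith)
    · rw [List.map_map]
      exact hsum.trans (hlist c _ _ fun B _ => (prune_spec hf B).2.1 O)
  choose c hc using hc
  set L : ℕ → List (Finset (Ground α k)) := fun i => (fun F => F.flatMap c)^[i] [∅] with hL
  have hLs : ∀ i, L (i + 1) = (L i).flatMap c := fun i => by
    simp only [hL, Function.iterate_succ_apply']
  have hcard : ∀ i, i ≤ ℓ → ∀ A ∈ L i, A.card ≤ i * (k / ℓ) := by
    intro i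
    induction i with
    | zero => intro _ A hA; simp [hL] at hA; simp [hA]
    | succ i ih =>
      intro hi A hA
      rw [hLs, List.mem_flatMap] at hA
      obtain ⟨B, hB, hA⟩ := hA
      have h3 := ih (by omega) B hB
      have h4 := (hc B (admissible_of_card hk hℓ h2 (by omega) h3 (by simp))).2.2.1 A hA
      rw [add_mul, one_mul]
      omega
  have hadm : ∀ i, i < ℓ → ∀ A ∈ L i, Admissible ℓ ∅ A := fun i hi A hA =>
    admissible_of_card hk hℓ h2 hi (hcard i hi.le A hA) (by simp)
  refine ⟨L, rfl, ?_, ?_, ?_, ?_⟩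
  · intro i
    induction i with
    | zero => intro _; simp [hL]
    | succ i ih =>
      intro hi
      rw [hLs, length_flatMap_eq _ _ ℓ fun A hA => (hc A (hadm i (by omega) A hA)).1,
        ih (by omega), pow_succ]
  · have hmem : ∀ i, i ≤ ℓ → ∀ A ∈ L i,
        A ∈ (fun F => F.flatMap (prunedOutputs f ε ℓ))^[i] [∅] := by
      intro i
      induction i with
      | zero => intro _ A hA; exact hA
      | succ i ih =>
        intro hi A hA
        rw [hLs, List.mem_flatMap] at hA
        obtain ⟨B, hB, hA⟩ := hA
        rw [Function.iterate_succ_apply', List.mem_flatMap]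
        exact ⟨B, ih (by omega) B hB, (hc B (hadm i (by omega) B hB)).2.1 A hA⟩
    intro i hi A hA
    exact mem_guidanceSets hi _ (hmem (i + 1) (by omega) A hA)
  · intro i hi
    have := sum_le_sum_flatMap (L i) c _ _ fun A hA => (hc A (hadm i hi A hA)).2.2.2.1
    rw [List.sum_map_add, List.sum_map_mul_left, List.sum_map_mul_left, List.sum_map_mul_left,
      List.sum_map_mul_left, ← hLs] at this
    exact this
  · intro i hi
    have := sum_le_sum_flatMap (L i) c _ _ fun A hA => (hc A (hadm i hi A hA)).2.2.2.2
    rw [List.sum_map_mul_left, ← hLs] at this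
    exact this

end Trees

/-! ### Average values along the trees. -/

section Averages

variable {α : Type u} [Fintype α] [LinearOrder α] {k : ℕ} {f : Finset α → ℝ}
  {ε t : ℝ} {ℓ : ℕ}

theorem listSum_le_listSum {β : Type u} {L : List β} {φ ψ : β → ℝ} (h : ∀ B ∈ L, φ B ≤ ψ B) :
    (L.map φ).sum ≤ (L.map ψ).sum := List.sum_le_sum h

/-- The average values along the tree of guidance sets. Every linear inequality between the values
`f Z` and `f (O ∪ Z)` that holds for all guidance sets `Z` holds for the averages. -/
theorem exists_guidance_averages (hf : IsSubmodular f) (h0 : ∀ S, 0 ≤ f S) (hε : 0 < ε)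
    (hε1 : ε < 1) (hk : 0 < k) (hℓ : ℓ ∣ k) (h2 : 2 ≤ k / ℓ) (O : Finset (Ground α k))
    (hO : O.card ≤ k) :
    ∃ z b : ℕ → ℝ, 0 ≤ z 0 ∧ b 0 = extendFn k f O ∧
      (∀ i, i < ℓ → z i + rate ε ℓ * ((1 - 1 / ℓ) * b i) ≤ (1 + rate ε ℓ) * z (i + 1)) ∧
      (∀ i, i < ℓ → (1 - 1 / ℓ) * b i ≤ b (i + 1)) ∧
      ∀ x y w : ℝ, (∀ Z ∈ (guidanceSets ε ℓ ℓ [∅]).run f,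
        w ≤ x * extendFn k f Z + y * extendFn k f (O ∪ Z)) →
        ∀ i, i < ℓ → w ≤ x * z (i + 1) + y * b (i + 1) := by
  obtain ⟨L, hL0, hlen, hmem, hz, hb⟩ := exists_guidance_tree hf h0 hε hε1 hk hℓ h2 O hO
  have hℓ0 : 0 < ℓ := Nat.pos_of_ne_zero fun h => by simp [h] at h2
  have hℓR : (0 : ℝ) < ℓ := by exact_mod_cast hℓ0
  refine ⟨fun i => ((L i).map (extendFn k f)).sum / ℓ ^ i,
    fun i => ((L i).map fun A => extendFn k f (O ∪ A)).sum / ℓ ^ i, ?_, ?_, ?_, ?_, ?_⟩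
  · simp only [hL0, List.map_cons, List.map_nil, List.sum_cons, List.sum_nil, add_zero, pow_zero,
      div_one]
    exact h0 _
  · simp [hL0]
  · intro i hi
    have hp : (0 : ℝ) < ℓ ^ (i + 1) := by positivity
    have := div_le_div_of_nonneg_right (hz i hi) hp.le
    dsimp only
    refine le_of_eq_of_le ?_ (this.trans_eq ?_)
    · rw [pow_succ]; field_simp
    · ring
  · intro i hi
    have hp : (0 : ℝ) < ℓ ^ (i + 1) := by positivity
    have := div_le_div_of_nonneg_right (hb i hi) hp.le
    dsimp only
    refine le_of_eq_of_le ?_ this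
    rw [pow_succ]; field_simp
  · intro x y w hw i hi
    have hp : (0 : ℝ) < ℓ ^ (i + 1) := by positivity
    have h3 := listSum_le_listSum fun A hA => hw A (hmem i hi A hA)
    rw [List.map_const', List.sum_replicate, hlen _ (by omega), List.sum_map_add,
      List.sum_map_mul_left, List.sum_map_mul_left, nsmul_eq_mul] at h3
    have := div_le_div_of_nonneg_right h3 hp.le
    push_cast at this
    rw [mul_div_cancel_left₀ _ hp.ne'] at this
    calc w ≤ _ := this
      _ = _ := by ring

/-- The family of candidate solutions after `i` guided iterations. -/
noncomputable def guidedFamily (ε t : ℝ) (ℓ : ℕ) (A : Finset (Ground α k)) (i : ℕ) :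
    OracleProg α (List (Finset (Ground α k))) :=
  loop (fun F (j : ℝ) =>
      (forEach (threshGuidedIG ε ℓ (if j ≤ t * ℓ then A else ∅)) F).bind
        fun F' => ret F'.flatten)
    ((List.range' 1 i).map Nat.cast) [∅]

/-- The loop variable of `guidedSets` has type ℝ and its index list is cast entrywise; the right
side makes that cast an explicit `map`. -/
theorem guidedSets_eq (A : Finset (Ground α k)) :
    guidedSets ε t ℓ A = guidedFamily ε t ℓ A ℓ := by
  unfold guidedSets guidedFamily
  congr 1
  simp [List.map_eq_flatMap]

/-- The guide of iteration `i + 1`. -/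
noncomputable def guideAt (t : ℝ) (ℓ : ℕ) (A : Finset (Ground α k)) (i : ℕ) :
    Finset (Ground α k) :=
  if ((i + 1 : ℕ) : ℝ) ≤ t * ℓ then A else ∅

theorem guideAt_subset (A : Finset (Ground α k)) (i : ℕ) : guideAt t ℓ A i ⊆ A := by
  unfold guideAt
  split_ifs <;> simp

theorem run_guidedFamily_succ (f : Finset α → ℝ) (A : Finset (Ground α k)) (i : ℕ) :
    (guidedFamily ε t ℓ A (i + 1)).run f = ((guidedFamily ε t ℓ A i).run f).flatMap
      fun B => (threshGuidedIG ε ℓ (guideAt t ℓ A i) B).run f := by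
  rw [guidedFamily, List.range'_1_concat, List.map_append, List.map_singleton, run_loop_concat]
  simp only [run_bind, run_forEach, run_ret, List.flatMap_def, add_comm 1 i]
  rfl

theorem queries_guidedFamily_succ (f : Finset α → ℝ) (A : Finset (Ground α k)) (i : ℕ) :
    (guidedFamily ε t ℓ A (i + 1)).queries f = (guidedFamily ε t ℓ A i).queries f +
      (forEach (threshGuidedIG ε ℓ (guideAt t ℓ A i)) ((guidedFamily ε t ℓ A i).run f)).queries
        f := by
  rw [guidedFamily, List.range'_1_concat, List.map_append, List.map_singleton, queries_loop_concat]
  simp only [queries_bind, queries_ret, add_zero, add_comm 1 i]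
  rfl

theorem guidedFamily_all (hf : IsSubmodular f) (hε : 0 < ε) (hε1 : ε < 1) (hk : 0 < k)
    (hℓ : ℓ ∣ k) (h2 : 2 ≤ k / ℓ) {Z : Finset (Ground α k)} (hZ : Z.card ≤ k) (i : ℕ)
    (hi : i ≤ ℓ) :
    (∀ B ∈ (guidedFamily ε t ℓ Z i).run f, B.card ≤ i * (k / ℓ)) ∧
    ((guidedFamily ε t ℓ Z i).run f).length = (ℓ * (ℓ + 1)) ^ i ∧
    ℓ * (ℓ + 1) * (guidedFamily ε t ℓ Z i).queries f + 2 * callCost α k ε ℓ ≤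
      2 * callCost α k ε ℓ * (ℓ * (ℓ + 1)) ^ i := by
  induction i with
  | zero => simp [guidedFamily, loop]
  | succ i ih =>
    obtain ⟨h3, h4, h5⟩ := ih (by omega)
    have hs : 2 ≤ ℓ * (ℓ + 1) := by nlinarith
    have hall := fun B hB => threshGuidedIG_all hf hε hε1
      (admissible_of_card hk hℓ h2 (i := i) (by omega) (h3 B hB)
        (Z := guideAt t ℓ Z i) ((Finset.card_le_card (guideAt_subset Z i)).trans hZ))
    rw [run_guidedFamily_succ, queries_guidedFamily_succ]
    refine ⟨?_, ?_, ?_⟩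
    · intro B hB
      obtain ⟨A, hA, hB⟩ := List.mem_flatMap.1 hB
      exact card_le_of_sdiff (h3 A hA) ((hall A hA).2.1 B hB).2.1
    · rw [length_flatMap_eq _ _ _ fun A hA => (hall A hA).1, h4, pow_succ]
    · have hq := queries_forEach_le f (threshGuidedIG ε ℓ (guideAt t ℓ Z i))
        ((guidedFamily ε t ℓ Z i).run f) (callCost α k ε ℓ) fun A hA => (hall A hA).2.2
      rw [h4] at hq
      set s := ℓ * (ℓ + 1)
      have h6 := Nat.mul_le_mul_left s hq
      have h7 : 2 * (s ^ i * callCost α k ε ℓ) ≤ s * (s ^ i * callCost α k ε ℓ) :=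
        Nat.mul_le_mul_right _ hs
      rw [pow_succ]
      linarith

/-- A tree of candidate solutions along which the average values can be controlled. -/
theorem exists_guided_tree (hf : IsSubmodular f) (h0 : ∀ S, 0 ≤ f S) (hε : 0 < ε) (hε1 : ε < 1)
    (hk : 0 < k) (hℓ : ℓ ∣ k) (h2 : 2 ≤ k / ℓ) (O Z : Finset (Ground α k)) (hO : O.card ≤ k)
    (hZ : Z.card ≤ k) :
    ∃ L : ℕ → List (Finset (Ground α k)), L 0 = [∅] ∧
      (∀ i, i ≤ ℓ → (L i).length = ℓ ^ i) ∧
      (∀ i, i ≤ ℓ → ∀ A ∈ L i, A ∈ (guidedFamily ε t ℓ Z i).run f) ∧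
      (∀ i, i < ℓ → ∀ B ∈ L (i + 1), ∃ A ∈ L i, ∀ x ∈ B, x ∉ A → x ∉ guideAt t ℓ Z i) ∧
      (∀ i, i < ℓ → ℓ * ((L i).map (extendFn k f)).sum + rate ε ℓ *
          ((L (i + 1)).map fun A => extendFn k f ((O \ guideAt t ℓ Z i) ∪ A)).sum ≤
        (1 + rate ε ℓ) * ((L (i + 1)).map (extendFn k f)).sum) ∧
      (∀ i, i < ℓ → ∀ S, O \ guideAt t ℓ Z i ⊆ S →
        ((ℓ : ℝ) - 1) * ((L i).map fun A => extendFn k f (S ∪ A)).sum ≤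
        ((L (i + 1)).map fun A => extendFn k f (S ∪ A)).sum) := by
  have hc : ∀ (i : ℕ) (A : Finset (Ground α k)), ∃ c : List (Finset (Ground α k)),
      Admissible ℓ (guideAt t ℓ Z i) A →
      GoodOutputs f ε ℓ (guideAt t ℓ Z i) A (O \ guideAt t ℓ Z i) c ∧
      ∀ B ∈ c, B ∈ (threshGuidedIG ε ℓ (guideAt t ℓ Z i) A).run f := by
    intro i A
    by_cases hA : Admissible ℓ (guideAt t ℓ Z i) A
    · obtain ⟨c, hc⟩ := threshGuidedIG_good hf hε hε1 hA (W := O \ guideAt t ℓ Z i)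
        ((Finset.card_le_card Finset.sdiff_subset).trans hO) Finset.sdiff_disjoint
      exact ⟨c, fun _ => hc⟩
    · exact ⟨[], fun h => absurd h hA⟩
  choose c hc using hc
  set L : ℕ → List (Finset (Ground α k)) := fun i =>
    Nat.rec [∅] (fun i F => F.flatMap (c i)) i with hL
  have hLs : ∀ i, L (i + 1) = (L i).flatMap (c i) := fun i => rfl
  have hcard : ∀ i, i ≤ ℓ → ∀ A ∈ L i, A ∈ (guidedFamily ε t ℓ Z i).run f ∧
      A.card ≤ i * (k / ℓ) := by
    intro i
    induction i with
    | zero => intro _ A hA; simp [hL] at hA; simp [hA, guidedFamily, loop]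
    | succ i ih =>
      intro hi A hA
      rw [hLs, List.mem_flatMap] at hA
      obtain ⟨B, hB, hA⟩ := hA
      have h3 := ih (by omega) B hB
      have h4 := (hc i B (admissible_of_card hk hℓ h2 (by omega) h3.2
        ((Finset.card_le_card (guideAt_subset Z i)).trans hZ)))
      refine ⟨?_, card_le_of_sdiff h3.2 (h4.1.size_le A hA)⟩
      rw [run_guidedFamily_succ, List.mem_flatMap]
      exact ⟨B, h3.1, h4.2 A hA⟩
  have hgood : ∀ i, i < ℓ → ∀ A ∈ L i, _ := fun i hi A hA =>
    (hc i A (admissible_of_card hk hℓ h2 hi (hcard i hi.le A hA).2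
      ((Finset.card_le_card (guideAt_subset Z i)).trans hZ))).1
  refine ⟨L, rfl, ?_, fun i hi A hA => (hcard i hi A hA).1, ?_, ?_, ?_⟩
  · intro i
    induction i with
    | zero => intro _; simp [hL]
    | succ i ih =>
      intro hi
      rw [hLs, length_flatMap_eq _ _ ℓ fun A hA => (hgood i (by omega) A hA).len,
        ih (by omega), pow_succ]
  · intro i hi B hB
    rw [hLs, List.mem_flatMap] at hB
    obtain ⟨A, hA, hB⟩ := hB
    exact ⟨A, hA, (hgood i hi A hA).avoid B hB⟩
  · intro i hi
    have := sum_le_sum_flatMap (L i) (c i) (fun A => ℓ * extendFn k f A)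
      (fun B => (1 + rate ε ℓ) * extendFn k f B +
        (-rate ε ℓ) * extendFn k f ((O \ guideAt t ℓ Z i) ∪ B)) ?_
    · rw [List.sum_map_add, List.sum_map_mul_left, List.sum_map_mul_left, List.sum_map_mul_left,
        ← hLs] at this
      linarith
    · intro A hA
      have hg := hgood i hi A hA
      calc ℓ * extendFn k f A = ((c i A).map fun _ => extendFn k f A).sum := by
            rw [List.map_const', List.sum_replicate, hg.len, nsmul_eq_mul]
        _ ≤ _ := listSum_le_listSum fun B hB => by
            have := rate_step hε (hg.gain B hB)
            linarith
  · intro i hi S hS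
    have := sum_le_sum_flatMap (L i) (c i) (fun A => ((ℓ : ℝ) - 1) * extendFn k f (S ∪ A))
      (fun A => extendFn k f (S ∪ A)) fun A hA => (hgood i hi A hA).sum_union_ge hf h0 hS
    rw [List.sum_map_mul_left, ← hLs] at this
    exact this

theorem guideAt_of_lt {i : ℕ} (Z : Finset (Ground α k)) (h : i < ⌊t * ℓ⌋₊) :
    guideAt t ℓ Z i = Z := by
  unfold guideAt
  rw [if_pos]
  exact (Nat.le_floor_iff' (Nat.succ_ne_zero i)).1 h

theorem guideAt_of_ge {i : ℕ} (Z : Finset (Ground α k)) (h : ⌊t * ℓ⌋₊ ≤ i) :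
    guideAt t ℓ Z i = ∅ := by
  unfold guideAt
  rw [if_neg]
  intro h'
  have := (Nat.le_floor_iff' (Nat.succ_ne_zero i)).2 h'
  omega

/-- The average values along the tree of candidate solutions guided by `Z`. -/
theorem exists_guided_averages (hf : IsSubmodular f) (h0 : ∀ S, 0 ≤ f S) (hε : 0 < ε)
    (hε1 : ε < 1) (hk : 0 < k) (hℓ : ℓ ∣ k) (h2 : 2 ≤ k / ℓ) (O Z : Finset (Ground α k))
    (hO : O.card ≤ k) (hZ : Z.card ≤ k) (hT : ⌊t * ℓ⌋₊ ≤ ℓ) :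
    ∃ g D e : ℕ → ℝ, 0 ≤ g 0 ∧ D 0 = extendFn k f (O ∪ Z) ∧
      (∀ i, i < ⌊t * ℓ⌋₊ → g i + rate ε ℓ * (D (i + 1) + extendFn k f O -
        extendFn k f (O ∩ Z) - extendFn k f (O ∪ Z)) ≤ (1 + rate ε ℓ) * g (i + 1)) ∧
      (∀ i, i < ⌊t * ℓ⌋₊ → (1 - 1 / ℓ) * D i ≤ D (i + 1)) ∧
      extendFn k f O + D ⌊t * ℓ⌋₊ - extendFn k f (O ∪ Z) ≤ e ⌊t * ℓ⌋₊ ∧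
      (∀ i, ⌊t * ℓ⌋₊ ≤ i → i < ℓ → g i + rate ε ℓ * e (i + 1) ≤ (1 + rate ε ℓ) * g (i + 1)) ∧
      (∀ i, ⌊t * ℓ⌋₊ ≤ i → i < ℓ → (1 - 1 / ℓ) * e i ≤ e (i + 1)) ∧
      ∃ A ∈ (guidedSets ε t ℓ Z).run f, g ℓ ≤ extendFn k f A := by
  obtain ⟨L, hL0, hlen, hmem, hav, hg, hS⟩ :=
    exists_guided_tree (t := t) hf h0 hε hε1 hk hℓ h2 O Z hO hZ
  set F := extendFn k f with hFdef
  have hF : IsSubmodular F := hf.extendFn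
  have hF0 : ∀ S, 0 ≤ F S := fun S => h0 _
  set T := ⌊t * ℓ⌋₊ with hTdef
  have hκ : 0 ≤ rate ε ℓ := div_nonneg (by linarith) (by positivity)
  have hℓ0 : 0 < ℓ := Nat.pos_of_ne_zero fun h => by simp [h] at h2
  have hℓR : (0 : ℝ) < ℓ := by exact_mod_cast hℓ0
  -- The first T iterations are guided by Z, so no element of Z enters before their end.
  have hdisj : ∀ i, i ≤ T → ∀ A ∈ L i, Disjoint A Z := by
    intro i
    induction i with
    | zero => intro _ A hA; simp [hL0] at hA; simp [hA]
    | succ i ih =>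
      intro hi B hB
      obtain ⟨A, hA, h3⟩ := hav i (by omega) B hB
      rw [guideAt_of_lt Z (by omega)] at h3
      have h4 := ih (by omega) A hA
      rw [Finset.disjoint_left] at h4 ⊢
      intro x hx
      by_cases hxA : x ∈ A
      · exact h4 hxA
      · exact h3 x hx hxA
  have hpos : ∀ i, (0 : ℝ) < ℓ ^ i := fun i => by positivity
  have hconst : ∀ i, i ≤ ℓ → ∀ w : ℝ, ((L i).map fun _ => w).sum = ℓ ^ i * w := by
    intro i hi w
    rw [List.map_const', List.sum_replicate, hlen i hi, nsmul_eq_mul]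
    push_cast
    rfl
  -- The averages of F(A), of F(O ∪ Z ∪ A) for the guided phase, and of F(O ∪ A) for the unguided
  -- one.
  refine ⟨fun i => ((L i).map F).sum / ℓ ^ i,
    fun i => ((L i).map fun A => F (O ∪ Z ∪ A)).sum / ℓ ^ i,
    fun i => ((L i).map fun A => F (O ∪ A)).sum / ℓ ^ i, ?_, ?_, ?_, ?_, ?_, ?_, ?_, ?_⟩
  · simpa [hL0] using hF0 _
  · simp [hL0]
  · intro i hi
    have h3 := hg i (by omega)
    rw [guideAt_of_lt Z hi] at h3
    -- Submodularity for (O \ Z) ∪ A and O ∪ Z, and then for O ∩ Z and their intersection. The last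
    -- two have union O because A misses Z.
    have h4 : ((L (i + 1)).map fun A => F (O ∪ Z ∪ A) + (F O - F (O ∩ Z) - F (O ∪ Z))).sum ≤
        ((L (i + 1)).map fun A => F (O \ Z ∪ A)).sum := by
      apply listSum_le_listSum
      intro A hA
      have hd := Finset.disjoint_left.1 (hdisj (i + 1) (by omega) A hA)
      have h5 := hF.union_add_inter_le (O \ Z ∪ A) (O ∪ Z)
      have e1 : O \ Z ∪ A ∪ (O ∪ Z) = O ∪ Z ∪ A := by
        ext x; simp only [Finset.mem_union, Finset.mem_sdiff]; tauto
      have h6 := hF.union_add_inter_le (O ∩ Z) ((O \ Z ∪ A) ∩ (O ∪ Z))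
      have e2 : O ∩ Z ∪ (O \ Z ∪ A) ∩ (O ∪ Z) = O := by
        ext x
        have := @hd x
        simp only [Finset.mem_union, Finset.mem_sdiff, Finset.mem_inter]; tauto
      rw [e1] at h5
      rw [e2] at h6
      have h7 := hF0 (O ∩ Z ∩ ((O \ Z ∪ A) ∩ (O ∪ Z)))
      linarith
    rw [List.sum_map_add, hconst _ (by omega)] at h4
    have h5 := mul_le_mul_of_nonneg_left h4 hκ
    have h6 := div_le_div_of_nonneg_right
      ((add_le_add_right h5 (ℓ * ((L i).map F).sum)).trans h3) (hpos (i + 1)).le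
    dsimp only
    refine le_of_eq_of_le ?_ (h6.trans_eq ?_)
    · rw [pow_succ]; field_simp; ring
    · ring
  · intro i hi
    have h3 := div_le_div_of_nonneg_right (hS i (by omega) (O ∪ Z)
      (Finset.sdiff_subset.trans Finset.subset_union_left)) (hpos (i + 1)).le
    dsimp only
    refine le_of_eq_of_le ?_ h3
    rw [pow_succ]; field_simp
  -- At the change of phase A is still disjoint from Z, so O ∪ A and O ∪ Z meet exactly in O.
  · have h4 : ((L T).map fun A => F (O ∪ Z ∪ A) + (F O - F (O ∪ Z))).sum ≤
        ((L T).map fun A => F (O ∪ A)).sum := by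
      apply listSum_le_listSum
      intro A hA
      have hd := Finset.disjoint_left.1 (hdisj T le_rfl A hA)
      have h5 := hF.union_add_inter_le (O ∪ A) (O ∪ Z)
      have e1 : O ∪ A ∪ (O ∪ Z) = O ∪ Z ∪ A := by
        ext x; simp only [Finset.mem_union]; tauto
      have e2 : (O ∪ A) ∩ (O ∪ Z) = O := by
        ext x
        have := @hd x
        simp only [Finset.mem_union, Finset.mem_inter]; tauto
      rw [e1, e2] at h5
      linarith
    rw [List.sum_map_add, hconst _ hT] at h4
    have h6 := div_le_div_of_nonneg_right h4 (hpos T).le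
    rw [add_div, mul_div_cancel_left₀ _ (hpos T).ne'] at h6
    dsimp only
    linarith
  · intro i hi hi'
    have h3 := hg i hi'
    rw [guideAt_of_ge Z hi, Finset.sdiff_empty] at h3
    have h6 := div_le_div_of_nonneg_right h3 (hpos (i + 1)).le
    dsimp only
    refine le_of_eq_of_le ?_ (h6.trans_eq ?_)
    · rw [pow_succ]; field_simp
    · ring
  · intro i hi hi'
    have h3 := div_le_div_of_nonneg_right (hS i hi' O Finset.sdiff_subset) (hpos (i + 1)).le
    dsimp only
    refine le_of_eq_of_le ?_ h3
    rw [pow_succ]; field_simp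
  -- Some set at the last level has at least the average value.
  · by_contra hcon
    push Not at hcon
    have hne : L ℓ ≠ [] := by
      intro h
      have := hlen ℓ le_rfl
      rw [h, List.length_nil] at this
      have h3 : 0 < ℓ ^ ℓ := Nat.pow_pos hℓ0
      omega
    have h3 := List.sum_lt_sum_of_ne_nil hne F (fun _ => ((L ℓ).map F).sum / ℓ ^ ℓ)
      fun A hA => hcon A (guidedSets_eq (ε := ε) Z ▸ hmem ℓ le_rfl A hA)
    rw [hconst ℓ le_rfl, mul_div_cancel₀ _ (hpos ℓ).ne'] at h3
    exact lt_irrefl _ h3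

end Averages

/-! ### Solving the recursions for the averages. -/

section Recursions

theorem pow_mul_le_of_step {q x : ℝ} {u : ℕ → ℝ} {n : ℕ} (hq : 0 ≤ q) (h0 : x ≤ u 0)
    (h : ∀ i, i < n → q * u i ≤ u (i + 1)) (i : ℕ) (hi : i ≤ n) : q ^ i * x ≤ u i := by
  induction i with
  | zero => simpa using h0
  | succ i ih =>
    have h1 := mul_le_mul_of_nonneg_left (ih (by omega)) hq
    have h2 := h i (by omega)
    rw [pow_succ]
    linarith

/-- The solution of the recursion `(1 + κ) * g (i + 1) ≥ g i + κ * (q ^ (i + 1) * x + y)`. -/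
theorem recursion_bound {κ q x y : ℝ} {g : ℕ → ℝ} {n : ℕ} (hκ : 0 ≤ κ) (hq : 0 ≤ q)
    (hκq : q * (1 + κ) ≤ 1) (hx : 0 ≤ x)
    (h : ∀ i, i < n → g i + κ * (q ^ (i + 1) * x + y) ≤ (1 + κ) * g (i + 1)) (i : ℕ)
    (hi : i ≤ n) :
    ((1 + κ)⁻¹) ^ i * g 0 + (1 - ((1 + κ)⁻¹) ^ i) * y + κ * i * q ^ (i + 1) * x ≤ g i := by
  have hpos : 0 < 1 + κ := by linarith
  set p := (1 + κ)⁻¹ with hp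
  have hp0 : 0 ≤ p := inv_nonneg.2 hpos.le
  have hpκ : p * (1 + κ) = 1 := inv_mul_cancel₀ hpos.ne'
  have hqp : q ≤ p := by
    rw [hp, ← one_div, le_div_iff₀ hpos]; exact hκq
  induction i with
  | zero => simp
  | succ i ih =>
    have h1 := ih (by omega)
    have h2 := mul_le_mul_of_nonneg_left (h i (by omega)) hp0
    rw [← mul_assoc, hpκ, one_mul] at h2
    refine le_trans ?_ h2
    have h3 := mul_le_mul_of_nonneg_left h1 hp0
    -- With p = (1 + κ)⁻¹, one step gives p * κ * (i + 1) * q ^ (i + 1) as the coefficient of x;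
    -- trading p for the smaller q gives the closed form.
    have h4 : q * (κ * (i + 1) * q ^ (i + 1) * x) ≤ p * (κ * (i + 1) * q ^ (i + 1) * x) :=
      mul_le_mul_of_nonneg_right hqp (by positivity)
    have h5 : p * κ = 1 - p := by linarith
    have e : p * (κ * (q ^ (i + 1) * x + y)) = p * κ * q ^ (i + 1) * x + (1 - p) * y := by
      rw [← h5]; ring
    push_cast
    rw [pow_succ p, pow_succ q (i + 1), mul_add p (g i), e]
    linarith

/-- The value guaranteed by the guided iterations, for given averages. -/
theorem guided_recursion {κ q X a b : ℝ} {g D e : ℕ → ℝ} {T ℓ : ℕ} (hκ : 0 ≤ κ) (hq : 0 ≤ q)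
    (hκq : q * (1 + κ) ≤ 1) (hb : 0 ≤ b) (hE : 0 ≤ X - (1 - q ^ T) * b) (hT : T ≤ ℓ)
    (g0 : 0 ≤ g 0) (D0 : D 0 = b)
    (hg : ∀ i, i < T → g i + κ * (D (i + 1) + X - a - b) ≤ (1 + κ) * g (i + 1))
    (hD : ∀ i, i < T → q * D i ≤ D (i + 1)) (he0 : X + D T - b ≤ e T)
    (hg' : ∀ i, T ≤ i → i < ℓ → g i + κ * e (i + 1) ≤ (1 + κ) * g (i + 1))
    (he : ∀ i, T ≤ i → i < ℓ → q * e i ≤ e (i + 1)) :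
    ((1 + κ)⁻¹) ^ (ℓ - T) * ((1 - ((1 + κ)⁻¹) ^ T) * (X - a - b) + κ * T * q ^ (T + 1) * b) +
      κ * (ℓ - T : ℕ) * q ^ (ℓ - T + 1) * (X - (1 - q ^ T) * b) ≤ g ℓ := by
  have hp0 : 0 ≤ (1 + κ)⁻¹ := inv_nonneg.2 (by linarith)
  have hD' := pow_mul_le_of_step hq D0.ge hD
  have h1 := recursion_bound (g := g) (x := b) (y := X - a - b) (n := T) hκ hq hκq hb (by
    intro i hi
    have h1 := mul_le_mul_of_nonneg_left (hD' (i + 1) (by omega)) hκ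
    have h2 := hg i hi
    linarith) T le_rfl
  -- The starting value of the second phase: D has decayed to no less than q ^ T * b.
  have h2 : X - (1 - q ^ T) * b ≤ e T := by
    have := hD' T le_rfl
    linarith
  have he' := pow_mul_le_of_step (u := fun j => e (T + j)) (n := ℓ - T) hq h2
    fun i hi => he (T + i) (by omega) (by omega)
  have h3 := recursion_bound (g := fun j => g (T + j)) (x := X - (1 - q ^ T) * b) (y := 0)
    (n := ℓ - T) hκ hq hκq hE (by
    intro i hi
    have h1 := mul_le_mul_of_nonneg_left (he' (i + 1) (by omega)) hκ
    have h2 := hg' (T + i) (by omega) (by omega)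
    simp only [← add_assoc] at h1 ⊢
    linarith) (ℓ - T) le_rfl
  rw [add_zero, Nat.add_sub_cancel' hT, mul_zero, add_zero] at h3
  refine le_trans ?_ h3
  have h4 : 0 ≤ ((1 + κ)⁻¹) ^ T * g 0 := mul_nonneg (pow_nonneg hp0 _) g0
  have h5 := mul_le_mul_of_nonneg_left (show
    (1 - ((1 + κ)⁻¹) ^ T) * (X - a - b) + κ * T * q ^ (T + 1) * b ≤ g T by linarith)
    (pow_nonneg hp0 (ℓ - T))
  linarith

/-- The value of the guidance sets, for given averages that satisfy a linear inequality. -/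
theorem guidance_recursion {κ q c₀ c₁ zs : ℝ} {z b : ℕ → ℝ} {m ℓ : ℕ} (hκ : 0 ≤ κ) (hq : 0 ≤ q)
    (hκq : q * (1 + κ) ≤ 1) (hm : 1 ≤ m) (hmℓ : m ≤ ℓ) (hzs : zs * (1 + q * c₁) = q * c₀)
    (hc₁ : κ * q * c₁ ≤ 1) (z0 : 0 ≤ z 0) (b0 : b 0 = 1)
    (hz : ∀ i, i < ℓ → z i + κ * (q * b i) ≤ (1 + κ) * z (i + 1))
    (hb : ∀ i, i < ℓ → q * b i ≤ b (i + 1))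
    (hc : ∀ i, i < ℓ → c₀ - c₁ * z (i + 1) ≤ b (i + 1)) :
    zs - ((1 - κ * q * c₁) / (1 + κ)) ^ (ℓ - m) * (zs - κ * m * q ^ (m + 1)) ≤ z ℓ := by
  have hpos : 0 < 1 + κ := by linarith
  have hb' := pow_mul_le_of_step hq b0.ge hb
  have h1 := recursion_bound (g := z) (x := 1) (y := 0) (n := ℓ) hκ hq hκq zero_le_one (by
    intro i hi
    have h1 := mul_le_mul_of_nonneg_left (mul_le_mul_of_nonneg_left (hb' i hi.le) hq) hκ
    have h2 := hz i hi
    rw [pow_succ]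
    linarith) m hmℓ
  have hzm : κ * m * q ^ (m + 1) ≤ z m := by
    have : 0 ≤ ((1 + κ)⁻¹) ^ m * z 0 := by positivity
    linarith
  set r := (1 - κ * q * c₁) / (1 + κ) with hr
  have hr0 : 0 ≤ r := div_nonneg (by linarith) hpos.le
  -- Inserting b ≥ c₀ - c₁ z makes the recursion affine with fixed point zs and ratio r, so the gap
  -- to zs shrinks by r at each step. The first m steps only used b(i) ≥ q ^ i, which is the better
  -- bound while z is small.
  have key : ∀ j, j ≤ ℓ - m → zs - r ^ j * (zs - z m) ≤ z (m + j) := by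
    intro j
    induction j with
    | zero => intro _; simp
    | succ j ih =>
      intro hj
      have h2 := hz (m + j) (by omega)
      -- The linear inequality is known from depth 1 on, whence the requirement 1 ≤ m.
      have h3 : c₀ - c₁ * z (m + j) ≤ b (m + j) := by
        have := hc (m + j - 1) (by omega)
        rwa [show m + j - 1 + 1 = m + j by omega] at this
      have h4 := mul_le_mul_of_nonneg_left (mul_le_mul_of_nonneg_left h3 hq) hκ
      have h5 : zs - r * (zs - z (m + j)) ≤ z (m + j + 1) := by
        have e : zs - r * (zs - z (m + j)) =
            (zs * (1 + κ) - (1 - κ * q * c₁) * (zs - z (m + j))) / (1 + κ) := by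
          rw [hr]; field_simp
        rw [e, div_le_iff₀ hpos]
        have h6 : κ * (zs * (1 + q * c₁)) = κ * (q * c₀) := by rw [hzs]
        linarith
      have h6 := mul_le_mul_of_nonneg_left (ih (by omega)) hr0
      rw [pow_succ, ← add_assoc]
      linarith
  have h2 := key (ℓ - m) le_rfl
  rw [Nat.add_sub_cancel' hmℓ] at h2
  have h3 := mul_le_mul_of_nonneg_left hzm (pow_nonneg hr0 (ℓ - m))
  linarith

end Recursions

/-! ### Rational bounds for exponentials and powers. -/

section Exponentials

/-- Raising to the n-th power leaves a rational inequality with a decimal bound for e. -/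
theorem exp_neg_lt {m n : ℕ} {c : ℝ} (hn : n ≠ 0) (hc : 0 < c)
    (h : 1 < c ^ n * 2.7182818283 ^ m) : Real.exp (-(m / n : ℝ)) < c := by
  by_contra hcon
  push Not at hcon
  have hn' : (n : ℝ) ≠ 0 := by exact_mod_cast hn
  have h1 := pow_le_pow_left₀ hc.le hcon n
  rw [← Real.exp_nat_mul, mul_neg, mul_div_cancel₀ _ hn'] at h1
  have h2 : (2.7182818283 : ℝ) ^ m ≤ Real.exp m := by
    rw [← Real.exp_one_pow]
    exact pow_le_pow_left₀ (by norm_num) Real.exp_one_gt_d9.le m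
  have h3 := mul_le_mul h1 h2 (by positivity) (Real.exp_pos _).le
  rw [← Real.exp_add, neg_add_cancel, Real.exp_zero] at h3
  linarith

theorem lt_exp_neg {m n : ℕ} {c : ℝ} (hn : n ≠ 0) (hc : 0 < c)
    (h : c ^ n * 2.7182818286 ^ m < 1) : c < Real.exp (-(m / n : ℝ)) := by
  by_contra hcon
  push Not at hcon
  have hn' : (n : ℝ) ≠ 0 := by exact_mod_cast hn
  have h1 := pow_le_pow_left₀ (Real.exp_pos _).le hcon n
  rw [← Real.exp_nat_mul, mul_neg, mul_div_cancel₀ _ hn'] at h1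
  have h2 : Real.exp m ≤ (2.7182818286 : ℝ) ^ m := by
    rw [← Real.exp_one_pow]
    exact pow_le_pow_left₀ (Real.exp_pos _).le Real.exp_one_lt_d9.le m
  have h3 := mul_le_mul h1 h2 (Real.exp_pos _).le (by positivity)
  rw [← Real.exp_add, neg_add_cancel, Real.exp_zero] at h3
  linarith

theorem exp_neg_seven_tenths : 0.49658 < Real.exp (-0.7) ∧ Real.exp (-0.7) < 0.49659 := by
  have e : (-0.7 : ℝ) = -(((7 : ℕ) : ℝ) / (10 : ℕ)) := by norm_num
  rw [e]
  exact ⟨lt_exp_neg (by norm_num) (by norm_num) (by norm_num),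
    exp_neg_lt (by norm_num) (by norm_num) (by norm_num)⟩

theorem exp_neg_three_tenths : 0.74081 < Real.exp (-0.3) ∧ Real.exp (-0.3) < 0.74082 := by
  have e : (-0.3 : ℝ) = -(((3 : ℕ) : ℝ) / (10 : ℕ)) := by norm_num
  rw [e]
  exact ⟨lt_exp_neg (by norm_num) (by norm_num) (by norm_num),
    exp_neg_lt (by norm_num) (by norm_num) (by norm_num)⟩

theorem exp_neg_half_gt : 0.6065 < Real.exp (-0.5) := by
  have e : (-0.5 : ℝ) = -(((1 : ℕ) : ℝ) / (2 : ℕ)) := by norm_num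
  rw [e]
  exact lt_exp_neg (by norm_num) (by norm_num) (by norm_num)

theorem exp_neg_lt_d5 : Real.exp (-1.09) < 0.33622 := by
  have e : (-1.09 : ℝ) = -(((109 : ℕ) : ℝ) / (100 : ℕ)) := by norm_num
  rw [e]
  exact exp_neg_lt (by norm_num) (by norm_num) (by norm_num)

/-- Turns an error d in the exponent into a relative error, so that the later estimates become
polynomial in ε. -/
theorem exp_sub_ge {c c' d x : ℝ} (hc : c' ≤ Real.exp (-c)) (hd : d ≤ 1) (hx : x ≤ c + d) :
    c' * (1 - d) ≤ Real.exp (-x) := by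
  have h1 : Real.exp (-(c + d)) ≤ Real.exp (-x) := Real.exp_le_exp.2 (by linarith)
  refine (mul_le_mul_of_nonneg_right hc (by linarith)).trans (le_trans ?_ h1)
  rw [neg_add, Real.exp_add]
  exact mul_le_mul_of_nonneg_left (by linarith [Real.add_one_le_exp (-d)]) (Real.exp_pos _).le

theorem exp_sub_le {c c' d d' x : ℝ} (hc : Real.exp (-c) ≤ c') (hd' : 0 ≤ d') (hx : c - d ≤ x)
    (hd : 1 ≤ (1 - d) * (1 + d')) (hd1 : d < 1) : Real.exp (-x) ≤ c' * (1 + d') := by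
  have h1 : Real.exp (-x) ≤ Real.exp (-c + d) := Real.exp_le_exp.2 (by linarith)
  refine h1.trans ?_
  rw [Real.exp_add]
  refine mul_le_mul hc ?_ (Real.exp_pos _).le ((Real.exp_pos _).le.trans hc)
  have h2 := Real.add_one_le_exp (-d)
  have h3 : Real.exp d * Real.exp (-d) = 1 := by rw [← Real.exp_add]; simp
  have h4 : Real.exp d * (1 - d) ≤ 1 := by
    rw [← h3]
    exact mul_le_mul_of_nonneg_left (by linarith) (Real.exp_pos _).le
  exact le_of_mul_le_mul_right (by linarith : Real.exp d * (1 - d) ≤ (1 + d') * (1 - d))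
    (by linarith)

theorem inv_one_add_pow_ge {κ : ℝ} (hκ : 0 ≤ κ) (n : ℕ) :
    Real.exp (-(κ * n)) ≤ ((1 + κ)⁻¹) ^ n := by
  rw [Real.exp_neg, mul_comm, Real.exp_nat_mul, inv_pow]
  apply inv_anti₀ (by positivity)
  exact pow_le_pow_left₀ (by linarith) (by linarith [Real.add_one_le_exp κ]) n

/-- From log (1 + κ) ≥ 2κ / (κ + 2), which agrees with the logarithm to second order. -/
theorem inv_one_add_le_exp {κ : ℝ} (hκ : 0 ≤ κ) :
    (1 + κ)⁻¹ ≤ Real.exp (-(2 * κ / (κ + 2))) := by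
  have h1 := Real.le_log_one_add_of_nonneg hκ
  rw [Real.exp_neg]
  apply inv_anti₀ (Real.exp_pos _)
  rwa [← Real.le_log_iff_exp_le (by linarith)]

theorem inv_one_add_pow_le {κ : ℝ} (hκ : 0 ≤ κ) (n : ℕ) :
    ((1 + κ)⁻¹) ^ n ≤ Real.exp (-(2 * κ / (κ + 2) * n)) := by
  have h2 := pow_le_pow_left₀ (by positivity) (inv_one_add_le_exp hκ) n
  rwa [← Real.exp_nat_mul, mul_neg, mul_comm (n : ℝ)] at h2

theorem one_sub_inv_pow_ge {L : ℝ} (hL : 1 < L) (n : ℕ) :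
    Real.exp (-(n * (L - 1)⁻¹)) ≤ (1 - 1 / L) ^ n := by
  have h0 : 0 < L - 1 := by linarith
  have h1 : Real.exp (-(L - 1)⁻¹) ≤ 1 - 1 / L := by
    have e : 1 - 1 / L = (1 + (L - 1)⁻¹)⁻¹ := by
      have : L ≠ 0 := by linarith
      have : L - 1 ≠ 0 := h0.ne'
      field_simp
      ring
    rw [e, Real.exp_neg]
    apply inv_anti₀ (by positivity)
    linarith [Real.add_one_le_exp (L - 1)⁻¹]
  have h2 := pow_le_pow_left₀ (Real.exp_pos _).le h1 n
  rwa [← Real.exp_nat_mul, mul_neg] at h2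

end Exponentials

/-! ### The numerical constants 0.4762, 0.1288, 0.1085 and 0.377. -/

section Numerics

theorem rate_nonneg {ε : ℝ} (hε : 0 < ε) (hε1 : ε < 1) (ℓ : ℕ) : 0 ≤ rate ε ℓ :=
  div_nonneg (by linarith) (by positivity)

theorem rate_mul_le {ε : ℝ} (hε : 0 < ε) {ℓ : ℕ} : rate ε ℓ * ℓ ≤ 1 := by
  have hpos : (0 : ℝ) < ℓ + ε := by positivity
  have hL : (0 : ℝ) ≤ ℓ := Nat.cast_nonneg _
  unfold rate
  rw [div_mul_eq_mul_div, div_le_one hpos]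
  nlinarith

theorem le_rate_mul {ε c : ℝ} (hε : 0 < ε) {ℓ : ℕ} (h : (1 - c) * (ℓ + ε) ≤ (1 - ε) * ℓ) :
    1 - c ≤ rate ε ℓ * ℓ := by
  have hpos : (0 : ℝ) < ℓ + ε := by positivity
  unfold rate
  rw [div_mul_eq_mul_div, le_div_iff₀ hpos]
  exact h

theorem le_exponent_mul {ε c : ℝ} (hε : 0 < ε) (hε1 : ε < 1) {ℓ : ℕ}
    (h : (1 - c) * (2 * ℓ + 1 + ε) ≤ 2 * ℓ * (1 - ε)) :
    1 - c ≤ 2 * rate ε ℓ / (rate ε ℓ + 2) * ℓ := by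
  have hpos : (0 : ℝ) < ℓ + ε := by positivity
  have hpos2 : (0 : ℝ) < 2 * ℓ + 1 + ε := by positivity
  have e : 2 * rate ε ℓ / (rate ε ℓ + 2) * ℓ = 2 * ℓ * (1 - ε) / (2 * ℓ + 1 + ε) := by
    unfold rate
    have h1 : (1 - ε) / (ℓ + ε) + 2 = (2 * ℓ + 1 + ε) / (ℓ + ε) := by field_simp; ring
    rw [h1]
    field_simp
  rw [e, le_div_iff₀ hpos2]
  exact h

/-- Follows from κ * ℓ ≤ 1. This is the comparison q ≤ (1 + κ)⁻¹ that the recursions require. -/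
theorem one_sub_inv_mul_le {ε : ℝ} (hε : 0 < ε) {ℓ : ℕ} (hℓ : 1 ≤ ℓ) :
    (1 - 1 / (ℓ : ℝ)) * (1 + rate ε ℓ) ≤ 1 := by
  have hL : (1 : ℝ) ≤ ℓ := by exact_mod_cast hℓ
  have h1 := rate_mul_le hε (ℓ := ℓ)
  have e : (1 - 1 / (ℓ : ℝ)) * (1 + rate ε ℓ) = (ℓ - 1) * (1 + rate ε ℓ) / ℓ := by field_simp
  have h2 : 0 ≤ rate ε ℓ * ℓ + (1 - rate ε ℓ * ℓ) := by linarith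
  rw [e, div_le_one (by linarith)]
  rcases le_total 0 (rate ε ℓ) with h | h
  · linarith
  · nlinarith

theorem rate_le {ε c : ℝ} (hε : 0 < ε) (hε1 : ε < 1) {ℓ : ℕ} {κ : ℝ} (hκ0 : 0 ≤ κ)
    (hκ1 : κ * ℓ ≤ 1) (hc : 0 < c) (hℓ : 1 ≤ c * (ε * ℓ)) : κ ≤ c * ε := by
  have h1 := mul_le_mul_of_nonneg_left hℓ hκ0
  have h2 := mul_le_mul_of_nonneg_left hκ1 (mul_pos hc hε).le
  linarith

/-- As ε → 0: u, qn → e^(-0.7), v, qT, qT1 → e^(-0.3), κT → 0.3 and κn → 0.7. The right side then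
has constant term about 0.4763 and coefficients about -0.1287 for a and -0.1084 for b; rounding
gives the three constants. The first-order errors fit into the term -ε because a and b are bounded.
-/
theorem guided_coefficients {ε a b u v qT qT1 qn κT κn : ℝ} (hε : 0 < ε) (hε1 : ε < 0.377)
    (ha : 0 ≤ a) (ha1 : a ≤ 0.377) (hb : 0 ≤ b) (hb1 : b ≤ 0.92)
    (hu1 : 0.49658 * (1 - 0.2 * ε) ≤ u) (hu2 : u ≤ 0.49659 * (1 + 0.54 * ε))
    (hv1 : 0.74081 ≤ v) (hv2 : v ≤ 0.74082 * (1 + 0.461 * ε))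
    (hqT : 0.74081 * (1 - 0.065 * ε) ≤ qT) (hqT1 : 0.74081 * (1 - 0.2814 * ε) ≤ qT1)
    (hqn : 0.49658 * (1 - 0.5845 * ε) ≤ qn) (hκT : 0.3 - 0.362 * ε ≤ κT)
    (hκn : 0.7 * (1 - 0.54 * ε) ≤ κn) :
    0.4762 - ε - 0.1288 * a - 0.1085 * b ≤
      u * ((1 - v) * (1 - a - b) + κT * qT1 * b) + κn * qn * (1 - (1 - qT) * b) := by
  have hε2 : 0 ≤ ε * ε := mul_nonneg hε.le hε.le
  have hε3 : ε * ε ≤ 0.377 * ε := mul_le_mul_of_nonneg_right hε1.le hε.le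
  have hY1 : 0.128702 - 0.19535 * ε ≤ u * (1 - v) := by
    have h1 : 0.25918 - 0.34152 * ε ≤ 1 - v := by linarith
    have h2 := mul_le_mul hu1 h1 (by linarith) (by linarith)
    linarith
  have hY2 : u * (1 - v) ≤ 0.128712 + 0.0696 * ε := by
    have h1 : 1 - v ≤ 0.25919 := by linarith
    have h3 : v ≤ 1 := by linarith
    have h2 := mul_le_mul hu2 h1 (by linarith) (by linarith)
    linarith
  have hS : 0.11036 - 0.1864 * ε ≤ u * (κT * qT1) := by
    have h1 := mul_le_mul hκT hqT1 (by linarith) (by linarith)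
    have h3 : 0.222243 - 0.3308 * ε ≤ κT * qT1 := by linarith
    have h2 := mul_le_mul hu1 h3 (by linarith) (by linarith)
    linarith
  have hw : 0.3476 - 0.391 * ε ≤ κn * qn := by
    have h1 := mul_le_mul hκn hqn (by linarith) (by linarith)
    linarith
  have hB : 0 ≤ 1 - (1 - qT) * b := by
    have h1 : (1 - qT) * b ≤ 1 * b := mul_le_mul_of_nonneg_right (by linarith) hb
    linarith
  have hw2 := mul_le_mul_of_nonneg_right hw hB
  have hw3 : (0.3476 - 0.391 * ε) * (1 - qT) ≤ 0.0901 := by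
    have h1 : 1 - qT ≤ 0.25919 + 0.0482 * ε := by linarith
    have h2 := mul_le_mul_of_nonneg_left h1 (show 0 ≤ 0.3476 - 0.391 * ε by linarith)
    linarith
  have hw4 := mul_le_mul_of_nonneg_right hw3 hb
  have hYab := mul_le_mul_of_nonneg_right hY2 (add_nonneg ha hb)
  have hSb := mul_le_mul_of_nonneg_right hS hb
  have hεa : ε * a ≤ ε * 0.377 := mul_le_mul_of_nonneg_left ha1 hε.le
  have hεb : ε * b ≤ ε * 0.92 := mul_le_mul_of_nonneg_left hb1 hε.le
  linarith

/-- Since 1/ℓ ≤ ε/5, the floor, the discount 1 - 1/ℓ and the threshold loss ε/2 all cause errors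
linear in ε. -/
theorem guided_numeric {ε a b : ℝ} {ℓ : ℕ} (hε : 0 < ε) (hε1 : ε < 0.377) (hℓ : 5 ≤ ε * ℓ)
    (ha : 0 ≤ a) (ha1 : a ≤ 0.377) (hb : 0 ≤ b) (hb1 : b ≤ 0.92) :
    0.4762 - ε - 0.1288 * a - 0.1085 * b ≤
      ((1 + rate (ε / 2) ℓ)⁻¹) ^ (ℓ - ⌊(3 / 10 : ℝ) * ℓ⌋₊) *
        ((1 - ((1 + rate (ε / 2) ℓ)⁻¹) ^ ⌊(3 / 10 : ℝ) * ℓ⌋₊) * (1 - a - b) +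
          rate (ε / 2) ℓ * ⌊(3 / 10 : ℝ) * ℓ⌋₊ *
            (1 - 1 / (ℓ : ℝ)) ^ (⌊(3 / 10 : ℝ) * ℓ⌋₊ + 1) * b) +
      rate (ε / 2) ℓ * (ℓ - ⌊(3 / 10 : ℝ) * ℓ⌋₊ : ℕ) *
        (1 - 1 / (ℓ : ℝ)) ^ (ℓ - ⌊(3 / 10 : ℝ) * ℓ⌋₊ + 1) *
        (1 - (1 - (1 - 1 / (ℓ : ℝ)) ^ ⌊(3 / 10 : ℝ) * ℓ⌋₊) * b) := by
  set T := ⌊(3 / 10 : ℝ) * ℓ⌋₊ with hT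
  set κ := rate (ε / 2) ℓ with hκdef
  have hε2 : 0 ≤ ε * ε := mul_nonneg hε.le hε.le
  have hε3 : ε * ε ≤ 0.377 * ε := mul_le_mul_of_nonneg_right hε1.le hε.le
  have hL13 : (13 : ℝ) < ℓ := by
    have h1 : ε * ℓ ≤ 0.377 * ℓ := mul_le_mul_of_nonneg_right hε1.le (Nat.cast_nonneg _)
    linarith
  have hT1 : (T : ℝ) ≤ 0.3 * ℓ := by
    have := Nat.floor_le (show 0 ≤ (3 / 10 : ℝ) * ℓ by positivity)
    linarith
  have hT2 : 0.3 * ℓ - 1 ≤ (T : ℝ) := by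
    have := Nat.lt_floor_add_one ((3 / 10 : ℝ) * ℓ)
    linarith
  have hTℓ : T ≤ ℓ := by
    have : (T : ℝ) ≤ ℓ := by linarith
    exact_mod_cast this
  have hn : ((ℓ - T : ℕ) : ℝ) = ℓ - T := by rw [Nat.cast_sub hTℓ]
  have hκ0 : 0 ≤ κ := rate_nonneg (by linarith) (by linarith) ℓ
  have hκ1 : κ * ℓ ≤ 1 := rate_mul_le (by linarith)
  have hκ2 : 1 - 0.54 * ε ≤ κ * ℓ := le_rate_mul (by linarith) (by linarith)
  have hθ : 1 - 0.64 * ε ≤ 2 * κ / (κ + 2) * ℓ :=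
    le_exponent_mul (by linarith) (by linarith) (by linarith)
  have hκε : κ ≤ 0.2 * ε := rate_le hε (by linarith) hκ0 hκ1 (by norm_num) (by linarith)
  have hθ0 : 0 ≤ 2 * κ / (κ + 2) := by positivity
  have hθκ : 2 * κ / (κ + 2) ≤ κ := by
    rw [div_le_iff₀ (by linarith)]
    linarith [mul_nonneg hκ0 hκ0]
  have hs0 : 0 < (ℓ : ℝ) - 1 := by linarith
  have hs : ((ℓ : ℝ) - 1)⁻¹ ≤ 0.2164 * ε := by
    rw [inv_le_iff_one_le_mul₀ hs0]
    linarith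
  have hss : ((ℓ : ℝ) - 1)⁻¹ * (ℓ - 1) = 1 := inv_mul_cancel₀ hs0.ne'
  have hs' : 0 < ((ℓ : ℝ) - 1)⁻¹ := inv_pos.2 hs0
  have hN1 : ((ℓ - T : ℕ) : ℝ) ≤ 0.7 * ℓ + 1 := by rw [hn]; linarith
  have hN2 : 0.7 * ℓ ≤ ((ℓ - T : ℕ) : ℝ) := by rw [hn]; linarith
  have hlin : ∀ {m : ℕ} {c d : ℝ}, (m : ℝ) ≤ c * (ℓ - 1) + d → 0 ≤ d →
      m * ((ℓ : ℝ) - 1)⁻¹ ≤ c + d * 0.2164 * ε := by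
    intro m c d h hd
    have h1 := mul_le_mul_of_nonneg_right h hs'.le
    have h2 := mul_le_mul_of_nonneg_left hs hd
    have h3 : (c * ((ℓ : ℝ) - 1) + d) * ((ℓ : ℝ) - 1)⁻¹ =
      c * (((ℓ : ℝ) - 1)⁻¹ * (ℓ - 1)) + d * ((ℓ : ℝ) - 1)⁻¹ := by ring
    rw [h3, hss] at h1
    linarith
  have hq := fun n => one_sub_inv_pow_ge (L := (ℓ : ℝ)) (by linarith) n
  refine guided_coefficients hε hε1 ha ha1 hb hb1 ?_ ?_ ?_ ?_ ?_ ?_ ?_ ?_ ?_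
  · refine (exp_sub_ge exp_neg_seven_tenths.1.le (by linarith) ?_).trans
      (inv_one_add_pow_ge hκ0 _)
    linarith [mul_le_mul_of_nonneg_left hN1 hκ0]
  · refine (inv_one_add_pow_le hκ0 _).trans
      (exp_sub_le (d := 0.448 * ε) exp_neg_seven_tenths.2.le (by linarith) ?_ (by linarith)
        (by linarith))
    linarith [mul_le_mul_of_nonneg_left hN2 hθ0]
  · have h1 := exp_sub_ge (d := 0) (x := κ * T) exp_neg_three_tenths.1.le (by linarith)
      (by linarith [mul_le_mul_of_nonneg_left hT1 hκ0])
    linarith [inv_one_add_pow_ge hκ0 T]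
  · refine (inv_one_add_pow_le hκ0 _).trans
      (exp_sub_le (d := 0.392 * ε) exp_neg_three_tenths.2.le (by linarith) ?_ (by linarith)
        (by linarith))
    linarith [mul_le_mul_of_nonneg_left hT2 hθ0]
  · refine (exp_sub_ge exp_neg_three_tenths.1.le (by linarith) ?_).trans (hq T)
    have := hlin (m := T) (c := 0.3) (d := 0.3) (by linarith) (by norm_num)
    linarith
  · refine (exp_sub_ge exp_neg_three_tenths.1.le (by linarith) ?_).trans (hq (T + 1))
    have := hlin (m := T + 1) (c := 0.3) (d := 1.3) (by push_cast; linarith) (by norm_num)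
    linarith
  · refine (exp_sub_ge exp_neg_seven_tenths.1.le (by linarith) ?_).trans (hq (ℓ - T + 1))
    have := hlin (m := ℓ - T + 1) (c := 0.7) (d := 2.7) (by push_cast; linarith) (by norm_num)
    linarith
  · linarith [mul_le_mul_of_nonneg_left hT2 hκ0]
  · linarith [mul_le_mul_of_nonneg_left hN2 hκ0]

/-- In the limit the value is 0.418 - 0.33622 * (0.418 - 0.30325), about 0.379, slightly above
0.377. The derivative in ε stays above -1. -/
theorem guidance_coefficients {ε zs zm R : ℝ} (hε : 0 < ε) (hε1 : ε < 0.377)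
    (hzs : 0.418 - 0.1254 * ε ≤ zs) (hzm : 0.30325 - 0.4152 * ε ≤ zm) (hR0 : 0 ≤ R)
    (hR : R ≤ 0.33622 * (1 + 1.29 * ε)) : 0.377 - ε ≤ zs - R * (zs - zm) := by
  have hε2 : 0 ≤ ε * ε := mul_nonneg hε.le hε.le
  have hε3 : ε * ε ≤ 0.377 * ε := mul_le_mul_of_nonneg_right hε1.le hε.le
  have h1 : (1 - R) * (0.418 - 0.1254 * ε) ≤ (1 - R) * zs :=
    mul_le_mul_of_nonneg_left hzs (by linarith)
  have h2 := mul_le_mul_of_nonneg_left hzm hR0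
  have h3 : R * (0.11475 + 0.2898 * ε) ≤ 0.33622 * (1 + 1.29 * ε) * (0.11475 + 0.2898 * ε) :=
    mul_le_mul_of_nonneg_right hR (by linarith)
  linarith

/-- The fixed point tends to 0.0992 / (0.1085 + 0.1288), about 0.418, and half of the steps already
bring z to about e^(-1/2) / 2, which is 0.303. -/
theorem guidance_numeric {ε q κ c₀ c₁ zs : ℝ} {ℓ : ℕ} (hε : 0 < ε) (hε1 : ε < 0.377)
    (hℓ : 10 ≤ 3 * (ε * ℓ)) (hq : q = 1 - 1 / ℓ) (hκ : κ = rate (ε / 2) ℓ)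
    (hc₀ : c₀ = 0.0992 / 0.1085) (hc₁ : c₁ = 0.1288 / 0.1085)
    (hzs : zs * (1 + q * c₁) = q * c₀) :
    κ * q * c₁ ≤ 1 ∧
    0.377 - ε ≤ zs - ((1 - κ * q * c₁) / (1 + κ)) ^ (ℓ - ℓ / 2) *
      (zs - κ * (ℓ / 2 : ℕ) * q ^ (ℓ / 2 + 1)) := by
  have hε2 : 0 ≤ ε * ε := mul_nonneg hε.le hε.le
  have hε3 : ε * ε ≤ 0.377 * ε := mul_le_mul_of_nonneg_right hε1.le hε.le
  have hL8 : (8 : ℝ) < ℓ := by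
    have h1 : ε * ℓ ≤ 0.377 * ℓ := mul_le_mul_of_nonneg_right hε1.le (Nat.cast_nonneg _)
    linarith
  set m := ℓ / 2 with hm
  have hm1 : 2 * (m : ℝ) ≤ ℓ := by
    have : 2 * m ≤ ℓ := by omega
    exact_mod_cast this
  have hm2 : (ℓ : ℝ) - 1 ≤ 2 * (m : ℝ) := by
    have : ℓ ≤ 2 * m + 1 := by omega
    have h : (ℓ : ℝ) ≤ 2 * m + 1 := by exact_mod_cast this
    linarith
  have hn : ((ℓ - m : ℕ) : ℝ) = ℓ - m := by rw [Nat.cast_sub (by omega)]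
  have hκ0 : 0 ≤ κ := hκ ▸ rate_nonneg (by linarith) (by linarith) ℓ
  have hκ1 : κ * ℓ ≤ 1 := hκ ▸ rate_mul_le (by linarith)
  have hκ2 : 1 - 0.56 * ε ≤ κ * ℓ := hκ ▸ le_rate_mul (by linarith) (by linarith)
  have hθ : 1 - 0.71 * ε ≤ 2 * κ / (κ + 2) * ℓ :=
    hκ ▸ le_exponent_mul (by linarith) (by linarith) (by linarith)
  have hθ0 : 0 ≤ 2 * κ / (κ + 2) := by positivity
  have hκε : κ ≤ 0.3 * ε := rate_le hε (by linarith) hκ0 hκ1 (by norm_num) (by linarith)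
  have hs0 : 0 < (ℓ : ℝ) - 1 := by linarith
  have hs : ((ℓ : ℝ) - 1)⁻¹ ≤ 0.339 * ε := by
    rw [inv_le_iff_one_le_mul₀ hs0]
    linarith
  have hss : ((ℓ : ℝ) - 1)⁻¹ * (ℓ - 1) = 1 := inv_mul_cancel₀ hs0.ne'
  have hs' : 0 < ((ℓ : ℝ) - 1)⁻¹ := inv_pos.2 hs0
  have hq1 : q ≤ 1 := by
    have : 0 < 1 / (ℓ : ℝ) := by positivity
    linarith
  have hq2 : 1 - 0.3 * ε ≤ q := by
    have : 1 / (ℓ : ℝ) ≤ 0.3 * ε := by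
      rw [div_le_iff₀ (by linarith)]; linarith
    linarith
  have hc : 1.187 ≤ c₁ ∧ c₁ ≤ 1.1872 := by rw [hc₁]; norm_num
  set x := κ * q * c₁ with hx
  have hx0 : 0 ≤ x := mul_nonneg (mul_nonneg hκ0 (by linarith)) (by linarith)
  have hx1 : x ≤ 1 := by
    have h1 : κ * q ≤ 0.2 * 1 := mul_le_mul (by linarith) hq1 (by linarith) (by norm_num)
    have h2 : x ≤ (0.2 * 1) * 1.1872 := mul_le_mul h1 hc.2 (by linarith) (by norm_num)
    linarith
  refine ⟨hx1, guidance_coefficients hε hε1 ?_ ?_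
    (pow_nonneg (div_nonneg (by linarith) (by linarith)) _) ?_⟩
  · have h1 : 0 ≤ q * c₁ := mul_nonneg (by linarith) (by linarith)
    refine le_of_mul_le_mul_right (?_ : _ ≤ zs * (1 + q * c₁)) (by linarith)
    rw [hzs, hc₀, hc₁]
    have h2 : ε * (1 - 0.3 * ε) ≤ ε * q := mul_le_mul_of_nonneg_left hq2 hε.le
    linarith
  · have h1 : 0.6065 * (1 - 0.5085 * ε) ≤ q ^ (m + 1) := by
      rw [hq]
      refine (exp_sub_ge exp_neg_half_gt.le (by linarith) ?_).trans
        (one_sub_inv_pow_ge (by linarith) (m + 1))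
      have h2 : ((m + 1 : ℕ) : ℝ) ≤ 0.5 * (ℓ - 1) + 1.5 := by push_cast; linarith
      have h3 := mul_le_mul_of_nonneg_right h2 hs'.le
      linarith
    have h2 : 0.5 - 0.43 * ε ≤ κ * m := by linarith [mul_le_mul_of_nonneg_left hm2 hκ0]
    have h3 := mul_le_mul h2 h1 (by linarith) (by linarith)
    linarith
  -- At least ℓ / 2 contracting steps remain, so the total exponent tends to (1 + c₁) / 2, about
  -- 1.0935, of which 1.09 is used.
  · have h1 : (1 - x) / (1 + κ) ≤ Real.exp (-(x + 2 * κ / (κ + 2))) := by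
      rw [div_eq_mul_inv, neg_add, Real.exp_add]
      exact mul_le_mul (by linarith [Real.add_one_le_exp (-x)]) (inv_one_add_le_exp hκ0)
        (by positivity) (Real.exp_pos _).le
    have h2 := pow_le_pow_left₀ (div_nonneg (by linarith) (by linarith)) h1 (ℓ - m)
    rw [← Real.exp_nat_mul, mul_neg, hn] at h2
    refine h2.trans (exp_sub_le (d := 0.866 * ε) exp_neg_lt_d5.le (by linarith) ?_ (by linarith)
      (by linarith))
    have h3 := mul_le_mul hκ2 hq2 (by linarith) (by positivity)
    have h4 : 1 - 0.86 * ε ≤ κ * ℓ * q := by linarith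
    have h5 := mul_le_mul h4 hc.1 (by norm_num) (mul_nonneg (by positivity) (by linarith))
    have h6 : (ℓ : ℝ) / 2 * (x + 2 * κ / (κ + 2)) ≤ (ℓ - m) * (x + 2 * κ / (κ + 2)) :=
      mul_le_mul_of_nonneg_right (by linarith) (by linarith)
    rw [hx] at h6 ⊢
    linarith

end Numerics

/-! ### Approximation ratio and number of queries. -/

section Final

variable {α : Type u} [Fintype α] [LinearOrder α] {k : ℕ} {f : Finset α → ℝ}
  {ε : ℝ}

theorem ten_le_ell₁ (hε : 0 < ε) : 10 ≤ 3 * (ε * (ell₁ ε : ℝ)) := by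
  have h := Nat.le_ceil (10 / (3 * ε))
  rw [div_le_iff₀ (by positivity)] at h
  unfold ell₁
  linarith

theorem five_le_ell₂ (hε : 0 < ε) : 5 ≤ ε * (ell₂ ε : ℝ) := by
  have h := Nat.le_ceil (5 / ε)
  rw [div_le_iff₀ hε] at h
  unfold ell₂
  linarith

theorem ell₂_mul_lt (hε : 0 < ε) : ε * (ell₂ ε : ℝ) < 5 + ε := by
  have h := Nat.ceil_lt_add_one (show 0 ≤ 5 / ε by positivity)
  have h1 := mul_lt_mul_of_pos_left h hε
  rw [mul_add, mul_div_cancel₀ _ hε.ne'] at h1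
  unfold ell₂
  linarith

theorem ell₁_lt_ell₂ (hε : 0 < ε) (hε1 : ε < 1) : ell₁ ε < ell₂ ε := by
  have h1 := Nat.ceil_lt_add_one (show 0 ≤ 10 / (3 * ε) by positivity)
  have h2 := five_le_ell₂ hε
  have h3 := mul_lt_mul_of_pos_left h1 hε
  have h4 : ε * (10 / (3 * ε) + 1) = 10 / 3 + ε := by field_simp
  have h5 : ε * (ell₁ ε : ℝ) < ε * (ell₂ ε : ℝ) := by
    unfold ell₁
    linarith
  exact_mod_cast lt_of_mul_lt_mul_left h5 hε.le

theorem ell₂_lt_two_mul (hε : 0 < ε) (hε1 : ε < 1) : ell₂ ε < 2 * ell₁ ε := by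
  have h1 := ten_le_ell₁ hε
  have h2 := ell₂_mul_lt hε
  have h5 : ε * (ell₂ ε : ℝ) < ε * (2 * ell₁ ε : ℝ) := by linarith
  exact_mod_cast lt_of_mul_lt_mul_left h5 hε.le

/-- If k = b, then a would divide b although a < b < 2a; hence k ≥ 2b. Quotients of at least 2 are
needed since each procedure starts with one element taken and must not be full. -/
theorem two_le_div_of_dvd {a b k : ℕ} (hk : 0 < k) (ha : a ∣ k) (hb : b ∣ k) (hab : a < b)
    (hba : b < 2 * a) : 2 ≤ k / a ∧ 2 ≤ k / b := by
  obtain ⟨c, rfl⟩ := hb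
  have hb0 : 0 < b := by omega
  have hc : 2 ≤ c := by
    rcases Nat.lt_or_ge c 2 with h | h
    · interval_cases c
      · simp at hk
      · rw [mul_one] at ha
        obtain ⟨d, rfl⟩ := ha
        have h1 : 1 < d := by
          by_contra h'
          have := Nat.mul_le_mul_left a (show d ≤ 1 by omega)
          omega
        have := Nat.mul_le_mul_left a h1
        simp only [Nat.succ_eq_add_one] at this
        omega
    · exact h
  rw [Nat.mul_div_cancel_left _ hb0]
  refine ⟨?_, hc⟩
  rw [Nat.le_div_iff_mul_le (by omega)]
  have := Nat.mul_le_mul_left b hc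
  omega

theorem best_spec (f : Finset α → ℝ) (L : List (Finset (Ground α k))) :
    ((best L).run f ∈ L ∨ (best L).run f = ∅) ∧
    (∀ A ∈ L, extendFn k f A ≤ extendFn k f ((best L).run f)) ∧
    (best L).queries f ≤ L.length := by
  have er : (best L).run f =
      ((L.map fun S => (S, extendFn k f S)).argmax Prod.snd).elim ∅ Prod.fst := by
    simp [best]
  refine ⟨?_, ?_, ?_⟩
  · rw [er]
    rcases h : (L.map fun S => (S, extendFn k f S)).argmax Prod.snd with _ | p
    · right; rfl
    · left
      have := List.argmax_mem h
      rw [List.mem_map] at this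
      obtain ⟨A, hA, rfl⟩ := this
      exact hA
  · intro A hA
    rw [er]
    have hmem : (A, extendFn k f A) ∈ L.map fun S => (S, extendFn k f S) :=
      List.mem_map.2 ⟨A, hA, rfl⟩
    rcases h : (L.map fun S => (S, extendFn k f S)).argmax Prod.snd with _ | p
    · rw [List.argmax_eq_none] at h
      rw [h] at hmem
      simp at hmem
    · have h1 := List.le_of_mem_argmax hmem h
      have h2 := List.argmax_mem h
      rw [List.mem_map] at h2
      obtain ⟨B, hB, rfl⟩ := h2
      exact h1
  · have := queries_forEach_le f (fun S : Finset (Ground α k) => (value S).bind fun r => ret (S, r))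
      L 1 (by intro b _; simp)
    simpa [best] using this

/-- The bound on the best candidate solution guided by `Z`, in terms of the guidance set `Z`. -/
theorem guided_value_ge {ℓ : ℕ} (hf : IsSubmodular f) (h0 : ∀ S, 0 ≤ f S) (hε : 0 < ε)
    (hε1 : ε < 0.377) (hℓ5 : 5 ≤ ε * ℓ) (hk : 0 < k) (hℓ : ℓ ∣ k) (h2 : 2 ≤ k / ℓ)
    (O Z : Finset (Ground α k)) (hO : O.card ≤ k) (hZ : Z.card ≤ k)
    (hX : 0 < extendFn k f O) (hOZ : extendFn k f (O ∩ Z) ≤ extendFn k f Z)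
    (hZ1 : extendFn k f Z ≤ 0.377 * extendFn k f O)
    (hb1 : extendFn k f (O ∪ Z) ≤ 0.92 * extendFn k f O) :
    ∃ A ∈ (guidedSets (ε / 2) (3 / 10) ℓ Z).run f,
      (0.4762 - ε) * extendFn k f O - 0.1288 * extendFn k f Z - 0.1085 * extendFn k f (O ∪ Z) ≤
        extendFn k f A := by
  have hℓ0 : 0 < ℓ := Nat.pos_of_ne_zero fun h => by simp [h] at h2
  have hℓ1 : (1 : ℝ) ≤ ℓ := by exact_mod_cast hℓ0
  have hT : ⌊(3 / 10 : ℝ) * ℓ⌋₊ ≤ ℓ := by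
    have h1 := Nat.floor_le (show 0 ≤ (3 / 10 : ℝ) * ℓ by positivity)
    have h3 : ((⌊(3 / 10 : ℝ) * ℓ⌋₊ : ℕ) : ℝ) ≤ ℓ := by linarith
    exact_mod_cast h3
  obtain ⟨g, D, e, g0, D0, hg, hD, he0, hg', he, A, hA, hgA⟩ :=
    exists_guided_averages (t := 3 / 10) hf h0 (show 0 < ε / 2 by linarith)
      (show ε / 2 < 1 by linarith) hk hℓ h2 O Z hO hZ hT
  set X := extendFn k f O with hXdef
  set a := extendFn k f (O ∩ Z) with ha
  set b := extendFn k f (O ∪ Z) with hb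
  set κ := rate (ε / 2) ℓ with hκ
  have hκ0 : 0 ≤ κ := rate_nonneg (by linarith) (by linarith) ℓ
  have hq0 : 0 ≤ 1 - 1 / (ℓ : ℝ) := by
    rw [sub_nonneg, div_le_one (by linarith)]; exact hℓ1
  have ha0 : 0 ≤ a := h0 _
  have hb0 : 0 ≤ b := h0 _
  have haX : a / X ≤ 0.377 := by rw [div_le_iff₀ hX]; linarith
  have hbX : b / X ≤ 0.92 := by rw [div_le_iff₀ hX]; linarith
  -- All averages are divided by F(O), so that the optimum becomes 1.
  have hrec := guided_recursion (X := 1) (a := a / X) (b := b / X) (g := fun i => g i / X)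
    (D := fun i => D i / X) (e := fun i => e i / X) hκ0 hq0
    (one_sub_inv_mul_le (by linarith) hℓ0) (div_nonneg hb0 hX.le) (by
      have h1 : (1 - (1 - 1 / (ℓ : ℝ)) ^ ⌊(3 / 10 : ℝ) * ℓ⌋₊) * (b / X) ≤ 1 * (b / X) :=
        mul_le_mul_of_nonneg_right (by linarith [pow_nonneg hq0 ⌊(3 / 10 : ℝ) * ℓ⌋₊])
          (div_nonneg hb0 hX.le)
      linarith) hT (div_nonneg g0 hX.le) (by rw [D0]) (by
      intro i hi
      refine le_of_eq_of_le ?_ ((div_le_div_of_nonneg_right (hg i hi) hX.le).trans_eq ?_)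
      · field_simp
      · ring) (by
      intro i hi
      refine le_of_eq_of_le ?_ (div_le_div_of_nonneg_right (hD i hi) hX.le)
      ring) (by
      refine le_of_eq_of_le ?_ (div_le_div_of_nonneg_right he0 hX.le)
      field_simp) (by
      intro i hi hi'
      refine le_of_eq_of_le ?_ ((div_le_div_of_nonneg_right (hg' i hi hi') hX.le).trans_eq ?_)
      · ring
      · ring) (by
      intro i hi hi'
      refine le_of_eq_of_le ?_ (div_le_div_of_nonneg_right (he i hi hi') hX.le)
      ring)
  have hnum := guided_numeric hε hε1 hℓ5 (div_nonneg ha0 hX.le) haX (div_nonneg hb0 hX.le) hbX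
  have h3 := hnum.trans hrec
  rw [le_div_iff₀ hX] at h3
  have e1 : a / X * X = a := div_mul_cancel₀ _ hX.ne'
  have e2 : b / X * X = b := div_mul_cancel₀ _ hX.ne'
  have e3 : (0.4762 - ε - 0.1288 * (a / X) - 0.1085 * (b / X)) * X =
      (0.4762 - ε) * X - 0.1288 * (a / X * X) - 0.1085 * (b / X * X) := by ring
  rw [e3, e1, e2] at h3
  exact ⟨A, hA, by linarith⟩

/-- If a linear inequality holds for all guidance sets, then one of them has a large value. -/
theorem exists_guidance_value_ge {ℓ : ℕ} (hf : IsSubmodular f) (h0 : ∀ S, 0 ≤ f S) (hε : 0 < ε)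
    (hε1 : ε < 0.377) (hℓ10 : 10 ≤ 3 * (ε * ℓ)) (hk : 0 < k) (hℓ : ℓ ∣ k) (h2 : 2 ≤ k / ℓ)
    (O : Finset (Ground α k)) (hO : O.card ≤ k) (hX : 0 < extendFn k f O)
    (hlin : ∀ Z ∈ (guidanceSets (ε / 2) ℓ ℓ [∅]).run f,
      0.0992 * extendFn k f O ≤ 0.1288 * extendFn k f Z + 0.1085 * extendFn k f (O ∪ Z))
    {y : ℝ} (hy : ∀ Z ∈ (guidanceSets (ε / 2) ℓ ℓ [∅]).run f, extendFn k f Z ≤ y) :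
    (0.377 - ε) * extendFn k f O ≤ y := by
  have hL8 : (8 : ℝ) < ℓ := by
    have h1 : ε * ℓ ≤ 0.377 * ℓ := mul_le_mul_of_nonneg_right hε1.le (Nat.cast_nonneg _)
    linarith
  have hℓ8 : 8 < ℓ := by exact_mod_cast hL8
  obtain ⟨z, b, z0, b0, hz, hb, hconv⟩ := exists_guidance_averages hf h0
    (show 0 < ε / 2 by linarith) (show ε / 2 < 1 by linarith) hk hℓ h2 O hO
  have h3 := hconv _ _ _ hlin
  -- The transfer to averages, applied to F(Z) ≤ y: the averages are also at most y.
  have h4 := hconv (-1) 0 (-y) (fun Z hZ => by linarith [hy Z hZ])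
  set X := extendFn k f O with hXdef
  set κ := rate (ε / 2) ℓ with hκ
  set q : ℝ := 1 - 1 / ℓ with hq
  set c₀ : ℝ := 0.0992 / 0.1085 with hc₀
  set c₁ : ℝ := 0.1288 / 0.1085 with hc₁
  have hκ0 : 0 ≤ κ := rate_nonneg (by linarith) (by linarith) ℓ
  have hq0 : 0 ≤ q := by
    rw [hq, sub_nonneg, div_le_one (by linarith)]; linarith
  have hc₁0 : 0 ≤ c₁ := by rw [hc₁]; norm_num
  have hden : 0 < 1 + q * c₁ := by linarith [mul_nonneg hq0 hc₁0]
  have hzs : q * c₀ / (1 + q * c₁) * (1 + q * c₁) = q * c₀ := div_mul_cancel₀ _ hden.ne'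
  obtain ⟨h5, h6⟩ := guidance_numeric hε hε1 hℓ10 hq hκ hc₀ hc₁ hzs
  have hrec := guidance_recursion (z := fun i => z i / X) (b := fun i => b i / X) (m := ℓ / 2)
    (c₀ := c₀) hκ0 hq0 (one_sub_inv_mul_le (by linarith) (by omega)) (by omega)
    (Nat.div_le_self _ _) hzs h5 (div_nonneg z0 hX.le) (by rw [b0]; exact div_self hX.ne') (by
      intro i hi
      refine le_of_eq_of_le ?_ ((div_le_div_of_nonneg_right (hz i hi) hX.le).trans_eq ?_)
      · ring
      · ring) (by
      intro i hi
      refine le_of_eq_of_le ?_ (div_le_div_of_nonneg_right (hb i hi) hX.le)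
      ring) (by
      intro i hi
      rw [le_div_iff₀ hX, sub_mul, mul_assoc, div_mul_cancel₀ _ hX.ne', hc₀, hc₁]
      have := h3 i hi
      linarith)
  have h7 := h6.trans hrec
  rw [le_div_iff₀ hX] at h7
  have h8 := h4 (ℓ - 1) (by omega)
  rw [Nat.sub_add_cancel (by omega)] at h8
  linarith

theorem run_nearlyLinearAlg (f : Finset α → ℝ) : (nearlyLinearAlg α k ε).run f =
    ((best ((guidanceSets (k := k) (ε / 2) (ell₁ ε) (ell₁ ε) [∅]).run f ++
      (((guidanceSets (k := k) (ε / 2) (ell₁ ε) (ell₁ ε) [∅]).run f).map fun Z =>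
        (guidedSets (ε / 2) (3 / 10) (ell₂ ε) Z).run f).flatten)).run f).toLeft := by
  simp only [nearlyLinearAlg, run_bind, run_forEach, run_ret]

/-- By contradiction: were the output below 0.377 - ε, the bound 0.4762 - ε for guided sets would
leave the linear inequality with 0.4762 - 0.377 = 0.0992 for every guidance set, and then one of
them beats the output. -/
theorem nearlyLinearAlg_card_and_value (hf : IsSubmodular f) (h0 : ∀ S, 0 ≤ f S) (hε : 0 < ε)
    (hε1 : ε < 0.377) (hk : 0 < k) (h1 : ell₁ ε ∣ k) (h2 : ell₂ ε ∣ k) :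
    ((nearlyLinearAlg α k ε).run f).card ≤ k ∧
    ∀ O : Finset α, O.card ≤ k → (0.377 - ε) * f O ≤ f ((nearlyLinearAlg α k ε).run f) := by
  obtain ⟨d1, d2⟩ := two_le_div_of_dvd hk h1 h2 (ell₁_lt_ell₂ hε (by linarith))
    (ell₂_lt_two_mul hε (by linarith))
  have hε2 : 0 < ε / 2 := by linarith
  have hε3 : ε / 2 < 1 := by linarith
  obtain ⟨hZs, -, -⟩ := guidanceSets_all hf hε2 hε3 hk h1 d1 (ell₁ ε) 0 (by omega) [∅]
    (by simp)
  rw [run_nearlyLinearAlg]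
  set Zs := (guidanceSets (k := k) (ε / 2) (ell₁ ε) (ell₁ ε) [∅]).run f with hZsdef
  set All := Zs ++ (Zs.map fun Z => (guidedSets (ε / 2) (3 / 10) (ell₂ ε) Z).run f).flatten
    with hAll
  have hmemAll : ∀ Z ∈ Zs, ∀ A ∈ (guidedSets (ε / 2) (3 / 10) (ell₂ ε) Z).run f, A ∈ All := by
    intro Z hZ A hA
    refine List.mem_append_right _ ?_
    rw [List.mem_flatten]
    exact ⟨_, List.mem_map.2 ⟨Z, hZ, rfl⟩, hA⟩
  obtain ⟨hb1, hb2, -⟩ := best_spec f All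
  refine ⟨?_, ?_⟩
  · refine le_trans (Finset.card_toLeft_le (u := (best All).run f)) ?_
    rcases hb1 with h | h
    · rcases List.mem_append.1 h with h | h
      · exact (hZs _ h).1
      · rw [List.mem_flatten] at h
        obtain ⟨L, hL, hA⟩ := h
        obtain ⟨Z, hZ, rfl⟩ := List.mem_map.1 hL
        rw [guidedSets_eq] at hA
        refine ((guidedFamily_all hf hε2 hε3 hk h2 d2 (hZs Z hZ).1 _ le_rfl).1 _ hA).trans ?_
        exact (Nat.mul_div_cancel' h2).le
    · rw [h]; simp
  · intro O hO
    set O' : Finset (Ground α k) := O.map ⟨Sum.inl, Sum.inl_injective⟩ with hO'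
    have hFO : extendFn k f O' = f O := by
      unfold extendFn
      congr 1
      ext x
      simp [hO']
    have hO'card : O'.card ≤ k := by rw [hO', Finset.card_map]; exact hO
    change (0.377 - ε) * f O ≤ extendFn k f ((best All).run f)
    by_contra hcon
    push Not at hcon
    have hX : 0 < f O := by
      rcases (h0 O).lt_or_eq with h | h
      · exact h
      · rw [← h, mul_zero] at hcon
        exact absurd (h0 _) (not_le.2 hcon)
    rw [← hFO] at hcon hX
    set X := extendFn k f O' with hXdef
    have hεX : 0 < ε * X := mul_pos hε hX
    refine absurd (exists_guidance_value_ge hf h0 hε hε1 (ten_le_ell₁ hε) hk h1 d1 O' hO'card hX ?_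
      (fun Z hZ => hb2 Z (List.mem_append_left _ hZ))) (not_le.2 hcon)
    intro Z hZ
    have hFZ := hb2 Z (List.mem_append_left _ hZ)
    have hFZ0 : 0 ≤ extendFn k f Z := h0 _
    by_cases hb : extendFn k f (O' ∪ Z) ≤ 0.92 * X
    · obtain ⟨A, hA, hval⟩ := guided_value_ge hf h0 hε hε1 (five_le_ell₂ hε) hk h2 d2 O' Z hO'card
        (hZs Z hZ).1 hX ((hZs Z hZ).2 _ Finset.inter_subset_right) (by linarith) hb
      have := hb2 A (hmemAll Z hZ A hA)
      linarith
    -- Here the linear inequality is free: 0.1085 * 0.92 > 0.0992.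
    · push Not at hb
      linarith

theorem callCost_le (ℓ : ℕ) (hℓ : 0 < ℓ) (ε' : ℝ) :
    callCost α k ε' ℓ ≤
      4 * (Fintype.card α + 3 * k) * (levelBound ε' k + 1) * (ℓ * (ℓ + 1)) := by
  unfold callCost
  have h1 : 1 ≤ (levelBound ε' k + 1) * (ℓ * (ℓ + 1)) :=
    Nat.succ_le_of_lt (by positivity)
  have h2 := Nat.mul_le_mul_left (2 * (Fintype.card α + 3 * k)) h1
  linarith

/-- At most 2 * P₁ guides each cost 8 * NB * P₂; the guidance tree and the final comparison cost at
most 12 * NB * P₁ and 2 * P₁ + 2 * P₁ * P₂. Together this stays below 32 * NB * P₁ * P₂. -/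
theorem queries_nearlyLinearAlg_le (hf : IsSubmodular f) (hε : 0 < ε)
    (hε1 : ε < 0.377) (hk : 0 < k) (h1 : ell₁ ε ∣ k) (h2 : ell₂ ε ∣ k) :
    (nearlyLinearAlg α k ε).queries f ≤
      32 * ((Fintype.card α + 3 * k) * (levelBound (ε / 2) k + 1)) *
        ((ell₁ ε * (ell₁ ε + 1)) ^ ell₁ ε * (ell₂ ε * (ell₂ ε + 1)) ^ ell₂ ε) := by
  obtain ⟨d1, d2⟩ := two_le_div_of_dvd hk h1 h2 (ell₁_lt_ell₂ hε (by linarith))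
    (ell₂_lt_two_mul hε (by linarith))
  have hε2 : 0 < ε / 2 := by linarith
  have hε3 : ε / 2 < 1 := by linarith
  obtain ⟨hZs, hlen, hq⟩ := guidanceSets_all hf hε2 hε3 hk h1 d1 (ell₁ ε) 0 (by omega) [∅]
    (by simp)
  have hq0 : (nearlyLinearAlg α k ε).queries f =
      (guidanceSets (k := k) (ε / 2) (ell₁ ε) (ell₁ ε) [∅]).queries f +
      ((forEach (guidedSets (ε / 2) (3 / 10) (ell₂ ε))
        ((guidanceSets (k := k) (ε / 2) (ell₁ ε) (ell₁ ε) [∅]).run f)).queries f +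
      (best ((guidanceSets (k := k) (ε / 2) (ell₁ ε) (ell₁ ε) [∅]).run f ++
      (((guidanceSets (k := k) (ε / 2) (ell₁ ε) (ell₁ ε) [∅]).run f).map fun Z =>
        (guidedSets (ε / 2) (3 / 10) (ell₂ ε) Z).run f).flatten)).queries f) := by
    simp only [nearlyLinearAlg, queries_bind, run_forEach, queries_ret, add_zero]
  rw [hq0]
  set Zs := (guidanceSets (k := k) (ε / 2) (ell₁ ε) (ell₁ ε) [∅]).run f with hZsdef
  have hℓ1 : 0 < ell₁ ε := Nat.pos_of_dvd_of_pos h1 hk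
  have hℓ2 : 0 < ell₂ ε := Nat.pos_of_dvd_of_pos h2 hk
  set NB := (Fintype.card α + 3 * k) * (levelBound (ε / 2) k + 1) with hNB
  set s₁ := ell₁ ε * (ell₁ ε + 1) with hs₁
  set s₂ := ell₂ ε * (ell₂ ε + 1) with hs₂
  have hs₁0 : 0 < s₁ := by positivity
  have hs₂0 : 0 < s₂ := by positivity
  set P₁ := s₁ ^ ell₁ ε with hP₁
  set P₂ := s₂ ^ ell₂ ε with hP₂
  have hP₁0 : 1 ≤ P₁ := Nat.one_le_pow _ _ hs₁0
  have hP₂0 : 1 ≤ P₂ := Nat.one_le_pow _ _ hs₂0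
  have hN : Fintype.card α + 3 * k ≤ NB := Nat.le_mul_of_pos_right _ (Nat.succ_pos _)
  have hNB1 : 1 ≤ NB := by omega
  have hc₁ : callCost α k (ε / 2) (ell₁ ε) ≤ 4 * NB * s₁ :=
    (callCost_le _ hℓ1 _).trans_eq (by rw [hNB, hs₁]; ring)
  have hc₂ : callCost α k (ε / 2) (ell₂ ε) ≤ 4 * NB * s₂ :=
    (callCost_le _ hℓ2 _).trans_eq (by rw [hNB, hs₂]; ring)
  have hlenZ : Zs.length ≤ 2 * P₁ := by
    simp only [List.length_singleton, mul_one] at hlen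
    omega
  have hq1 : (guidanceSets (k := k) (ε / 2) (ell₁ ε) (ell₁ ε) [∅]).queries f ≤ 12 * NB * P₁ := by
    simp only [List.length_singleton, mul_one] at hq
    have h3 : callCost α k (ε / 2) (ell₁ ε) + s₁ * (2 * (Fintype.card α + 3 * k)) ≤
        s₁ * (6 * NB) := by
      have := Nat.mul_le_mul_left (2 * s₁) hN
      linarith
    have h4 := Nat.mul_le_mul_right P₁ (Nat.mul_le_mul_left 2 h3)
    refine Nat.le_of_mul_le_mul_left (?_ : s₁ * _ ≤ s₁ * _) hs₁0
    exact ((Nat.le_add_right _ _).trans hq).trans (h4.trans_eq (by ring))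
  have hgf := fun Z hZ => guidedFamily_all (t := 3 / 10) hf hε2 hε3 hk h2 d2 (hZs Z hZ).1 _ le_rfl
  have hq2 : (forEach (guidedSets (ε / 2) (3 / 10) (ell₂ ε)) Zs).queries f ≤
      Zs.length * (8 * NB * P₂) := by
    apply queries_forEach_le
    intro Z hZ
    rw [guidedSets_eq]
    have h3 := (hgf Z hZ).2.2
    have h4 := Nat.mul_le_mul_right P₂ (Nat.mul_le_mul_left 2 hc₂)
    refine Nat.le_of_mul_le_mul_left (?_ : s₂ * _ ≤ s₂ * _) hs₂0
    exact ((Nat.le_add_right _ _).trans h3).trans (h4.trans_eq (by ring))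
  have hq3 := (best_spec f (Zs ++ (Zs.map fun Z =>
    (guidedSets (ε / 2) (3 / 10) (ell₂ ε) Z).run f).flatten)).2.2
  have hlenflat : ((Zs.map fun Z => (guidedSets (ε / 2) (3 / 10) (ell₂ ε) Z).run f).flatten).length
      = Zs.length * P₂ := by
    rw [← List.flatMap_def]
    apply length_flatMap_eq
    intro Z hZ
    rw [guidedSets_eq]
    exact (hgf Z hZ).2.1
  rw [List.length_append, hlenflat] at hq3
  have h5 : Zs.length * (8 * NB * P₂) ≤ 2 * P₁ * (8 * NB * P₂) := Nat.mul_le_mul_right _ hlenZ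
  have h6 : Zs.length * P₂ ≤ 2 * P₁ * P₂ := Nat.mul_le_mul_right _ hlenZ
  have h7 : P₁ ≤ P₁ * P₂ := Nat.le_mul_of_pos_right _ hP₂0
  have h8 : P₁ * P₂ ≤ NB * (P₁ * P₂) := Nat.le_mul_of_pos_left _ hNB1
  have h9 : NB * P₁ ≤ NB * (P₁ * P₂) := Nat.mul_le_mul_left _ h7
  linarith

/-- The quotient of the two powers is (1 + 1/ℓ) ^ ℓ ≤ e < 3. -/
theorem mul_succ_pow_le (ℓ : ℕ) (hℓ : 0 < ℓ) :
    (((ℓ * (ℓ + 1)) ^ ℓ : ℕ) : ℝ) ≤ 3 * (ℓ : ℝ) ^ (2 * ℓ) := by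
  have hℓR : (0 : ℝ) < ℓ := by exact_mod_cast hℓ
  have h1 : (1 + 1 / (ℓ : ℝ)) ^ ℓ ≤ 3 := by
    have h2 : 1 + 1 / (ℓ : ℝ) ≤ Real.exp (1 / ℓ) := by linarith [Real.add_one_le_exp (1 / (ℓ : ℝ))]
    have h3 := pow_le_pow_left₀ (by positivity) h2 ℓ
    rw [← Real.exp_nat_mul, mul_one_div_cancel hℓR.ne'] at h3
    linarith [Real.exp_one_lt_d9]
  have e : (((ℓ * (ℓ + 1)) ^ ℓ : ℕ) : ℝ) = (ℓ : ℝ) ^ (2 * ℓ) * (1 + 1 / (ℓ : ℝ)) ^ ℓ := by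
    push_cast
    have h2 : (ℓ : ℝ) * (ℓ + 1) = ℓ * ℓ * (1 + 1 / (ℓ : ℝ)) := by field_simp
    rw [h2, mul_pow, mul_pow, two_mul, pow_add]
  rw [e, mul_comm]
  exact mul_le_mul_of_nonneg_right h1 (by positivity)

/-- As k ≥ 5/ε, the factor 2/ε inside the logarithm is at most k, so it only doubles log k. The
roundings are absorbed because log k ≥ 1. -/
theorem levelBound_le (hε : 0 < ε) (hε1 : ε < 0.377) (hk : 5 ≤ ε * (k : ℝ)) :
    ((levelBound (ε / 2) k + 1 : ℕ) : ℝ) ≤ 7 * Real.log k / ε := by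
  have hk13 : (13 : ℝ) < k := by
    have h1 : ε * k ≤ 0.377 * k := mul_le_mul_of_nonneg_right hε1.le (Nat.cast_nonneg _)
    linarith
  have hlog1 : 1 ≤ Real.log k := by
    rw [Real.le_log_iff_exp_le (by linarith)]
    linarith [Real.exp_one_lt_d9]
  have hlog : Real.log (k / (ε / 2)) ≤ 2 * Real.log k := by
    have e : 2 * Real.log k = Real.log ((k : ℝ) ^ 2) := by rw [Real.log_pow]; norm_num
    rw [e]
    apply Real.log_le_log (by positivity)
    rw [div_le_iff₀ (by linarith)]
    have := mul_le_mul_of_nonneg_right hk (show (0 : ℝ) ≤ k by linarith)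
    linarith
  have hceil := Nat.ceil_lt_add_one (show 0 ≤ Real.log (k / (ε / 2)) / (ε / 2) by
    apply div_nonneg (Real.log_nonneg _) (by linarith)
    rw [le_div_iff₀ (by linarith)]
    linarith)
  have h1 : Real.log (k / (ε / 2)) / (ε / 2) ≤ 4 * Real.log k / ε := by
    rw [div_le_div_iff₀ (by linarith) hε]
    have := mul_le_mul_of_nonneg_right hlog hε.le
    linarith
  have h2 : 3 ≤ 3 * Real.log k / ε := by
    rw [le_div_iff₀ hε]
    linarith
  have e : 7 * Real.log k / ε = 4 * Real.log k / ε + 3 * Real.log k / ε := by ring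
  unfold levelBound
  push_cast
  linarith

end Final

end SubMax

theorem mainTheorem3 :
    ∃ C : ℝ, 0 < C ∧
      ∀ (α : Type*) [Fintype α] [LinearOrder α] (f : Finset α → ℝ) (k : ℕ) (ε : ℝ),
        (∀ S, 0 ≤ f S) → SubMax.IsSubmodular f →
        0 < k → k ≤ Fintype.card α →
        0 < ε → ε < 0.377 →
        SubMax.ell₁ ε ∣ k → SubMax.ell₂ ε ∣ k →
        ((SubMax.nearlyLinearAlg α k ε).run f).card ≤ k ∧
        (∀ O : Finset α, O.card ≤ k →
          (0.377 - ε) * f O ≤ f ((SubMax.nearlyLinearAlg α k ε).run f)) ∧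
        ((SubMax.nearlyLinearAlg α k ε).queries f : ℝ) ≤
          C / ε ^ 2 * (Fintype.card α * Real.log k *
            (SubMax.ell₁ ε : ℝ) ^ (2 * SubMax.ell₁ ε) *
            (SubMax.ell₂ ε : ℝ) ^ (2 * SubMax.ell₂ ε - 1)) := by
  -- 48384 = 32 * 4 * 7 * 3 * 3 * 6, the constants of the final estimate.
  refine ⟨48384, by norm_num, ?_⟩
  intro α _ _ f k ε h0 hf hk hkn hε hε1 h1 h2
  obtain ⟨hcard, hval⟩ := SubMax.nearlyLinearAlg_card_and_value hf h0 hε hε1 hk h1 h2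
  refine ⟨hcard, hval, ?_⟩
  have hq := SubMax.queries_nearlyLinearAlg_le hf hε hε1 hk h1 h2
  have hℓ₁ : 0 < SubMax.ell₁ ε := Nat.pos_of_dvd_of_pos h1 hk
  have hℓ₂ : 0 < SubMax.ell₂ ε := Nat.pos_of_dvd_of_pos h2 hk
  have hkε : 5 ≤ ε * (k : ℝ) := by
    have h3 : (SubMax.ell₂ ε : ℝ) ≤ k := by exact_mod_cast Nat.le_of_dvd hk h2
    exact (SubMax.five_le_ell₂ hε).trans (mul_le_mul_of_nonneg_left h3 hε.le)
  have hB := SubMax.levelBound_le hε hε1 hkε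
  have hP₁ := SubMax.mul_succ_pow_le _ hℓ₁
  have hP₂ := SubMax.mul_succ_pow_le _ hℓ₂
  have hlog : 0 ≤ Real.log k := Real.log_natCast_nonneg k
  have hℓ₂R : (SubMax.ell₂ ε : ℝ) ≤ 6 / ε := by
    rw [le_div_iff₀ hε]
    linarith [SubMax.ell₂_mul_lt hε]
  have hN : ((Fintype.card α + 3 * k : ℕ) : ℝ) ≤ 4 * Fintype.card α := by
    exact_mod_cast (by omega : Fintype.card α + 3 * k ≤ 4 * Fintype.card α)
  -- One factor ℓ₂ ≤ 6/ε is split off to reach the exponent 2ℓ₂ - 1. It supplies the second power of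
  -- 1/ε; the first comes from the number of threshold levels.
  have hpow : (SubMax.ell₂ ε : ℝ) ^ (2 * SubMax.ell₂ ε) =
      SubMax.ell₂ ε * (SubMax.ell₂ ε : ℝ) ^ (2 * SubMax.ell₂ ε - 1) := by
    rw [← pow_succ']
    congr 1
    omega
  have hP₂' : (((SubMax.ell₂ ε * (SubMax.ell₂ ε + 1)) ^ SubMax.ell₂ ε : ℕ) : ℝ) ≤
      3 * (6 / ε * (SubMax.ell₂ ε : ℝ) ^ (2 * SubMax.ell₂ ε - 1)) := by
    refine hP₂.trans ?_
    rw [hpow]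
    exact mul_le_mul_of_nonneg_left (mul_le_mul_of_nonneg_right hℓ₂R (by positivity)) (by norm_num)
  calc ((SubMax.nearlyLinearAlg α k ε).queries f : ℝ)
      ≤ ((32 * ((Fintype.card α + 3 * k) * (SubMax.levelBound (ε / 2) k + 1)) *
        ((SubMax.ell₁ ε * (SubMax.ell₁ ε + 1)) ^ SubMax.ell₁ ε *
          (SubMax.ell₂ ε * (SubMax.ell₂ ε + 1)) ^ SubMax.ell₂ ε) : ℕ) : ℝ) := by
        exact_mod_cast hq
    _ = 32 * (((Fintype.card α + 3 * k : ℕ) : ℝ) * ((SubMax.levelBound (ε / 2) k + 1 : ℕ) : ℝ)) *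
        ((((SubMax.ell₁ ε * (SubMax.ell₁ ε + 1)) ^ SubMax.ell₁ ε : ℕ) : ℝ) *
          (((SubMax.ell₂ ε * (SubMax.ell₂ ε + 1)) ^ SubMax.ell₂ ε : ℕ) : ℝ)) := by
        push_cast; ring
    _ ≤ 32 * ((4 * Fintype.card α) * (7 * Real.log k / ε)) *
        ((3 * (SubMax.ell₁ ε : ℝ) ^ (2 * SubMax.ell₁ ε)) *
          (3 * (6 / ε * (SubMax.ell₂ ε : ℝ) ^ (2 * SubMax.ell₂ ε - 1)))) := by
        gcongr
    _ = _ := by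
        field_simp
        ring
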